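/- Let $g>0$, $\beta>0$, $n\ge 1$, and write $\underline{\boldsymbol x}_k=x_1+\dots+x_k$ for $\boldsymbol x_k=(x_1,\dots,x_k)\in\mathbb R^k$. For $\lambda\in\mathbb C$ and $t\in\mathbb R$ put $$w_\lambda(t)=(1+\beta e^{-t})^{-i\lambda-g}\,(1-\beta e^{-t})^{-i\lambda+g-1}\,\theta(t-\ln\beta),$$ where $\theta$ is the Heaviside step function. For $k\ge1$ and $\lambda\in\mathbb R$ let $\mathbb\Lambda_k(\lambda)$ be the integral operator taking functions $\phi$ on $\mathbb R^{k-1}$ to functions on $\mathbb R^k$, $$[\mathbb\Lambda_k(\lambda)\phi](\boldsymbol x_k)=\int_{\mathbb R^{k-1}}d\boldsymbol y_{k-1}\,\mathbb\Lambda_\lambda(\boldsymbol x_k|\boldsymbol y_{k-1})\,\phi(\boldsymbol y_{k-1}),$$ $$\mathbb\Lambda_\lambda(\boldsymbol x_k|\boldsymbol y_{k-1})=\frac{(2\beta)^{i\lambda}}{\Gamma(g-i\lambda)}\int_{\mathbb R^k}d\boldsymbol z_k\,w_\lambda(z_1)\exp\Bigl(i\lambda(\underline{\boldsymbol x}_k+\underline{\boldsymbol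 y}_{k-1}-2\underline{\boldsymbol z}_k)-\sum_{j=1}^{k-1}(e^{z_j-x_j}+e^{z_j-y_j}+e^{x_j-z_{j+1}}+e^{y_j-z_{j+1}})-e^{z_k-x_k}\Bigr),$$ and for $\boldsymbol\lambda_n=(\lambda_1,\dots,\lambda_n)\in\mathbb R^n$ let $\Psi_{\boldsymbol\lambda_n}=\mathbb\Lambda_n(\lambda_n)\cdots\mathbb\Lambda_1(\lambda_1)\cdot 1$ be the wave function of the $BC_n$ Toda chain. The Baxter operator $\mathbb Q_n(\lambda)$ and the reduced Baxter operator $\mathbb Q'_n(\lambda)$ are the integral operators $\phi\mapsto\int_{\mathbb R^n}d\boldsymbol y_n\,K(\boldsymbol x_n|\boldsymbol y_n)\,\phi(\boldsymbol y_n)$ whose kernels $K$ are, respectively, $$\mathbb Q_\lambda(\boldsymbol x_n|\boldsymbol y_n)=\frac{(2\beta)^{i\lambda}}{\Gamma(g-i\lambda)}\int_{\mathbb R^{n+1}}d\boldsymbol z_{n+1}\,w_\lambda(z_1)\exp\Bigl(i\lambda(\underline{\boldsymbol x}_n+\underline{\boldsymbol y}_n-2\underline{\boldsymbol z}_{n+1})-\sum_{j=1}^{n}(e^{z_j-x_j}+e^{z_j-y_j}+e^{x_j-z_{j+1}}+e^{y_j-z_{j+1}})\Bigr),$$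 $$\mathbb Q'_\lambda(\boldsymbol x_n|\boldsymbol y_n)=\frac{(2\beta)^{-i\lambda}}{\Gamma(g+i\lambda)}\int_{\mathbb R^{n}}d\boldsymbol z_{n}\,w_{-\lambda}(z_1)\exp\Bigl(i\lambda(2\underline{\boldsymbol z}_n-\underline{\boldsymbol x}_n-\underline{\boldsymbol y}_n)-\sum_{j=1}^{n-1}(e^{z_j-x_j}+e^{z_j-y_j}+e^{x_j-z_{j+1}}+e^{y_j-z_{j+1}})-e^{z_n-x_n}-e^{z_n-y_n}\Bigr).$$ Let $\boldsymbol\lambda_n\in\mathbb R^n$. Then all the integrals that define $\Psi_{\boldsymbol\lambda_n}$ converge absolutely; so do those that define $\mathbb Q_n(\lambda)\Psi_{\boldsymbol\lambda_n}$ if $\operatorname{Im}\lambda\in(-g,0)$ and those that define $\mathbb Q'_n(\lambda)\Psi_{\boldsymbol\lambda_n}$ if $\operatorname{Im}\lambda<0$; and for all $\boldsymbol x_n\in\mathbb R^n$ $$[\mathbb Q_n(\lambda)\Psi_{\boldsymbol\lambda_n}](\boldsymbol x_n)=\frac{(2\beta)^{-i\lambda}\,\Gamma(2i\lambda)}{\Gamma(g+i\lambda)}\prod_{j=1}^n\Gamma(i\lambda+i\lambda_j)\Gamma(i\lambda-i\lambda_j)\;\Psi_{\boldsymbol\lambda_n}(\boldsymbol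 x_n),\qquad \operatorname{Im}\lambda\in(-g,0),$$ $$[\mathbb Q'_n(\lambda)\Psi_{\boldsymbol\lambda_n}](\boldsymbol x_n)=\frac{(2\beta)^{-i\lambda}}{\Gamma(g+i\lambda)}\prod_{j=1}^n\Gamma(i\lambda+i\lambda_j)\Gamma(i\lambda-i\lambda_j)\;\Psi_{\boldsymbol\lambda_n}(\boldsymbol x_n),\qquad \operatorname{Im}\lambda<0.$$ -/

import Mathlib

namespace BCToda

noncomputable section

open MeasureTheory

/-- The Heaviside step function, with `θ 0 = 1`. -/
def heaviside (t : ℝ) : ℝ := if 0 ≤ t then 1 else 0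

/-- The boundary weight
`(1 + β e^{-t})^{-iλ-g} (1 - β e^{-t})^{-iλ+g-1} θ(t - ln β)`. -/
def boundaryWeight (g β : ℝ) (lam : ℂ) (t : ℝ) : ℂ :=
  ((1 + β * Real.exp (-t) : ℝ) : ℂ) ^ (-(Complex.I * lam) - (g : ℂ)) *
    ((1 - β * Real.exp (-t) : ℝ) : ℂ) ^ (-(Complex.I * lam) + (g : ℂ) - 1) *
    (heaviside (t - Real.log β) : ℂ)

/-- The integrand (in `z`) of the kernel of the raising operator from functions of `n` variables
to functions of `n + 1` variables. -/
def raisingIntegrand (g β : ℝ) (n : ℕ) (lam : ℂ)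
    (x : Fin (n + 1) → ℝ) (y : Fin n → ℝ) (z : Fin (n + 1) → ℝ) : ℂ :=
  boundaryWeight g β lam (z 0) *
    Complex.exp
      (Complex.I * lam * ((∑ j, x j + ∑ j, y j - 2 * ∑ j, z j : ℝ) : ℂ)
        - ((∑ j : Fin n,
              (Real.exp (z j.castSucc - x j.castSucc) + Real.exp (z j.castSucc - y j)
                + Real.exp (x j.castSucc - z j.succ) + Real.exp (y j - z j.succ))
            + Real.exp (z (Fin.last n) - x (Fin.last n)) : ℝ) : ℂ))

/-- The kernel of the raising operator from functions of `n` variables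
to functions of `n + 1` variables. -/
def raisingKernel (g β : ℝ) (n : ℕ) (lam : ℂ)
    (x : Fin (n + 1) → ℝ) (y : Fin n → ℝ) : ℂ :=
  (2 * (β : ℂ)) ^ (Complex.I * lam) / Complex.Gamma ((g : ℂ) - Complex.I * lam) *
    ∫ z : Fin (n + 1) → ℝ, raisingIntegrand g β n lam x y z

/-- The raising operator from functions of `n` variables to functions of `n + 1` variables. -/
def raisingOp (g β : ℝ) (n : ℕ) (lam : ℂ) (φ : (Fin n → ℝ) → ℂ) :
    (Fin (n + 1) → ℝ) → ℂ :=
  fun x => ∫ y : Fin n → ℝ, raisingKernel g β n lam x y * φ y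

/-- All integrals in the definition of `raisingOp g β n lam φ` converge absolutely. -/
def RaisingConverges (g β : ℝ) (n : ℕ) (lam : ℂ) (φ : (Fin n → ℝ) → ℂ) : Prop :=
  ∀ x : Fin (n + 1) → ℝ,
    (∀ y : Fin n → ℝ, Integrable (fun z => raisingIntegrand g β n lam x y z)) ∧
      Integrable (fun y : Fin n → ℝ => raisingKernel g β n lam x y * φ y)

/-- The wave function of the `BC` Toda chain with `n` particles: the raising operators with
parameters `lams 0, …, lams (n - 1)` applied successively to the constant function `1`. -/
def waveFunction (g β : ℝ) : (n : ℕ) → (Fin n → ℝ) → (Fin n → ℝ) → ℂ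
  | 0, _ => fun _ => 1
  | n + 1, lams =>
      raisingOp g β n (lams (Fin.last n) : ℂ) (waveFunction g β n (fun j => lams j.castSucc))

/-- All integrals in the iterative definition of the wave function converge absolutely. -/
def WaveFunctionConverges (g β : ℝ) : (n : ℕ) → (Fin n → ℝ) → Prop
  | 0, _ => True
  | n + 1, lams =>
      WaveFunctionConverges g β n (fun j => lams j.castSucc) ∧
        RaisingConverges g β n (lams (Fin.last n) : ℂ)
          (waveFunction g β n (fun j => lams j.castSucc))

/-- The integrand (in `z`) of the kernel of the Baxter operator in `n` variables. -/
def baxterIntegrand (g β : ℝ) (n : ℕ) (lam : ℂ)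
    (x y : Fin n → ℝ) (z : Fin (n + 1) → ℝ) : ℂ :=
  boundaryWeight g β lam (z 0) *
    Complex.exp
      (Complex.I * lam * ((∑ j, x j + ∑ j, y j - 2 * ∑ j, z j : ℝ) : ℂ)
        - ((∑ j : Fin n,
              (Real.exp (z j.castSucc - x j) + Real.exp (z j.castSucc - y j)
                + Real.exp (x j - z j.succ) + Real.exp (y j - z j.succ)) : ℝ) : ℂ))

/-- The kernel of the Baxter operator in `n` variables. -/
def baxterKernel (g β : ℝ) (n : ℕ) (lam : ℂ) (x y : Fin n → ℝ) : ℂ :=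
  (2 * (β : ℂ)) ^ (Complex.I * lam) / Complex.Gamma ((g : ℂ) - Complex.I * lam) *
    ∫ z : Fin (n + 1) → ℝ, baxterIntegrand g β n lam x y z

/-- The Baxter operator in `n` variables. -/
def baxterOp (g β : ℝ) (n : ℕ) (lam : ℂ) (φ : (Fin n → ℝ) → ℂ) : (Fin n → ℝ) → ℂ :=
  fun x => ∫ y : Fin n → ℝ, baxterKernel g β n lam x y * φ y

/-- All integrals in the definition of `baxterOp g β n lam φ` converge absolutely. -/
def BaxterConverges (g β : ℝ) (n : ℕ) (lam : ℂ) (φ : (Fin n → ℝ) → ℂ) : Prop :=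
  ∀ x : Fin n → ℝ,
    (∀ y : Fin n → ℝ, Integrable (fun z => baxterIntegrand g β n lam x y z)) ∧
      Integrable (fun y : Fin n → ℝ => baxterKernel g β n lam x y * φ y)

/-- The integrand (in `z`) of the kernel of the reduced Baxter operator in `n + 1` variables.
The spectral parameter enters with the opposite sign compared to `baxterIntegrand`. -/
def reducedBaxterIntegrand (g β : ℝ) (n : ℕ) (lam : ℂ)
    (x y z : Fin (n + 1) → ℝ) : ℂ :=
  boundaryWeight g β (-lam) (z 0) *
    Complex.exp
      (Complex.I * lam * ((2 * ∑ j, z j - ∑ j, x j - ∑ j, y j : ℝ) : ℂ)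
        - ((∑ j : Fin n,
              (Real.exp (z j.castSucc - x j.castSucc) + Real.exp (z j.castSucc - y j.castSucc)
                + Real.exp (x j.castSucc - z j.succ) + Real.exp (y j.castSucc - z j.succ))
            + Real.exp (z (Fin.last n) - x (Fin.last n))
            + Real.exp (z (Fin.last n) - y (Fin.last n)) : ℝ) : ℂ))

/-- The kernel of the reduced Baxter operator in `n + 1` variables. -/
def reducedBaxterKernel (g β : ℝ) (n : ℕ) (lam : ℂ) (x y : Fin (n + 1) → ℝ) : ℂ :=
  (2 * (β : ℂ)) ^ (-(Complex.I * lam)) / Complex.Gamma ((g : ℂ) + Complex.I * lam) *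
    ∫ z : Fin (n + 1) → ℝ, reducedBaxterIntegrand g β n lam x y z

/-- The reduced Baxter operator in `n + 1` variables. -/
def reducedBaxterOp (g β : ℝ) (n : ℕ) (lam : ℂ) (φ : (Fin (n + 1) → ℝ) → ℂ) :
    (Fin (n + 1) → ℝ) → ℂ :=
  fun x => ∫ y : Fin (n + 1) → ℝ, reducedBaxterKernel g β n lam x y * φ y

/-- All integrals in the definition of `reducedBaxterOp g β n lam φ` converge absolutely. -/
def ReducedBaxterConverges (g β : ℝ) (n : ℕ) (lam : ℂ) (φ : (Fin (n + 1) → ℝ) → ℂ) : Prop :=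
  ∀ x : Fin (n + 1) → ℝ,
    (∀ y : Fin (n + 1) → ℝ, Integrable (fun z => reducedBaxterIntegrand g β n lam x y z)) ∧
      Integrable (fun y : Fin (n + 1) → ℝ => reducedBaxterKernel g β n lam x y * φ y)

end

end BCToda

namespace BCToda

noncomputable section

open MeasureTheory

/-! For fixed x and y the auxiliary variables z of every kernel separate: z_1 gives a Whittaker-type
integral `boundary`, every other z_j a Macdonald integral `bessel`. A coefficient in the exponent
may vanish, and the Macdonald integral is then a Gamma function. Two symmetries carry the proof: the
reflection ν → -ν of the Macdonald index (`bessel_reflect`) and its counterpart at the boundary.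

The boundary symmetry concerns a double integral over two boundary variables z, u coupled by (e^z +
e^u)^{i(μ+ρ)}. The substitution e^z = r + p, e^u = r + q with pq = r² - β² turns it into a Macdonald
integral inside a Whittaker integral (`coupledBoundary_eq`); reflecting the inner index exchanges μ
and ρ (`coupledBoundary_swap`). For μ = -ρ the coupling disappears, and comparing the two forms
gives Kummer's transformation (`boundary_neg`). With the reflection of all Macdonald factors this
yields Q = Γ(2iλ) Q' already for the kernels (`baxterKernel_eq`), so only Q' remains.

For Q' the heart is the exchange relation Q'_n(λ) Λ_n(r) = Γ(iλ+ir) Γ(iλ-ir) Λ_n(r) Q'_{n-1}(λ) for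
n ≥ 2 (`kernel_exchange`); for n = 1 the scalar (2β)^{-iλ}/Γ(g+iλ) plays the role of Q'_0
(`kernel_exchange_one`). In either product the integral over the intermediate variables is a product
of Macdonald functions of the two rows z and u. Their indices are reflected and the integrals
reopened; the reflection factors telescope, so that only the boundary variables of the two rows stay
coupled. After integrating z and u out, the two sides agree pointwise in the new intermediate
variables (`coupled_exchange`). One Gamma factor comes from the last intermediate variable on the
left, the other from the last variable of u. Induction on n then produces the eigenvalue.

Convergence rests on one notion, `LocalKernel`: relative to the weight e^{sΣx}, the kernels of Λ
(for any s > 0) and of Q' (for 0 < s < -Im λ) are dominated by products of e^{-ε|y_j - p_j(x)|}.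
Such kernels preserve the functions of size O(e^{sΣx}), a class which contains every wave function,
and they may be composed by Fubini. -/

/-! ### Macdonald functions and their degenerations to Gamma functions -/

/-- The integrand `exp (ν t - A e^t - B e^{-t})` of the Macdonald function. -/
def besselIntegrand (ν : ℂ) (A B t : ℝ) : ℂ :=
  Complex.exp (ν * t - ((A * Real.exp t + B * Real.exp (-t) : ℝ) : ℂ))

/-- The two-sided Laplace form of the Macdonald function. -/
def bessel (ν : ℂ) (A B : ℝ) : ℂ := ∫ t : ℝ, besselIntegrand ν A B t

/-- The absolute value of `besselIntegrand`. -/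
def absBesselIntegrand (s A B t : ℝ) : ℝ :=
  Real.exp (s * t - (A * Real.exp t + B * Real.exp (-t)))

/-- The Macdonald function for a real index. -/
def absBessel (s A B : ℝ) : ℝ := ∫ t : ℝ, absBesselIntegrand s A B t

theorem norm_besselIntegrand (ν : ℂ) (A B t : ℝ) :
    ‖besselIntegrand ν A B t‖ = absBesselIntegrand ν.re A B t := by
  rw [besselIntegrand, absBesselIntegrand, Complex.norm_exp, Complex.sub_re, Complex.ofReal_re,
    Complex.re_mul_ofReal]

theorem measurable_besselIntegrand {Z : Type*} [MeasurableSpace Z] (ν : ℂ) {A B t : Z → ℝ}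
    (hA : Measurable A) (hB : Measurable B) (ht : Measurable t) :
    Measurable fun z => besselIntegrand ν (A z) (B z) (t z) := by
  unfold besselIntegrand; fun_prop

theorem measurable_absBesselIntegrand {Z : Type*} [MeasurableSpace Z] (s : ℝ) {A B t : Z → ℝ}
    (hA : Measurable A) (hB : Measurable B) (ht : Measurable t) :
    Measurable fun z => absBesselIntegrand s (A z) (B z) (t z) := by
  unfold absBesselIntegrand; fun_prop

theorem absBesselIntegrand_pos (s A B t : ℝ) : 0 < absBesselIntegrand s A B t := Real.exp_pos _

theorem absBessel_nonneg (s A B : ℝ) : 0 ≤ absBessel s A B :=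
  integral_nonneg fun t => (absBesselIntegrand_pos s A B t).le

theorem integrable_besselIntegrand_iff (ν : ℂ) (A B : ℝ) :
    Integrable (besselIntegrand ν A B) ↔ Integrable (absBesselIntegrand ν.re A B) := by
  rw [← integrable_norm_iff]
  · simp only [norm_besselIntegrand]
  · exact (measurable_besselIntegrand ν measurable_const measurable_const
      measurable_id).aestronglyMeasurable

theorem besselIntegrand_neg (ν : ℂ) (A B t : ℝ) :
    besselIntegrand ν A B (-t) = besselIntegrand (-ν) B A t := by
  simp only [besselIntegrand]; congr 1; push_cast; simp; ring

theorem absBesselIntegrand_neg (s A B t : ℝ) :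
    absBesselIntegrand s A B (-t) = absBesselIntegrand (-s) B A t := by
  simp only [absBesselIntegrand]; congr 1; simp; ring

theorem bessel_swap (ν : ℂ) (A B : ℝ) : bessel ν A B = bessel (-ν) B A := by
  rw [bessel, ← integral_neg_eq_self]
  simp only [besselIntegrand_neg]; rfl

theorem absBessel_swap (s A B : ℝ) : absBessel s A B = absBessel (-s) B A := by
  rw [absBessel, ← integral_neg_eq_self]
  simp only [absBesselIntegrand_neg]; rfl

/-- Reflection of the index of the Macdonald function. -/
theorem bessel_reflect (ν : ℂ) {A B : ℝ} (hA : 0 < A) (hB : 0 < B) :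
    bessel ν A B = Complex.exp (ν * (Real.log B - Real.log A : ℝ)) * bessel (-ν) A B := by
  -- The substitution t ↦ log(B/A) - t interchanges A e^t and B e^{-t}.
  have h : bessel ν A B = ∫ t, besselIntegrand ν A B ((Real.log B - Real.log A) - t) := by
    rw [integral_sub_left_eq_self (besselIntegrand ν A B) volume]; rfl
  rw [h, bessel, ← integral_const_mul]
  congr 1; ext t
  simp only [besselIntegrand]
  rw [← Complex.exp_add]
  congr 1
  have e1 : Real.exp (Real.log B - Real.log A - t) = B / A * Real.exp (-t) := by
    rw [sub_eq_add_neg, Real.exp_add, Real.exp_sub, Real.exp_log hA, Real.exp_log hB]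
  have e2 : Real.exp (-(Real.log B - Real.log A - t)) = A / B * Real.exp t := by
    rw [show -(Real.log B - Real.log A - t) = Real.log A - Real.log B + t by ring,
      Real.exp_add, Real.exp_sub, Real.exp_log hA, Real.exp_log hB]
  rw [e1, e2]
  have : A * (B / A * Real.exp (-t)) + B * (A / B * Real.exp t)
    = A * Real.exp t + B * Real.exp (-t) := by field_simp; ring
  rw [this]; push_cast; ring

theorem absBesselIntegrand_zero_eq {s A : ℝ} (t : ℝ) :
    absBesselIntegrand s A 0 t
      = |Real.exp t| • (Real.exp t ^ (s - 1) * Real.exp (-(A * Real.exp t))) := by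
  rw [absBesselIntegrand, abs_of_pos (Real.exp_pos _), smul_eq_mul, ← Real.exp_mul,
    ← Real.exp_add, ← Real.exp_add]
  congr 1; ring

theorem integrable_absBesselIntegrand_zero {s A : ℝ} (hs : 0 < s) (hA : 0 < A) :
    Integrable (absBesselIntegrand s A 0) := by
  have h := integrableOn_image_iff_integrableOn_abs_deriv_smul (s := Set.univ) (f := Real.exp)
    (f' := Real.exp) MeasurableSet.univ (fun x _ => (Real.hasDerivAt_exp x).hasDerivWithinAt)
    Real.exp_injective.injOn (fun t => t ^ (s - 1) * Real.exp (-(A * t)))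
  rw [Set.image_univ, Real.range_exp, integrableOn_univ] at h
  refine (h.1 ?_).congr (ae_of_all _ fun t => (absBesselIntegrand_zero_eq t).symm)
  have := integrableOn_rpow_mul_exp_neg_mul_rpow (p := 1) (s := s - 1) (b := A) (by linarith)
    one_pos hA
  simpa using this

theorem integrable_absBesselIntegrand_left {s A B : ℝ} (hs : 0 < s) (hA : 0 < A) (hB : 0 ≤ B) :
    Integrable (absBesselIntegrand s A B) := by
  refine (integrable_absBesselIntegrand_zero hs hA).mono'
    (measurable_absBesselIntegrand s measurable_const measurable_const
      measurable_id).aestronglyMeasurable (ae_of_all _ fun t => ?_)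
  rw [Real.norm_of_nonneg (absBesselIntegrand_pos _ _ _ _).le]
  refine Real.exp_le_exp.2 ?_
  have := mul_nonneg hB (Real.exp_pos (-t)).le
  linarith

theorem integrable_absBesselIntegrand_right {s A B : ℝ} (hs : s < 0) (hA : 0 ≤ A) (hB : 0 < B) :
    Integrable (absBesselIntegrand s A B) := by
  have := (integrable_absBesselIntegrand_left (neg_pos.2 hs) hB hA).comp_neg
  simpa only [absBesselIntegrand_neg, neg_neg] using this

theorem integrable_absBesselIntegrand {A B : ℝ} (s : ℝ) (hA : 0 < A) (hB : 0 < B) :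
    Integrable (absBesselIntegrand s A B) := by
  have hs : 0 < |s| + 1 := by positivity
  refine ((integrable_absBesselIntegrand_left hs hA hB.le).add
    (integrable_absBesselIntegrand_right (neg_neg_of_pos hs) hA.le hB)).mono'
    (measurable_absBesselIntegrand s measurable_const measurable_const
      measurable_id).aestronglyMeasurable (ae_of_all _ fun t => ?_)
  rw [Real.norm_of_nonneg (absBesselIntegrand_pos _ _ _ _).le, Pi.add_apply]
  have h1 := abs_le.1 (le_refl |s|)
  rcases le_total 0 t with ht | ht
  · refine le_add_of_le_of_nonneg (Real.exp_le_exp.2 ?_) (absBesselIntegrand_pos _ _ _ _).le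
    nlinarith
  · refine le_add_of_nonneg_of_le (absBesselIntegrand_pos _ _ _ _).le (Real.exp_le_exp.2 ?_)
    nlinarith

theorem bessel_zero_right {ν : ℂ} {A : ℝ} (hν : 0 < ν.re) (hA : 0 < A) :
    bessel ν A 0 = Complex.Gamma ν * Complex.exp (-(ν * (Real.log A : ℝ))) := by
  have h := integral_image_eq_integral_abs_deriv_smul (s := Set.univ) (f := Real.exp)
    (f' := Real.exp) MeasurableSet.univ (fun x _ => (Real.hasDerivAt_exp x).hasDerivWithinAt)
    Real.exp_injective.injOn (fun t : ℝ => (t : ℂ) ^ (ν - 1) * Complex.exp (-((A : ℂ) * t)))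
  rw [Set.image_univ, Real.range_exp, setIntegral_univ,
    Complex.integral_cpow_mul_exp_neg_mul_Ioi hν (by simpa using hA)] at h
  rw [bessel, mul_comm]
  have hA' : (A : ℂ) ≠ 0 := by exact_mod_cast hA.ne'
  have e : (1 / (A : ℂ)) ^ ν = Complex.exp (-(ν * (Real.log A : ℝ))) := by
    rw [Complex.cpow_def_of_ne_zero (by simpa using hA'), one_div, ← Complex.ofReal_inv,
      ← Complex.ofReal_log (inv_pos.2 hA).le, Real.log_inv]
    congr 1; push_cast; ring
  rw [← e, h]
  congr 1; ext t
  rw [abs_of_pos (Real.exp_pos _), Complex.real_smul,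
    Complex.cpow_def_of_ne_zero (by exact_mod_cast (Real.exp_pos t).ne'),
    ← Complex.ofReal_log (Real.exp_pos t).le, Real.log_exp, besselIntegrand, Complex.ofReal_exp,
    ← Complex.exp_add, ← Complex.exp_add]
  congr 1; push_cast; ring

theorem bessel_zero_left {ν : ℂ} {B : ℝ} (hν : ν.re < 0) (hB : 0 < B) :
    bessel ν 0 B = Complex.Gamma (-ν) * Complex.exp (ν * (Real.log B : ℝ)) := by
  rw [bessel_swap, bessel_zero_right (by simpa using hν) hB]; simp

theorem ofReal_absBessel (s A B : ℝ) : ((absBessel s A B : ℝ) : ℂ) = bessel s A B := by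
  rw [absBessel, bessel, ← integral_complex_ofReal]
  simp [absBesselIntegrand, besselIntegrand]

theorem absBessel_zero_right {s A : ℝ} (hs : 0 < s) (hA : 0 < A) :
    absBessel s A 0 = Real.Gamma s * Real.exp (-(s * Real.log A)) := by
  have := ofReal_absBessel s A 0
  rw [bessel_zero_right (by simpa using hs) hA, Complex.Gamma_ofReal] at this
  exact_mod_cast this

theorem absBessel_anti {s A B A' B' : ℝ} (h : Integrable (absBesselIntegrand s A B))
    (hA : A ≤ A') (hB : B ≤ B') : absBessel s A' B' ≤ absBessel s A B := by
  refine integral_mono_of_nonneg (ae_of_all _ fun t => (absBesselIntegrand_pos _ _ _ _).le) h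
    (ae_of_all _ fun t => Real.exp_le_exp.2 ?_)
  have h1 := mul_le_mul_of_nonneg_right hA (Real.exp_pos t).le
  have h2 := mul_le_mul_of_nonneg_right hB (Real.exp_pos (-t)).le
  linarith

theorem absBessel_le_left {s A B : ℝ} (hs : 0 < s) (hA : 0 < A) (hB : 0 ≤ B) :
    absBessel s A B ≤ Real.Gamma s * Real.exp (-(s * Real.log A)) := by
  rw [← absBessel_zero_right hs hA]
  exact absBessel_anti (integrable_absBesselIntegrand_zero hs hA) le_rfl hB

theorem absBessel_le_right {s A B : ℝ} (hs : 0 < s) (hA : 0 ≤ A) (hB : 0 < B) :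
    absBessel (-s) A B ≤ Real.Gamma s * Real.exp (-(s * Real.log B)) := by
  rw [absBessel_swap, neg_neg]
  exact absBessel_le_left hs hB hA

/-- An exponential is dominated by any power. -/
theorem exp_neg_le_rpow {τ v : ℝ} (hτ : 0 < τ) (hv : 0 < v) :
    Real.exp (-v) ≤ Real.exp (τ * Real.log τ - τ * Real.log v) := by
  rw [Real.exp_le_exp]
  have := Real.log_le_sub_one_of_pos (div_pos hv hτ)
  rw [Real.log_div hv.ne' hτ.ne'] at this
  have h2 := mul_le_mul_of_nonneg_left this hτ.le
  have : τ * (v / τ - 1) = v - τ := by field_simp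
  nlinarith

/-- At index zero neither term of the exponent may be dropped outright. Trading e^{-B e^{-t}} for a
power of B e^{-t} creates the index τ, and the rest is a Gamma integral. Any τ > 0 is allowed, so
the logarithmic growth at AB → 0 costs an arbitrarily small power and the decay at infinity beats
every power. -/
theorem absBessel_zero_le {τ A B : ℝ} (hτ : 0 < τ) (hA : 0 < A) (hB : 0 < B) :
    absBessel 0 A B ≤ Real.exp (τ * Real.log τ) * Real.Gamma τ *
      Real.exp (-(τ * (Real.log A + Real.log B))) := by
  have h : absBessel 0 A B ≤
      ∫ t, Real.exp (τ * Real.log τ - τ * Real.log B) * absBesselIntegrand τ A 0 t := by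
    refine integral_mono_of_nonneg (ae_of_all _ fun t => (absBesselIntegrand_pos _ _ _ _).le)
      ((integrable_absBesselIntegrand_zero hτ hA).const_mul _) (ae_of_all _ fun t => ?_)
    have h1 := exp_neg_le_rpow hτ (mul_pos hB (Real.exp_pos (-t)))
    rw [Real.log_mul hB.ne' (Real.exp_pos _).ne', Real.log_exp] at h1
    simp only [absBesselIntegrand]
    calc Real.exp (0 * t - (A * Real.exp t + B * Real.exp (-t)))
        = Real.exp (-(A * Real.exp t)) * Real.exp (-(B * Real.exp (-t))) := by
          rw [← Real.exp_add]; congr 1; ring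
      _ ≤ Real.exp (-(A * Real.exp t)) * _ := mul_le_mul_of_nonneg_left h1 (Real.exp_pos _).le
      _ = _ := by rw [← Real.exp_add, ← Real.exp_add]; congr 1; ring
  refine h.trans (le_of_eq ?_)
  rw [integral_const_mul]
  change _ * absBessel τ A 0 = _
  rw [absBessel_zero_right hτ hA, mul_left_comm, ← Real.exp_add, mul_right_comm, ← Real.exp_add,
    mul_comm]
  congr 2; ring

/-! ### The boundary weight and its beta integral -/

/-- The boundary weight in exponential form, with a strict cut-off. -/
def weight (g β : ℝ) (lam : ℂ) (t : ℝ) : ℂ :=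
  if Real.log β < t then
    Complex.exp ((-(Complex.I * lam) - g) * (Real.log (1 + β * Real.exp (-t)) : ℝ)
      + (-(Complex.I * lam) + g - 1) * (Real.log (1 - β * Real.exp (-t)) : ℝ))
  else 0

/-- The absolute value of the boundary weight. -/
def absWeight (g β η t : ℝ) : ℝ :=
  if Real.log β < t then
    Real.exp ((η - g) * Real.log (1 + β * Real.exp (-t))
      + (η + g - 1) * Real.log (1 - β * Real.exp (-t)))
  else 0

theorem absWeight_nonneg (g β η t : ℝ) : 0 ≤ absWeight g β η t := by
  unfold absWeight; split_ifs <;> positivity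

theorem norm_weight (g β : ℝ) (lam : ℂ) (t : ℝ) :
    ‖weight g β lam t‖ = absWeight g β lam.im t := by
  unfold weight absWeight
  split_ifs
  · rw [Complex.norm_exp, Complex.add_re, Complex.re_mul_ofReal, Complex.re_mul_ofReal]
    simp
  · simp

theorem measurable_weight (g β : ℝ) (lam : ℂ) : Measurable (weight g β lam) := by
  unfold weight
  exact Measurable.ite measurableSet_Ioi (by fun_prop) measurable_const

theorem measurable_absWeight (g β η : ℝ) : Measurable (absWeight g β η) := by
  unfold absWeight
  exact Measurable.ite measurableSet_Ioi (by fun_prop) measurable_const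

theorem mul_exp_neg_lt_one {β t : ℝ} (hβ : 0 < β) (ht : Real.log β < t) :
    β * Real.exp (-t) < 1 := by
  rw [Real.exp_neg, ← div_eq_mul_inv, div_lt_one (Real.exp_pos t)]
  exact (Real.log_lt_iff_lt_exp hβ).1 ht

/-- On the support both bases are positive, so the complex powers are exponentials of real
logarithms. Only the cut-off point itself, where the two Heaviside conventions differ, must be
excluded. -/
theorem boundaryWeight_eq_weight {g β : ℝ} (hβ : 0 < β) (lam : ℂ) {t : ℝ}
    (ht : t ≠ Real.log β) : boundaryWeight g β lam t = weight g β lam t := by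
  unfold boundaryWeight weight heaviside
  rcases lt_or_gt_of_ne ht with h | h
  · rw [if_neg (by linarith), if_neg (by linarith)]; simp
  · have h1 := mul_exp_neg_lt_one hβ h
    have h2 : 0 < 1 + β * Real.exp (-t) := by positivity
    have h3 : 0 < 1 - β * Real.exp (-t) := by linarith
    rw [if_pos (by linarith), if_pos h, Complex.cpow_def_of_ne_zero (by exact_mod_cast h2.ne'),
      Complex.cpow_def_of_ne_zero (by exact_mod_cast h3.ne'), ← Complex.ofReal_log h2.le,
      ← Complex.ofReal_log h3.le, Complex.exp_add]
    push_cast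
    rw [mul_one, mul_comm (_ - _ : ℂ), mul_comm (_ - _ : ℂ)]

theorem boundaryWeight_ae_eq {g β : ℝ} (hβ : 0 < β) (lam : ℂ) :
    boundaryWeight g β lam =ᵐ[volume] weight g β lam := by
  filter_upwards [compl_mem_ae_iff.2 (measure_singleton (Real.log β))] with t ht
  exact boundaryWeight_eq_weight hβ lam ht

section Beta

variable {β : ℝ}

theorem betaSubst_image (hβ : 0 < β) :
    (fun v => Real.log β + Real.log (1 + v) - Real.log (1 - v)) '' Set.Ioo 0 1
      = Set.Ioi (Real.log β) := by
  ext t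
  constructor
  · rintro ⟨v, ⟨h0, h1⟩, rfl⟩
    have := Real.log_lt_log (show 0 < 1 - v by linarith) (show 1 - v < 1 + v by linarith)
    simp only [Set.mem_Ioi]; linarith
  · intro ht
    have h1 := mul_exp_neg_lt_one hβ ht
    set e := β * Real.exp (-t) with he
    have he0 : 0 < e := by positivity
    have hle : Real.log e = Real.log β - t := by
      rw [he, Real.log_mul hβ.ne' (Real.exp_pos _).ne', Real.log_exp]; ring
    refine ⟨(1 - e) / (1 + e), ⟨div_pos (by linarith) (by linarith), ?_⟩, ?_⟩
    · rw [div_lt_one (by linarith)]; linarith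
    · have a1 : 1 + (1 - e) / (1 + e) = 2 / (1 + e) := by field_simp; ring
      have a2 : 1 - (1 - e) / (1 + e) = 2 * e / (1 + e) := by field_simp; ring
      simp only [a1, a2]
      rw [Real.log_div (by positivity) (by positivity), Real.log_div (by positivity)
        (by positivity), Real.log_mul (by positivity) he0.ne', hle]
      ring

theorem betaSubst_hasDerivAt {v : ℝ} (h0 : 0 < v) (h1 : v < 1) :
    HasDerivAt (fun v => Real.log β + Real.log (1 + v) - Real.log (1 - v))
      (2 / ((1 - v) * (1 + v))) v := by
  have a := ((hasDerivAt_id v).const_add 1).log (by simp; linarith)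
  have b := ((hasDerivAt_id v).const_sub 1).log (by simp; linarith)
  have c := (a.const_add (Real.log β)).sub b
  have h3 : 1 - v ≠ 0 := by linarith
  have h4 : 1 + v ≠ 0 := by linarith
  refine c.congr_deriv ?_
  simp only [id]
  field_simp; ring

theorem betaSubst_injOn :
    Set.InjOn (fun v => Real.log β + Real.log (1 + v) - Real.log (1 - v)) (Set.Ioo 0 1) := by
  refine StrictMonoOn.injOn fun v hv w hw h => ?_
  have a := Real.log_lt_log (show 0 < 1 + v by linarith [hv.1]) (show 1 + v < 1 + w by linarith)
  have b := Real.log_lt_log (show 0 < 1 - w by linarith [hw.2]) (show 1 - w < 1 - v by linarith)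
  linarith

/-- In the variable v = (1 - βe^{-t})/(1 + βe^{-t}) one has 1 + βe^{-t} = 2/(1+v) and 1 - βe^{-t} =
2v/(1+v). All powers of 1 + v cancel against the Jacobian and the character, which leaves an Euler
beta integrand. -/
theorem weight_betaSubst (g : ℝ) (hβ : 0 < β) (lam : ℂ) {v : ℝ} (h0 : 0 < v) (h1 : v < 1) :
    |2 / ((1 - v) * (1 + v))| •
      (weight g β lam (Real.log β + Real.log (1 + v) - Real.log (1 - v)) *
        Complex.exp (-(2 * Complex.I * lam) *
          (Real.log β + Real.log (1 + v) - Real.log (1 - v) : ℝ)))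
      = Complex.exp (-(2 * Complex.I * lam) * (Real.log 2 + Real.log β : ℝ)) *
        ((v : ℂ) ^ ((g - Complex.I * lam) - 1) * (1 - v : ℂ) ^ (2 * Complex.I * lam - 1)) := by
  have p1 : 0 < 1 - v := by linarith
  have p2 : 0 < 1 + v := by linarith
  have hlt : Real.log β < Real.log β + Real.log (1 + v) - Real.log (1 - v) := by
    have := Real.log_lt_log p1 (show 1 - v < 1 + v by linarith)
    linarith
  have he : β * Real.exp (-(Real.log β + Real.log (1 + v) - Real.log (1 - v)))
      = (1 - v) / (1 + v) := by
    rw [show -(Real.log β + Real.log (1 + v) - Real.log (1 - v))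
      = Real.log (1 - v) - Real.log (1 + v) - Real.log β by ring, Real.exp_sub, Real.exp_sub,
      Real.exp_log p1, Real.exp_log p2, Real.exp_log hβ]
    field_simp
  have e1 : Real.log (1 + (1 - v) / (1 + v)) = Real.log 2 - Real.log (1 + v) := by
    rw [← Real.log_div (by norm_num) p2.ne']; congr 1; field_simp; ring
  have e2 : Real.log (1 - (1 - v) / (1 + v)) = Real.log 2 + Real.log v - Real.log (1 + v) := by
    rw [← Real.log_mul (by norm_num) h0.ne', ← Real.log_div (by positivity) p2.ne']
    congr 1; field_simp; ring
  have e3 : |2 / ((1 - v) * (1 + v))|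
      = Real.exp (Real.log 2 - Real.log (1 - v) - Real.log (1 + v)) := by
    rw [abs_of_pos (by positivity), Real.exp_sub, Real.exp_sub, Real.exp_log p1,
      Real.exp_log p2, Real.exp_log two_pos, div_div]
  rw [weight, if_pos hlt, he, e1, e2, e3, Complex.real_smul,
    Complex.cpow_def_of_ne_zero (by exact_mod_cast h0.ne'),
    Complex.cpow_def_of_ne_zero (by exact_mod_cast p1.ne'), ← Complex.ofReal_log h0.le,
    show (1 - v : ℂ) = ((1 - v : ℝ) : ℂ) by push_cast; rfl, ← Complex.ofReal_log p1.le,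
    Complex.ofReal_exp, ← Complex.exp_add, ← Complex.exp_add, ← Complex.exp_add,
    ← Complex.exp_add]
  congr 1; push_cast; ring

theorem weight_mul_eq_indicator (g : ℝ) (lam : ℂ) (f : ℝ → ℂ) :
    (fun t => weight g β lam t * f t)
      = (Set.Ioi (Real.log β)).indicator fun t => weight g β lam t * f t := by
  ext t
  by_cases h : Real.log β < t
  · rw [Set.indicator_of_mem (by exact h)]
  · rw [Set.indicator_of_notMem (by exact h), weight, if_neg h, zero_mul]

theorem integrable_weight_exp {g : ℝ} (hβ : 0 < β) {lam : ℂ} (h1 : -g < lam.im)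
    (h2 : lam.im < 0) :
    Integrable fun t : ℝ => weight g β lam t * Complex.exp (-(2 * Complex.I * lam) * t) := by
  rw [weight_mul_eq_indicator, integrable_indicator_iff measurableSet_Ioi, ← betaSubst_image hβ,
    integrableOn_image_iff_integrableOn_abs_deriv_smul measurableSet_Ioo
      (fun v hv => (betaSubst_hasDerivAt hv.1 hv.2).hasDerivWithinAt) betaSubst_injOn]
  have hb := Complex.betaIntegral_convergent (u := g - Complex.I * lam)
    (v := 2 * Complex.I * lam) (by simp; linarith) (by simp; linarith)
  rw [intervalIntegrable_iff_integrableOn_Ioo_of_le zero_le_one] at hb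
  refine IntegrableOn.congr_fun (hb.const_mul
    (Complex.exp (-(2 * Complex.I * lam) * (Real.log 2 + Real.log β : ℝ)))) (fun v hv => ?_)
    measurableSet_Ioo
  exact (weight_betaSubst g hβ lam hv.1 hv.2).symm

/-- The boundary weight integrated against its natural character is a beta integral. -/
theorem integral_weight_exp {g : ℝ} (hβ : 0 < β) (lam : ℂ) :
    ∫ t : ℝ, weight g β lam t * Complex.exp (-(2 * Complex.I * lam) * t)
      = Complex.exp (-(2 * Complex.I * lam) * (Real.log 2 + Real.log β : ℝ)) *
        Complex.betaIntegral (g - Complex.I * lam) (2 * Complex.I * lam) := by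
  rw [weight_mul_eq_indicator, integral_indicator measurableSet_Ioi, ← betaSubst_image hβ,
    integral_image_eq_integral_abs_deriv_smul measurableSet_Ioo
      (fun v hv => (betaSubst_hasDerivAt hv.1 hv.2).hasDerivWithinAt) betaSubst_injOn,
    Complex.betaIntegral, intervalIntegral.integral_of_le zero_le_one,
    integral_Ioc_eq_integral_Ioo, ← integral_const_mul]
  exact setIntegral_congr_fun measurableSet_Ioo fun v hv => weight_betaSubst g hβ lam hv.1 hv.2

end Beta

/-! ### Power bounds for the absolute boundary transform -/

/-- Only the exponent η + g - 1 of 1 - βe^{-t} matters for integrability: on the support 1 + βe^{-t}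
lies between 1 and 2, so changing its exponent costs a constant. -/
theorem absWeight_le {g β : ℝ} (hβ : 0 < β) (η g' η' : ℝ) (h : η + g = η' + g') (t : ℝ) :
    absWeight g β η t
      ≤ Real.exp (|(η - g) - (η' - g')| * Real.log 2) * absWeight g' β η' t := by
  unfold absWeight
  split_ifs with ht
  · rw [← Real.exp_add, Real.exp_le_exp]
    have h1 := mul_exp_neg_lt_one hβ ht
    have h2 : 0 < β * Real.exp (-t) := by positivity
    have a1 : 0 ≤ Real.log (1 + β * Real.exp (-t)) := Real.log_nonneg (by linarith)
    have a2 : Real.log (1 + β * Real.exp (-t)) ≤ Real.log 2 :=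
      Real.log_le_log (by linarith) (by linarith)
    have h3 := mul_le_mul_of_nonneg_left a2 (abs_nonneg ((η - g) - (η' - g')))
    have h4 := mul_le_mul_of_nonneg_right (le_abs_self ((η - g) - (η' - g'))) a1
    rw [h]; nlinarith
  · simp

theorem integrable_absWeight_exp {g β η s : ℝ} (hβ : 0 < β) (hη : -g < η) (hs : s < 0) :
    Integrable fun t => absWeight g β η t * Real.exp (s * t) := by
  -- The parameters are changed to η' = s/2 and g' = η + g - s/2: the sum η + g is kept, while the
  -- character of the beta integral becomes e^{st}.
  have hint := (integrable_weight_exp (g := η + g - s / 2) (lam := Complex.I * (s / 2 : ℝ)) hβ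
    (by simp; linarith) (by simp; linarith)).norm
  refine (hint.const_mul
    (Real.exp (|(η - g) - (s / 2 - (η + g - s / 2))| * Real.log 2))).mono'
    ((measurable_absWeight g β η).mul (by fun_prop)).aestronglyMeasurable
    (ae_of_all _ fun t => ?_)
  have e : ‖weight (η + g - s / 2) β (Complex.I * (s / 2 : ℝ)) t *
      Complex.exp (-(2 * Complex.I * (Complex.I * (s / 2 : ℝ))) * t)‖
      = absWeight (η + g - s / 2) β (s / 2) t * Real.exp (s * t) := by
    rw [norm_mul, norm_weight, Complex.norm_exp]
    congr 2
    · simp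
    · rw [show -(2 * Complex.I * (Complex.I * (s / 2 : ℝ))) * (t : ℂ)
        = -(Complex.I * Complex.I) * (s * t : ℝ) by push_cast; ring, Complex.I_mul_I]
      simp
  rw [e, Real.norm_of_nonneg (mul_nonneg (absWeight_nonneg _ _ _ _) (Real.exp_pos _).le),
    ← mul_assoc]
  exact mul_le_mul_of_nonneg_right (absWeight_le hβ _ _ _ (by ring) t) (Real.exp_pos _).le

/-- The integrand of the absolute boundary transform. -/
def absBoundaryIntegrand (g β η s c t : ℝ) : ℝ :=
  absWeight g β η t * Real.exp (s * t - c * Real.exp t)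

/-- The absolute boundary transform. -/
def absBoundary (g β η s c : ℝ) : ℝ := ∫ t, absBoundaryIntegrand g β η s c t

theorem absBoundaryIntegrand_nonneg (g β η s c t : ℝ) : 0 ≤ absBoundaryIntegrand g β η s c t :=
  mul_nonneg (absWeight_nonneg _ _ _ _) (Real.exp_pos _).le

theorem absBoundary_nonneg (g β η s c : ℝ) : 0 ≤ absBoundary g β η s c :=
  integral_nonneg fun _ => absBoundaryIntegrand_nonneg ..

theorem measurable_absBoundaryIntegrand (g β η s c : ℝ) :
    Measurable (absBoundaryIntegrand g β η s c) :=
  (measurable_absWeight g β η).mul (by fun_prop)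

theorem absBoundaryIntegrand_le {g β η s c τ : ℝ} (hc : 0 < c) (hτ : 0 < τ) (t : ℝ) :
    absBoundaryIntegrand g β η s c t ≤ Real.exp (τ * Real.log τ) * Real.exp (-(τ * Real.log c)) *
      (absWeight g β η t * Real.exp ((s - τ) * t)) := by
  have h1 := exp_neg_le_rpow hτ (mul_pos hc (Real.exp_pos t))
  rw [Real.log_mul hc.ne' (Real.exp_pos _).ne', Real.log_exp] at h1
  unfold absBoundaryIntegrand
  rw [mul_left_comm]
  refine mul_le_mul_of_nonneg_left ?_ (absWeight_nonneg _ _ _ _)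
  rw [sub_eq_add_neg, Real.exp_add]
  refine (mul_le_mul_of_nonneg_left h1 (Real.exp_pos _).le).trans (le_of_eq ?_)
  rw [← Real.exp_add, ← Real.exp_add, ← Real.exp_add]; congr 1; ring

theorem integrable_absBoundaryIntegrand {g β η c : ℝ} (hβ : 0 < β) (hη : -g < η) (s : ℝ)
    (hc : 0 < c) : Integrable (absBoundaryIntegrand g β η s c) := by
  have hτ : 0 < |s| + 1 := by positivity
  refine ((integrable_absWeight_exp hβ hη (s := s - (|s| + 1))
    (by linarith [le_abs_self s])).const_mul (Real.exp ((|s| + 1) * Real.log (|s| + 1)) *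
      Real.exp (-((|s| + 1) * Real.log c)))).mono'
    (measurable_absBoundaryIntegrand g β η s c).aestronglyMeasurable (ae_of_all _ fun t => ?_)
  rw [Real.norm_of_nonneg (absBoundaryIntegrand_nonneg ..)]
  exact absBoundaryIntegrand_le hc hτ t

theorem integrable_absBoundaryIntegrand_zero {g β η s : ℝ} (hβ : 0 < β) (hη : -g < η)
    (hs : s < 0) : Integrable (absBoundaryIntegrand g β η s 0) := by
  refine (integrable_absWeight_exp hβ hη hs).congr (ae_of_all _ fun t => ?_)
  simp [absBoundaryIntegrand]

theorem absBoundary_anti {g β η s c c' : ℝ} (h : Integrable (absBoundaryIntegrand g β η s c))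
    (hc : c ≤ c') : absBoundary g β η s c' ≤ absBoundary g β η s c := by
  refine integral_mono_of_nonneg (ae_of_all _ fun t => absBoundaryIntegrand_nonneg ..) h
    (ae_of_all _ fun t => mul_le_mul_of_nonneg_left (Real.exp_le_exp.2 ?_)
      (absWeight_nonneg ..))
  have h1 := mul_le_mul_of_nonneg_right hc (Real.exp_pos t).le
  linarith

/-- Replacing e^{-ce^t} by a multiple of (ce^t)^{-τ} leaves the exponent s - τ, which must be
negative because the weight tends to 1 at infinity. -/
theorem absBoundary_le {g β η s τ : ℝ} (hβ : 0 < β) (hη : -g < η) (hτ : 0 < τ) (hs : s < τ) :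
    ∃ M, 0 ≤ M ∧ ∀ c, 0 < c → absBoundary g β η s c ≤ M * Real.exp (-(τ * Real.log c)) := by
  refine ⟨Real.exp (τ * Real.log τ) * ∫ t, absWeight g β η t * Real.exp ((s - τ) * t),
    mul_nonneg (Real.exp_pos _).le (integral_nonneg fun t =>
      mul_nonneg (absWeight_nonneg ..) (Real.exp_pos _).le), fun c hc => ?_⟩
  rw [mul_right_comm, ← integral_const_mul]
  exact integral_mono_of_nonneg (ae_of_all _ fun t => absBoundaryIntegrand_nonneg ..)
    ((integrable_absWeight_exp hβ hη (by linarith)).const_mul _)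
    (ae_of_all _ fun t => absBoundaryIntegrand_le hc hτ t)

/-- The singularity at the cut-off is confined to t ≤ log(2β), where 2βe^{-t} ≥ 1. Beyond it 1 ±
βe^{-t} lies in [1/2, 2], so each power is at most 2 to the absolute value of its exponent. -/
theorem absWeight_le_add {β : ℝ} (hβ : 0 < β) (g η : ℝ) :
    ∃ M, 0 ≤ M ∧ ∀ t, absWeight g β η t ≤ M + 2 * β * (absWeight g β η t * Real.exp (-t)) := by
  refine ⟨Real.exp ((|η - g| + |η + g - 1|) * Real.log 2), (Real.exp_pos _).le, fun t => ?_⟩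
  have hw := absWeight_nonneg g β η t
  by_cases ht : t ≤ Real.log (2 * β)
  · have : 1 ≤ 2 * β * Real.exp (-t) := by
      rw [Real.exp_neg, ← div_eq_mul_inv, one_le_div (Real.exp_pos t)]
      exact (Real.le_log_iff_exp_le (by positivity)).1 ht
    have h2 := mul_le_mul_of_nonneg_left this hw
    have := Real.exp_pos ((|η - g| + |η + g - 1|) * Real.log 2)
    nlinarith
  · push Not at ht
    have hlt : Real.log β < t := lt_trans (Real.log_lt_log hβ (by linarith)) ht
    refine le_add_of_le_of_nonneg ?_ (by positivity)
    rw [absWeight, if_pos hlt, Real.exp_le_exp, add_mul]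
    have h1 := mul_exp_neg_lt_one hβ hlt
    have h0 : 0 < β * Real.exp (-t) := by positivity
    have h2 : β * Real.exp (-t) < 1 / 2 := by
      have := mul_exp_neg_lt_one (β := 2 * β) (by positivity) ht
      linarith
    have key : ∀ a y : ℝ, 1 / 2 ≤ y → y ≤ 2 → a * Real.log y ≤ |a| * Real.log 2 := by
      intro a y hy1 hy2
      have b1 : Real.log y ≤ Real.log 2 := Real.log_le_log (by linarith) hy2
      have b2 : -Real.log 2 ≤ Real.log y := by
        rw [← Real.log_inv]; exact Real.log_le_log (by norm_num) (by linarith)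
      refine (le_abs_self _).trans ?_
      rw [abs_mul]
      exact mul_le_mul_of_nonneg_left (abs_le.2 ⟨b2, b1⟩) (abs_nonneg a)
    exact add_le_add (key _ _ (by linarith) (by linarith)) (key _ _ (by linarith) (by linarith))

/-- The sharp power bound for the absolute boundary transform. -/
theorem absBoundary_le_self {g β η s : ℝ} (hβ : 0 < β) (hη : -g < η) (hs : 0 < s) :
    ∃ M, 0 ≤ M ∧ ∀ c, 0 < c → absBoundary g β η s c ≤ M * Real.exp (-(s * Real.log c)) := by
  -- At τ = s the previous power bound just fails. The bounded part of the weight gives the Gamma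
  -- integral Γ(s)c^{-s} exactly; the other part carries an extra e^{-t}, so its exponent s - 1 lies
  -- strictly below τ = s.
  obtain ⟨M₁, hM₁, h₁⟩ := absWeight_le_add hβ g η
  obtain ⟨M₂, hM₂, h₂⟩ := absBoundary_le (s := s - 1) hβ hη hs (by linarith)
  refine ⟨M₁ * Real.Gamma s + 2 * β * M₂, by have := Real.Gamma_pos_of_pos hs; positivity,
    fun c hc => ?_⟩
  have i₁ := (integrable_absBesselIntegrand_zero hs hc).const_mul M₁
  have i₂ := (integrable_absBoundaryIntegrand hβ hη (s - 1) hc).const_mul (2 * β)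
  have h : absBoundary g β η s c
      ≤ M₁ * absBessel s c 0 + 2 * β * absBoundary g β η (s - 1) c := by
    rw [absBessel, absBoundary, absBoundary, ← integral_const_mul, ← integral_const_mul,
      ← integral_add i₁ i₂]
    refine integral_mono_of_nonneg (ae_of_all _ fun t => absBoundaryIntegrand_nonneg ..)
      (i₁.add i₂) (ae_of_all _ fun t => ?_)
    refine (mul_le_mul_of_nonneg_right (h₁ t) (Real.exp_pos _).le).trans (le_of_eq ?_)
    simp only [absBesselIntegrand, absBoundaryIntegrand, zero_mul, add_zero]
    rw [show (s - 1) * t - c * Real.exp t = -t + (s * t - c * Real.exp t) by ring,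
      Real.exp_add (-t)]
    ring
  rw [absBessel_zero_right hs hc] at h
  have := mul_le_mul_of_nonneg_left (h₂ c hc) (show 0 ≤ 2 * β by positivity)
  calc _ ≤ _ := h
    _ ≤ _ := by linarith

/-! ### The boundary transform and the decoupling of two boundary variables -/

/-- The integrand of the boundary transform. -/
def boundaryIntegrand (g β : ℝ) (lam : ℂ) (c t : ℝ) : ℂ :=
  weight g β lam t * Complex.exp (-(2 * Complex.I * lam) * t - ((c * Real.exp t : ℝ) : ℂ))

/-- The boundary transform, a Whittaker function. -/
def boundary (g β : ℝ) (lam : ℂ) (c : ℝ) : ℂ := ∫ t, boundaryIntegrand g β lam c t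

theorem norm_boundaryIntegrand (g β : ℝ) (lam : ℂ) (c t : ℝ) :
    ‖boundaryIntegrand g β lam c t‖ = absBoundaryIntegrand g β lam.im (2 * lam.im) c t := by
  rw [boundaryIntegrand, absBoundaryIntegrand, norm_mul, norm_weight, Complex.norm_exp,
    Complex.sub_re, Complex.ofReal_re, Complex.re_mul_ofReal]
  simp

theorem measurable_boundaryIntegrand {Z : Type*} [MeasurableSpace Z] (g β : ℝ) (lam : ℂ)
    {c t : Z → ℝ} (hc : Measurable c) (ht : Measurable t) :
    Measurable fun z => boundaryIntegrand g β lam (c z) (t z) := by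
  unfold boundaryIntegrand
  exact ((measurable_weight g β lam).comp ht).mul (by fun_prop)

theorem integrable_boundaryIntegrand_iff (g β : ℝ) (lam : ℂ) (c : ℝ) :
    Integrable (boundaryIntegrand g β lam c)
      ↔ Integrable (absBoundaryIntegrand g β lam.im (2 * lam.im) c) := by
  rw [← integrable_norm_iff]
  · simp only [norm_boundaryIntegrand]
  · exact (measurable_boundaryIntegrand g β lam measurable_const
      measurable_id).aestronglyMeasurable

theorem boundary_zero {g β : ℝ} (hβ : 0 < β) {lam : ℂ} (h1 : -g < lam.im) (h2 : lam.im < 0) :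
    boundary g β lam 0 * Complex.Gamma (g + Complex.I * lam)
      = Complex.exp (-(2 * Complex.I * lam) * (Real.log 2 + Real.log β : ℝ)) *
        (Complex.Gamma (g - Complex.I * lam) * Complex.Gamma (2 * Complex.I * lam)) := by
  have := integral_weight_exp (g := g) hβ lam
  rw [boundary]
  simp only [boundaryIntegrand, zero_mul, Complex.ofReal_zero, sub_zero, this]
  rw [Complex.Gamma_mul_Gamma_eq_betaIntegral (by simp; linarith) (by simp; linarith)]
  rw [show (g - Complex.I * lam) + 2 * Complex.I * lam = g + Complex.I * lam by ring]
  ring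

/-- The integrand of the coupled boundary transform of two rows. -/
def coupledIntegrand (g β : ℝ) (mu rho : ℂ) (a b : ℝ) (p : ℝ × ℝ) : ℂ :=
  weight g β mu p.1 * weight g β rho p.2 *
    Complex.exp (-(2 * Complex.I * mu) * p.1 - 2 * Complex.I * rho * p.2
      + (Complex.I * mu + Complex.I * rho) * (Real.log (Real.exp p.1 + Real.exp p.2) : ℝ)
      - ((a * Real.exp p.1 + b * Real.exp p.2 : ℝ) : ℂ))

/-- The coupled boundary transform of two rows. -/
def coupledBoundary (g β : ℝ) (mu rho : ℂ) (a b : ℝ) : ℂ :=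
  ∫ p : ℝ × ℝ, coupledIntegrand g β mu rho a b p

theorem coupledIntegrand_swap (g β : ℝ) (mu rho : ℂ) (a b : ℝ) (p : ℝ × ℝ) :
    coupledIntegrand g β mu rho a b p.swap = coupledIntegrand g β rho mu b a p := by
  simp only [coupledIntegrand, Prod.fst_swap, Prod.snd_swap]
  rw [mul_comm (weight g β mu p.2)]
  congr 2
  rw [add_comm (Real.exp p.2), add_comm (a * _)]
  ring

/-- The change of variables which decouples two boundary rows. -/
def decouple (β : ℝ) (p : ℝ × ℝ) : ℝ × ℝ :=
  (Real.log (Real.exp p.1 + Real.exp p.2),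
    Real.log (Real.exp p.1 + (Real.exp p.1 ^ 2 - β ^ 2) * Real.exp (-p.2)))

/-- The inverse of `decouple`. -/
def recouple (β : ℝ) (p : ℝ × ℝ) : ℝ × ℝ :=
  (Real.log ((Real.exp p.1 * Real.exp p.2 + β ^ 2) / (Real.exp p.1 + Real.exp p.2)),
    Real.log ((Real.exp p.1 ^ 2 - β ^ 2) / (Real.exp p.1 + Real.exp p.2)))

section Decouple

variable {β : ℝ}

theorem sq_sub_sq_pos {r : ℝ} (hβ : 0 < β) (h : β < r) : 0 < r ^ 2 - β ^ 2 := by nlinarith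

theorem decouple_leftInvOn (hβ : 0 < β) :
    Set.LeftInvOn (recouple β) (decouple β) (Set.Ioi (Real.log β) ×ˢ Set.univ) := by
  rintro ⟨ξ, η⟩ ⟨h, -⟩
  have hr := (Real.log_lt_iff_lt_exp hβ).1 h
  have hc := sq_sub_sq_pos hβ hr
  have hp := Real.exp_pos η
  have hr0 := Real.exp_pos ξ
  simp only [recouple, decouple]
  rw [Real.exp_log (by positivity), Real.exp_log (by positivity), Real.exp_neg]
  set r := Real.exp ξ
  set p := Real.exp η
  have hT : 0 < r + p + (r + (r ^ 2 - β ^ 2) * p⁻¹) := by positivity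
  ext
  · rw [← Real.log_exp ξ]
    change Real.log _ = Real.log r
    congr 1
    rw [div_eq_iff hT.ne']
    field_simp
    ring
  · rw [← Real.log_exp η]
    change Real.log _ = Real.log p
    congr 1
    rw [div_eq_iff hT.ne']
    field_simp
    ring

theorem decouple_image (hβ : 0 < β) :
    decouple β '' (Set.Ioi (Real.log β) ×ˢ Set.univ)
      = Set.Ioi (Real.log β) ×ˢ Set.Ioi (Real.log β) := by
  ext ⟨z, u⟩
  constructor
  · rintro ⟨⟨ξ, η⟩, ⟨h, -⟩, he⟩
    have hr := (Real.log_lt_iff_lt_exp hβ).1 h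
    have hc := sq_sub_sq_pos hβ hr
    rw [← he]
    have h2 : 0 < (Real.exp ξ ^ 2 - β ^ 2) * Real.exp (-η) := by positivity
    exact ⟨Real.log_lt_log hβ (by linarith [Real.exp_pos η]), Real.log_lt_log hβ (by linarith)⟩
  · rintro ⟨hz, hu⟩
    have hz := (Real.log_lt_iff_lt_exp hβ).1 hz
    have hu := (Real.log_lt_iff_lt_exp hβ).1 hu
    refine ⟨recouple β (z, u), ⟨?_, trivial⟩, ?_⟩
    · simp only [recouple]
      refine Real.log_lt_log hβ ?_
      rw [lt_div_iff₀ (by positivity)]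
      dsimp only at hz hu
      nlinarith
    · have hc := sq_sub_sq_pos hβ hz
      simp only [recouple, decouple]
      rw [Real.exp_neg, Real.exp_log (by positivity), Real.exp_log (by positivity)]
      ext
      · refine (congrArg Real.log ?_).trans (Real.log_exp z)
        field_simp
        ring
      · refine (congrArg Real.log ?_).trans (Real.log_exp u)
        have h1 := Real.exp_pos z
        have h2 := Real.exp_pos u
        set t := Real.exp z
        set s := Real.exp u
        field_simp
        ring

theorem decouple_hasFDerivAt {p : ℝ × ℝ} (hβ : 0 < β) (hp : Real.log β < p.1) :
    HasFDerivAt (decouple β)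
      (LinearMap.toContinuousLinearMap (Matrix.toLin (Module.Basis.finTwoProd ℝ)
        (Module.Basis.finTwoProd ℝ)
        !![Real.exp p.1 / (Real.exp p.1 + Real.exp p.2),
            Real.exp p.2 / (Real.exp p.1 + Real.exp p.2);
          (Real.exp p.1 + 2 * Real.exp p.1 ^ 2 * Real.exp (-p.2)) /
            (Real.exp p.1 + (Real.exp p.1 ^ 2 - β ^ 2) * Real.exp (-p.2)),
          -((Real.exp p.1 ^ 2 - β ^ 2) * Real.exp (-p.2)) /
            (Real.exp p.1 + (Real.exp p.1 ^ 2 - β ^ 2) * Real.exp (-p.2))])) p := by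
  have hr := (Real.log_lt_iff_lt_exp hβ).1 hp
  have hc := sq_sub_sq_pos hβ hr
  rw [Matrix.toLin_finTwoProd_toContinuousLinearMap]
  have f1 : HasFDerivAt (fun p : ℝ × ℝ => Real.exp p.1)
      (Real.exp p.1 • ContinuousLinearMap.fst ℝ ℝ ℝ) p :=
    hasFDerivAt_fst.exp
  have f2 : HasFDerivAt (fun p : ℝ × ℝ => Real.exp p.2)
      (Real.exp p.2 • ContinuousLinearMap.snd ℝ ℝ ℝ) p :=
    hasFDerivAt_snd.exp
  have f3 : HasFDerivAt (fun p : ℝ × ℝ => Real.exp (-p.2))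
      (Real.exp (-p.2) • (-ContinuousLinearMap.snd ℝ ℝ ℝ)) p := hasFDerivAt_snd.neg.exp
  have f4 := (f1.add f2).log (by simp only [Pi.add_apply]; positivity)
  have f5 := (f1.add (((f1.pow 2).sub_const (β ^ 2)).mul f3)).log
    (by simp only [Pi.add_apply, Pi.mul_apply]; positivity)
  refine (f4.prodMk f5).congr_fderiv ?_
  ext <;> simp <;> field_simp

theorem decouple_det {p : ℝ × ℝ} (hβ : 0 < β) (hp : Real.log β < p.1) :
    |(LinearMap.toContinuousLinearMap (Matrix.toLin (Module.Basis.finTwoProd ℝ)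
        (Module.Basis.finTwoProd ℝ)
        !![Real.exp p.1 / (Real.exp p.1 + Real.exp p.2),
            Real.exp p.2 / (Real.exp p.1 + Real.exp p.2);
          (Real.exp p.1 + 2 * Real.exp p.1 ^ 2 * Real.exp (-p.2)) /
            (Real.exp p.1 + (Real.exp p.1 ^ 2 - β ^ 2) * Real.exp (-p.2)),
          -((Real.exp p.1 ^ 2 - β ^ 2) * Real.exp (-p.2)) /
            (Real.exp p.1 + (Real.exp p.1 ^ 2 - β ^ 2) * Real.exp (-p.2))])).det|
      = Real.exp p.1 * (Real.exp p.1 + Real.exp p.2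
          + (Real.exp p.1 + (Real.exp p.1 ^ 2 - β ^ 2) * Real.exp (-p.2)))
        / ((Real.exp p.1 + Real.exp p.2)
          * (Real.exp p.1 + (Real.exp p.1 ^ 2 - β ^ 2) * Real.exp (-p.2))) := by
  have hr := (Real.log_lt_iff_lt_exp hβ).1 hp
  have hc := sq_sub_sq_pos hβ hr
  rw [LinearMap.det_toContinuousLinearMap, LinearMap.det_toLin, Matrix.det_fin_two_of,
    ← abs_neg, abs_of_pos]
  · rw [Real.exp_neg]
    field_simp
    ring
  · have := Real.exp_pos p.1
    have := Real.exp_pos p.2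
    have := Real.exp_pos (-p.2)
    have e : ∀ a b c d : ℝ, -(a * -b - c * d) = a * b + c * d := by intros; ring
    rw [neg_div, e]
    positivity

theorem weight_log (g : ℝ) (hβ : 0 < β) (lam : ℂ) {t : ℝ} (ht : β < t) :
    weight g β lam (Real.log t) = Complex.exp
      ((-(Complex.I * lam) - g) * (Real.log (t + β) - Real.log t : ℝ)
        + (-(Complex.I * lam) + g - 1) * (Real.log (t - β) - Real.log t : ℝ)) := by
  have ht0 : 0 < t := hβ.trans ht
  rw [weight, if_pos (Real.log_lt_log hβ ht), Real.exp_neg, Real.exp_log ht0,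
    ← Real.log_div (by linarith) ht0.ne', ← Real.log_div (by linarith) ht0.ne']
  congr 6
  · field_simp
  · field_simp

/-- Write r = e^ξ, p = e^η, q = (r² - β²)/p, so that the two boundary variables have exponentials r
+ p and r + q. The linear exponent becomes (a+b)r + ap + bq. The weights factor because the products
of r + p ± β and r + q ± β share the factor T = 2r + p + q, for instance (r+p-β)(r+q-β) = (r-β)T,
and all powers of T cancel. -/
theorem coupledIntegrand_decouple (g : ℝ) (hβ : 0 < β) (mu rho : ℂ) (a b : ℝ) {p : ℝ × ℝ}
    (hp : Real.log β < p.1) :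
    (Real.exp p.1 * (Real.exp p.1 + Real.exp p.2
          + (Real.exp p.1 + (Real.exp p.1 ^ 2 - β ^ 2) * Real.exp (-p.2)))
        / ((Real.exp p.1 + Real.exp p.2)
          * (Real.exp p.1 + (Real.exp p.1 ^ 2 - β ^ 2) * Real.exp (-p.2)))) •
      coupledIntegrand g β mu rho a b (decouple β p)
      = boundaryIntegrand g β rho (a + b) p.1 *
        besselIntegrand (Complex.I * rho - Complex.I * mu) a
          (b * (Real.exp p.1 ^ 2 - β ^ 2)) p.2 := by
  have hr := (Real.log_lt_iff_lt_exp hβ).1 hp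
  have hc := sq_sub_sq_pos hβ hr
  obtain ⟨ξ, η⟩ := p
  dsimp only at hp hr hc ⊢
  have hwr := weight_log g hβ rho hr
  rw [Real.log_exp] at hwr
  rw [boundaryIntegrand, hwr, besselIntegrand, Real.exp_neg]
  have hr0 := Real.exp_pos ξ
  have hp0 := Real.exp_pos η
  have hlr : Real.log (Real.exp ξ) = ξ := Real.log_exp ξ
  have hlp : Real.log (Real.exp η) = η := Real.log_exp η
  simp only [decouple, coupledIntegrand]
  rw [Real.exp_neg]
  generalize Real.exp ξ = r at *
  generalize Real.exp η = p at *
  obtain ⟨q, hq⟩ : ∃ q, q = (r ^ 2 - β ^ 2) * p⁻¹ := ⟨_, rfl⟩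
  have hq0 : 0 < q := by rw [hq]; positivity
  have hpq : p * q = (r - β) * (r + β) := by rw [hq]; field_simp; ring
  have hbq : b * (r ^ 2 - β ^ 2) * p⁻¹ = b * q := by rw [hq]; ring
  rw [hbq, ← hq]
  have hrβ : 0 < r - β := by linarith
  have hrβ' : 0 < r + β := by linarith
  rw [weight_log g hβ mu (show β < r + p by linarith),
    weight_log g hβ rho (show β < r + q by linarith), Real.exp_log (by positivity),
    Real.exp_log (by positivity)]
  have T0 : 0 < r + p + (r + q) := by positivity
  have t1 : 0 < r + p - β := by linarith
  have t2 : 0 < r + p + β := by linarith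
  have s1 : 0 < r + q - β := by linarith
  have s2 : 0 < r + q + β := by linarith
  -- `E1` to `E5` are logarithms of product identities that follow from pq = r² - β²; after them the
  -- claim is linear in the logarithms.
  have E1 : Real.log (r + p - β) + Real.log (r + p + β) = η + Real.log (r + p + (r + q)) := by
    rw [← hlp, ← Real.log_mul t1.ne' t2.ne', ← Real.log_mul hp0.ne' T0.ne']
    congr 1; nlinarith
  have E2 : Real.log (r + q - β) + Real.log (r + q + β)
      = Real.log q + Real.log (r + p + (r + q)) := by
    rw [← Real.log_mul s1.ne' s2.ne', ← Real.log_mul hq0.ne' T0.ne']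
    congr 1; nlinarith
  have E3 : Real.log (r + p - β) + Real.log (r + q - β)
      = Real.log (r - β) + Real.log (r + p + (r + q)) := by
    rw [← Real.log_mul t1.ne' s1.ne', ← Real.log_mul hrβ.ne' T0.ne']
    congr 1; nlinarith
  have E4 : Real.log (r + p + β) + Real.log (r + q + β)
      = Real.log (r + β) + Real.log (r + p + (r + q)) := by
    rw [← Real.log_mul t2.ne' s2.ne', ← Real.log_mul hrβ'.ne' T0.ne']
    congr 1; nlinarith
  have E5 : η + Real.log q = Real.log (r - β) + Real.log (r + β) := by
    rw [← hlp, ← Real.log_mul hp0.ne' hq0.ne', ← Real.log_mul hrβ.ne' hrβ'.ne', hpq]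
  have E6 : r * (r + p + (r + q)) / ((r + p) * (r + q))
      = Real.exp (ξ + Real.log (r + p + (r + q)) - (Real.log (r + p) + Real.log (r + q))) := by
    rw [← hlr, Real.exp_sub, Real.exp_add, Real.exp_add, Real.exp_log hr0, Real.exp_log T0,
      Real.exp_log (by positivity), Real.exp_log (by positivity)]
  rw [E6, Complex.real_smul, Complex.ofReal_exp, ← Complex.exp_add, ← Complex.exp_add,
    ← Complex.exp_add, ← Complex.exp_add, ← Complex.exp_add]
  congr 1
  have E1 := congrArg (fun x : ℝ => (x : ℂ)) E1
  have E2 := congrArg (fun x : ℝ => (x : ℂ)) E2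
  have E3 := congrArg (fun x : ℝ => (x : ℂ)) E3
  have E4 := congrArg (fun x : ℝ => (x : ℂ)) E4
  have E5 := congrArg (fun x : ℝ => (x : ℂ)) E5
  push_cast at E1 E2 E3 E4 E5 ⊢
  linear_combination (-(Complex.I * mu)) * E1 - Complex.I * rho * E2 + (g - 1 : ℂ) * E3
    - (g : ℂ) * E4 - Complex.I * rho * E5

end Decouple

theorem coupledIntegrand_eq_indicator (g β : ℝ) (mu rho : ℂ) (a b : ℝ) :
    coupledIntegrand g β mu rho a b
      = (Set.Ioi (Real.log β) ×ˢ Set.Ioi (Real.log β)).indicator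
        (coupledIntegrand g β mu rho a b) := by
  ext p
  by_cases h : p ∈ Set.Ioi (Real.log β) ×ˢ Set.Ioi (Real.log β)
  · rw [Set.indicator_of_mem h]
  · rw [Set.indicator_of_notMem h]
    simp only [Set.mem_prod, Set.mem_Ioi, not_and_or] at h
    rcases h with h | h <;> simp [coupledIntegrand, weight, h]

/-- The decoupled form of the coupled boundary transform. -/
theorem coupledBoundary_eq {g β : ℝ} (hβ : 0 < β) {mu rho : ℂ} {a b : ℝ}
    (h : Integrable (coupledIntegrand g β mu rho a b)) :
    coupledBoundary g β mu rho a b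
      = ∫ ξ, boundaryIntegrand g β rho (a + b) ξ *
          bessel (Complex.I * rho - Complex.I * mu) a (b * (Real.exp ξ ^ 2 - β ^ 2)) := by
  have hS : MeasurableSet (Set.Ioi (Real.log β) ×ˢ (Set.univ : Set ℝ)) :=
    measurableSet_Ioi.prod MeasurableSet.univ
  have hS' : MeasurableSet (Set.Ioi (Real.log β) ×ˢ Set.Ioi (Real.log β)) :=
    measurableSet_Ioi.prod measurableSet_Ioi
  have hf := fun (p : ℝ × ℝ) (hp : p ∈ Set.Ioi (Real.log β) ×ˢ (Set.univ : Set ℝ)) =>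
    (decouple_hasFDerivAt hβ hp.1).hasFDerivWithinAt (s := Set.Ioi (Real.log β) ×ˢ Set.univ)
  have key : ∀ p ∈ Set.Ioi (Real.log β) ×ˢ (Set.univ : Set ℝ), _ = _ := fun p hp =>
    (congrArg (fun c : ℝ => c • coupledIntegrand g β mu rho a b (decouple β p))
      (decouple_det hβ hp.1)).trans (coupledIntegrand_decouple g hβ mu rho a b hp.1)
  -- The change of variables transports integrability as well, which permits iterating the decoupled
  -- integral.
  have hint : Integrable (fun p : ℝ × ℝ => boundaryIntegrand g β rho (a + b) p.1 *
      besselIntegrand (Complex.I * rho - Complex.I * mu) a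
        (b * (Real.exp p.1 ^ 2 - β ^ 2)) p.2)
      ((volume.restrict (Set.Ioi (Real.log β))).prod volume) := by
    have h' := h.integrableOn (s := Set.Ioi (Real.log β) ×ˢ Set.Ioi (Real.log β))
    rw [← decouple_image hβ, integrableOn_image_iff_integrableOn_abs_det_fderiv_smul _ hS hf
      (decouple_leftInvOn hβ).injOn] at h'
    have h'' := h'.congr_fun key hS
    rw [IntegrableOn, Measure.volume_eq_prod, ← Measure.prod_restrict, Measure.restrict_univ]
      at h''
    exact h''
  rw [coupledBoundary, coupledIntegrand_eq_indicator, integral_indicator hS',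
    ← decouple_image hβ, integral_image_eq_integral_abs_det_fderiv_smul _ hS hf
      (decouple_leftInvOn hβ).injOn, setIntegral_congr_fun hS key, Measure.volume_eq_prod,
    ← Measure.prod_restrict, Measure.restrict_univ, integral_prod _ hint]
  simp only [integral_const_mul]
  rw [setIntegral_eq_integral_of_forall_compl_eq_zero]
  · rfl
  · intro x hx
    simp only [Set.mem_Ioi] at hx
    simp [boundaryIntegrand, weight, hx]

/-- In decoupled form μ and ρ enter through the outer weight and the index i(ρ-μ) of the inner
Macdonald function, and reflecting that index exchanges them. -/
theorem coupledBoundary_swap {g β : ℝ} (hβ : 0 < β) {mu rho : ℂ} {a b : ℝ} (ha : 0 < a)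
    (hb : 0 < b) (h₁ : Integrable (coupledIntegrand g β mu rho a b))
    (h₂ : Integrable (coupledIntegrand g β rho mu a b)) :
    Complex.exp ((Complex.I * rho - Complex.I * mu) * (Real.log a - Real.log b : ℝ)) *
      coupledBoundary g β mu rho a b = coupledBoundary g β rho mu a b := by
  rw [coupledBoundary_eq hβ h₁, coupledBoundary_eq hβ h₂, ← integral_const_mul]
  congr 1; ext ξ
  by_cases hξ : Real.log β < ξ
  · have hr := (Real.log_lt_iff_lt_exp hβ).1 hξ
    have hc := sq_sub_sq_pos hβ hr
    have h1 : 0 < Real.exp ξ - β := by linarith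
    have h2 : 0 < Real.exp ξ + β := by linarith
    have w1 := weight_log g hβ rho hr
    have w2 := weight_log g hβ mu hr
    rw [Real.log_exp] at w1 w2
    -- The reflection factor is (b(r² - β²)/a)^{i(ρ-μ)} with r = e^ξ. Its part (r² - β²)^{i(ρ-μ)}
    -- converts the weight and character of ρ into those of μ; the part in a and b cancels the
    -- prefactor.
    rw [bessel_reflect _ ha (mul_pos hb hc), neg_sub, ← mul_assoc, ← mul_assoc,
      boundaryIntegrand, boundaryIntegrand, w1, w2]
    congr 1
    rw [← Complex.exp_add, ← Complex.exp_add, ← Complex.exp_add, ← Complex.exp_add,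
      Real.log_mul hb.ne' hc.ne',
      show Real.exp ξ ^ 2 - β ^ 2 = (Real.exp ξ - β) * (Real.exp ξ + β) by ring,
      Real.log_mul h1.ne' h2.ne']
    congr 1; push_cast; ring
  · simp [boundaryIntegrand, weight, hξ]

/-- For b = 0 the inner Macdonald integral no longer depends on ξ and is a Gamma function. -/
theorem coupledBoundary_zero {g β : ℝ} (hβ : 0 < β) {mu rho : ℂ} {a : ℝ} (ha : 0 < a)
    (hre : 0 < (Complex.I * rho - Complex.I * mu).re)
    (h : Integrable (coupledIntegrand g β mu rho a 0)) :
    coupledBoundary g β mu rho a 0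
      = Complex.Gamma (Complex.I * rho - Complex.I * mu) *
        Complex.exp (-((Complex.I * rho - Complex.I * mu) * (Real.log a : ℝ))) *
        boundary g β rho a := by
  rw [coupledBoundary_eq hβ h]
  simp only [zero_mul, add_zero]
  rw [integral_mul_const, bessel_zero_right hre ha, mul_comm]
  rfl

theorem coupledIntegrand_neg_self (g β : ℝ) (lam : ℂ) (a : ℝ) (p : ℝ × ℝ) :
    coupledIntegrand g β (-lam) lam a 0 p
      = boundaryIntegrand g β (-lam) a p.1 * boundaryIntegrand g β lam 0 p.2 := by
  simp only [coupledIntegrand, boundaryIntegrand]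
  rw [mul_mul_mul_comm, ← Complex.exp_add]
  congr 2; push_cast; ring

/-- Kummer's transformation of the boundary transform. -/
theorem boundary_neg {g β : ℝ} (hβ : 0 < β) {lam : ℂ} {a : ℝ} (ha : 0 < a)
    (h1 : -g < lam.im) (h2 : lam.im < 0) :
    Complex.exp (Complex.I * lam * (Real.log 2 + Real.log β : ℝ)) /
        Complex.Gamma (g - Complex.I * lam) *
        (Complex.exp (-(2 * Complex.I * lam * (Real.log a : ℝ))) * boundary g β lam a)
      = Complex.exp (-(Complex.I * lam) * (Real.log 2 + Real.log β : ℝ)) /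
        Complex.Gamma (g + Complex.I * lam) * boundary g β (-lam) a := by
  have i1 : Integrable (boundaryIntegrand g β (-lam) a) := by
    rw [integrable_boundaryIntegrand_iff]
    exact integrable_absBoundaryIntegrand hβ (by simp; linarith) _ ha
  have i2 : Integrable (boundaryIntegrand g β lam 0) := by
    rw [integrable_boundaryIntegrand_iff]
    exact integrable_absBoundaryIntegrand_zero hβ h1 (by linarith)
  have hint : Integrable (coupledIntegrand g β (-lam) lam a 0) := by
    simp only [funext (coupledIntegrand_neg_self g β lam a)]
    exact i1.mul_prod i2
  -- The coupled integral with μ = -λ, ρ = λ, b = 0 is computed twice: decoupled, and as the product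
  -- it is when μ + ρ = 0. The factor with vanishing coefficient is the beta integral of
  -- `boundary_zero`.
  have e1 := coupledBoundary_zero hβ ha (by simp; linarith) hint
  have e2 : coupledBoundary g β (-lam) lam a 0
      = boundary g β (-lam) a * boundary g β lam 0 := by
    rw [coupledBoundary]
    simp only [coupledIntegrand_neg_self]
    exact integral_prod_mul _ _
  have e3 := boundary_zero hβ h1 h2
  have G1 : Complex.Gamma (2 * Complex.I * lam) ≠ 0 :=
    Complex.Gamma_ne_zero_of_re_pos (by simp; linarith)
  have G2 : Complex.Gamma (g - Complex.I * lam) ≠ 0 :=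
    Complex.Gamma_ne_zero_of_re_pos (by simp; linarith)
  have G3 : Complex.Gamma (g + Complex.I * lam) ≠ 0 :=
    Complex.Gamma_ne_zero_of_re_pos (by simp; linarith)
  rw [e2, show Complex.I * lam - Complex.I * -lam = 2 * Complex.I * lam by ring] at e1
  have e4 : Complex.exp (-(2 * Complex.I * lam) * (Real.log 2 + Real.log β : ℝ)) *
      Complex.exp (Complex.I * lam * (Real.log 2 + Real.log β : ℝ))
      = Complex.exp (-(Complex.I * lam) * (Real.log 2 + Real.log β : ℝ)) := by
    rw [← Complex.exp_add]; congr 1; ring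
  rw [div_mul_eq_mul_div, div_mul_eq_mul_div, div_eq_div_iff G2 G3, ← e4]
  refine mul_left_cancel₀ G1 ?_
  linear_combination (-Complex.exp (Complex.I * lam * (Real.log 2 + Real.log β : ℝ)) *
    Complex.Gamma (g + Complex.I * lam)) * e1
    + Complex.exp (Complex.I * lam * (Real.log 2 + Real.log β : ℝ)) * boundary g β (-lam) a * e3

/-! ### Kernels as products of one-dimensional integrals -/

theorem integrable_prod_succ {n : ℕ} {f₀ : ℝ → ℂ} {f : Fin n → ℝ → ℂ} (h₀ : Integrable f₀)
    (h : ∀ j, Integrable (f j)) :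
    Integrable fun z : Fin (n + 1) → ℝ => f₀ (z 0) * ∏ j, f j (z j.succ) := by
  have := Integrable.fintype_prod (ι := Fin (n + 1)) (μ := fun _ => (volume : Measure ℝ))
    (f := Fin.cons (α := fun _ => ℝ → ℂ) f₀ f) (fun k => by
      induction k using Fin.cases with
      | zero => simpa using h₀
      | succ j => simpa using h j)
  simp only [Fin.prod_univ_succ, Fin.cons_zero, Fin.cons_succ] at this
  exact this

theorem integral_prod_succ {n : ℕ} (f₀ : ℝ → ℂ) (f : Fin n → ℝ → ℂ) :
    ∫ z : Fin (n + 1) → ℝ, f₀ (z 0) * ∏ j, f j (z j.succ) = (∫ t, f₀ t) * ∏ j, ∫ t, f j t := by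
  have := integral_fintype_prod_volume_eq_prod (ι := Fin (n + 1)) (E := fun _ => ℝ) (𝕜 := ℂ)
    (Fin.cons (α := fun _ => ℝ → ℂ) f₀ f)
  simpa only [Fin.prod_univ_succ, Fin.cons_zero, Fin.cons_succ] using this

/-- Extend a tuple by a final zero. -/
def snocZero {n : ℕ} (f : Fin n → ℝ) : Fin (n + 1) → ℝ := Fin.snoc (α := fun _ => ℝ) f 0

@[simp] theorem snocZero_castSucc {n : ℕ} (f : Fin n → ℝ) (j : Fin n) :
    snocZero f j.castSucc = f j := by simp [snocZero]

@[simp] theorem snocZero_last {n : ℕ} (f : Fin n → ℝ) : snocZero f (Fin.last n) = 0 := by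
  simp [snocZero]

theorem snocZero_nonneg {n : ℕ} {f : Fin n → ℝ} (hf : ∀ j, 0 ≤ f j) (k : Fin (n + 1)) :
    0 ≤ snocZero f k := by
  induction k using Fin.lastCases with
  | last => simp
  | cast j => simpa using hf j

/-- The integrand of a row of auxiliary variables. -/
def rowIntegrand (g β : ℝ) (lam : ℂ) {n : ℕ} (C : Fin (n + 1) → ℝ) (D : Fin n → ℝ)
    (z : Fin (n + 1) → ℝ) : ℂ :=
  boundaryIntegrand g β lam (C 0) (z 0) *
    ∏ j, besselIntegrand (-(2 * Complex.I * lam)) (C j.succ) (D j) (z j.succ)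

/-- The integral over a row of auxiliary variables. -/
def row (g β : ℝ) (lam : ℂ) {n : ℕ} (C : Fin (n + 1) → ℝ) (D : Fin n → ℝ) : ℂ :=
  boundary g β lam (C 0) * ∏ j, bessel (-(2 * Complex.I * lam)) (C j.succ) (D j)

theorem integral_rowIntegrand (g β : ℝ) (lam : ℂ) {n : ℕ} (C : Fin (n + 1) → ℝ)
    (D : Fin n → ℝ) : ∫ z, rowIntegrand g β lam C D z = row g β lam C D :=
  integral_prod_succ _ _

theorem rowIntegrand_eq (g β : ℝ) (lam : ℂ) {n : ℕ} (C : Fin (n + 1) → ℝ) (D : Fin n → ℝ)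
    (z : Fin (n + 1) → ℝ) :
    rowIntegrand g β lam C D z = weight g β lam (z 0) *
      Complex.exp (-(2 * Complex.I * lam) * (∑ k, z k : ℝ)
        - ((∑ k, C k * Real.exp (z k) + ∑ j, D j * Real.exp (-z j.succ) : ℝ) : ℂ)) := by
  simp only [rowIntegrand, boundaryIntegrand, besselIntegrand]
  rw [← Complex.exp_sum, mul_assoc, ← Complex.exp_add]
  congr 2
  simp only [Fin.sum_univ_succ, Finset.sum_sub_distrib, Finset.sum_add_distrib, Complex.ofReal_add,
    Complex.ofReal_sum, ← Finset.mul_sum]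
  ring

theorem ae_boundaryWeight_eq {g β : ℝ} (hβ : 0 < β) (lam : ℂ) (n : ℕ) :
    ∀ᵐ z : Fin (n + 1) → ℝ, boundaryWeight g β lam (z 0) = weight g β lam (z 0) :=
  (Measure.tendsto_eval_ae_ae (μ := fun _ : Fin (n + 1) => (volume : Measure ℝ))
    (i := 0)).eventually (boundaryWeight_ae_eq hβ lam)

section Coefficients

variable {n : ℕ}

/-- The coefficients of `e^{z_k}` in the raising kernel. -/
def raisingUp (x : Fin (n + 1) → ℝ) (y : Fin n → ℝ) (k : Fin (n + 1)) : ℝ :=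
  Real.exp (-x k) + snocZero (fun j => Real.exp (-y j)) k

/-- The coefficients of `e^{-z_{j+1}}` in the raising kernel. -/
def raisingDown (x : Fin (n + 1) → ℝ) (y : Fin n → ℝ) (j : Fin n) : ℝ :=
  Real.exp (x j.castSucc) + Real.exp (y j)

/-- The coefficients of `e^{z_k}` in the reduced Baxter kernel. -/
def pairUp (x y : Fin n → ℝ) (k : Fin n) : ℝ := Real.exp (-x k) + Real.exp (-y k)

/-- The coefficients of `e^{-z_{j+1}}` in the Baxter kernel. -/
def pairDown (x y : Fin n → ℝ) (k : Fin n) : ℝ := Real.exp (x k) + Real.exp (y k)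

theorem raisingUp_pos (x : Fin (n + 1) → ℝ) (y : Fin n → ℝ) (k : Fin (n + 1)) :
    0 < raisingUp x y k :=
  add_pos_of_pos_of_nonneg (Real.exp_pos _) (snocZero_nonneg (fun _ => (Real.exp_pos _).le) k)

theorem raisingDown_pos (x : Fin (n + 1) → ℝ) (y : Fin n → ℝ) (j : Fin n) :
    0 < raisingDown x y j := add_pos (Real.exp_pos _) (Real.exp_pos _)

theorem pairUp_pos (x y : Fin n → ℝ) (k : Fin n) : 0 < pairUp x y k :=
  add_pos (Real.exp_pos _) (Real.exp_pos _)

theorem pairDown_pos (x y : Fin n → ℝ) (k : Fin n) : 0 < pairDown x y k :=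
  add_pos (Real.exp_pos _) (Real.exp_pos _)

/-- From e^x + e^y = (e^{-x} + e^{-y}) e^{x+y}. Relations of this kind are what makes products of
reflection factors telescope. -/
theorem log_pairDown (x y : Fin n → ℝ) (k : Fin n) :
    Real.log (pairDown x y k) = Real.log (pairUp x y k) + (x k + y k) := by
  rw [← Real.log_exp (x k + y k), ← Real.log_mul (pairUp_pos x y k).ne' (Real.exp_pos _).ne']
  congr 1
  rw [pairDown, pairUp, add_mul, ← Real.exp_add, ← Real.exp_add, add_comm]
  congr 2 <;> ring

end Coefficients

theorem raisingIntegrand_ae_eq {g β : ℝ} (hβ : 0 < β) (n : ℕ) (lam : ℂ)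
    (x : Fin (n + 1) → ℝ) (y : Fin n → ℝ) :
    raisingIntegrand g β n lam x y =ᵐ[volume] fun z =>
      Complex.exp (Complex.I * lam * (∑ k, x k + ∑ j, y j : ℝ)) *
        rowIntegrand g β lam (raisingUp x y) (raisingDown x y) z := by
  filter_upwards [ae_boundaryWeight_eq hβ lam n] with z hz
  rw [raisingIntegrand, hz, rowIntegrand_eq, mul_left_comm, ← Complex.exp_add]
  congr 2
  have : ∑ k, raisingUp x y k * Real.exp (z k) + ∑ j, raisingDown x y j * Real.exp (-z j.succ)
      = ∑ j : Fin n, (Real.exp (z j.castSucc - x j.castSucc) + Real.exp (z j.castSucc - y j)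
          + Real.exp (x j.castSucc - z j.succ) + Real.exp (y j - z j.succ))
        + Real.exp (z (Fin.last n) - x (Fin.last n)) := by
    rw [Fin.sum_univ_castSucc]
    simp only [raisingUp, raisingDown, snocZero_castSucc, snocZero_last, add_mul, ← Real.exp_add,
      Finset.sum_add_distrib, add_zero]
    simp only [neg_add_eq_sub, ← sub_eq_add_neg]
    ring
  rw [this]; push_cast; ring

theorem baxterIntegrand_ae_eq {g β : ℝ} (hβ : 0 < β) (n : ℕ) (lam : ℂ) (x y : Fin n → ℝ) :
    baxterIntegrand g β n lam x y =ᵐ[volume] fun z =>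
      Complex.exp (Complex.I * lam * (∑ k, x k + ∑ j, y j : ℝ)) *
        rowIntegrand g β lam (snocZero (pairUp x y)) (pairDown x y) z := by
  filter_upwards [ae_boundaryWeight_eq hβ lam n] with z hz
  rw [baxterIntegrand, hz, rowIntegrand_eq, mul_left_comm, ← Complex.exp_add]
  congr 2
  have : ∑ k, snocZero (pairUp x y) k * Real.exp (z k)
        + ∑ j, pairDown x y j * Real.exp (-z j.succ)
      = ∑ j : Fin n, (Real.exp (z j.castSucc - x j) + Real.exp (z j.castSucc - y j)
          + Real.exp (x j - z j.succ) + Real.exp (y j - z j.succ)) := by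
    rw [Fin.sum_univ_castSucc]
    simp only [pairUp, pairDown, snocZero_castSucc, snocZero_last, add_mul, ← Real.exp_add,
      Finset.sum_add_distrib, zero_mul, add_zero]
    simp only [neg_add_eq_sub, ← sub_eq_add_neg]
    ring
  rw [this]; push_cast; ring

theorem reducedBaxterIntegrand_ae_eq {g β : ℝ} (hβ : 0 < β) (n : ℕ) (lam : ℂ)
    (x y : Fin (n + 1) → ℝ) :
    reducedBaxterIntegrand g β n lam x y =ᵐ[volume] fun z =>
      Complex.exp (-(Complex.I * lam) * (∑ k, x k + ∑ j, y j : ℝ)) *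
        rowIntegrand g β (-lam) (pairUp x y) (fun j => pairDown x y j.castSucc) z := by
  filter_upwards [ae_boundaryWeight_eq hβ (-lam) n] with z hz
  rw [reducedBaxterIntegrand, hz, rowIntegrand_eq, mul_left_comm, ← Complex.exp_add]
  congr 2
  have : ∑ k, pairUp x y k * Real.exp (z k)
        + ∑ j : Fin n, pairDown x y j.castSucc * Real.exp (-z j.succ)
      = ∑ j : Fin n, (Real.exp (z j.castSucc - x j.castSucc)
          + Real.exp (z j.castSucc - y j.castSucc)
          + Real.exp (x j.castSucc - z j.succ) + Real.exp (y j.castSucc - z j.succ))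
        + Real.exp (z (Fin.last n) - x (Fin.last n))
        + Real.exp (z (Fin.last n) - y (Fin.last n)) := by
    rw [Fin.sum_univ_castSucc]
    simp only [pairUp, pairDown, add_mul, ← Real.exp_add, Finset.sum_add_distrib]
    simp only [neg_add_eq_sub, ← sub_eq_add_neg]
    ring
  rw [this]; push_cast; ring

theorem integrable_rowIntegrand {g β : ℝ} {lam : ℂ} {n : ℕ} {C : Fin (n + 1) → ℝ}
    {D : Fin n → ℝ} (h₀ : Integrable (boundaryIntegrand g β lam (C 0)))
    (h : ∀ j : Fin n, Integrable (besselIntegrand (-(2 * Complex.I * lam)) (C j.succ) (D j))) :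
    Integrable (rowIntegrand g β lam C D) :=
  integrable_prod_succ h₀ h

theorem integrable_rowIntegrand_of_pos {g β : ℝ} (hβ : 0 < β) {lam : ℂ} (hlam : -g < lam.im)
    {n : ℕ} {C : Fin (n + 1) → ℝ} {D : Fin n → ℝ} (hC : ∀ k, 0 < C k) (hD : ∀ j, 0 < D j) :
    Integrable (rowIntegrand g β lam C D) :=
  integrable_rowIntegrand
    ((integrable_boundaryIntegrand_iff ..).2 (integrable_absBoundaryIntegrand hβ hlam _ (hC 0)))
    fun j => (integrable_besselIntegrand_iff ..).2
      (integrable_absBesselIntegrand _ (hC j.succ) (hD j))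

theorem integrable_raisingIntegrand {g β : ℝ} (hβ : 0 < β) {n : ℕ} {lam : ℂ}
    (hlam : -g < lam.im) (x : Fin (n + 1) → ℝ) (y : Fin n → ℝ) :
    Integrable (fun z => raisingIntegrand g β n lam x y z) :=
  ((integrable_rowIntegrand_of_pos hβ hlam (raisingUp_pos x y)
    (raisingDown_pos x y)).const_mul _).congr (raisingIntegrand_ae_eq hβ n lam x y).symm

theorem integrable_reducedBaxterIntegrand {g β : ℝ} (hβ : 0 < β) {n : ℕ} {lam : ℂ}
    (hlam : lam.im < g) (x y : Fin (n + 1) → ℝ) :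
    Integrable (fun z => reducedBaxterIntegrand g β n lam x y z) :=
  ((integrable_rowIntegrand_of_pos hβ (by simpa using hlam) (pairUp_pos x y)
    (fun j => pairDown_pos x y j.castSucc)).const_mul _).congr
      (reducedBaxterIntegrand_ae_eq hβ n lam x y).symm

theorem integrable_baxterIntegrand {g β : ℝ} (hβ : 0 < β) {n : ℕ} {lam : ℂ}
    (h1 : -g < lam.im) (h2 : lam.im < 0) (x y : Fin n → ℝ) :
    Integrable (fun z => baxterIntegrand g β n lam x y z) := by
  refine ((integrable_rowIntegrand ?_ fun j => ?_).const_mul _).congr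
    (baxterIntegrand_ae_eq hβ n lam x y).symm
  · rw [integrable_boundaryIntegrand_iff]
    -- The coefficient of e^{z_1} vanishes only when there are no particles; convergence at +∞ then
    -- relies on Im λ < 0.
    rcases (snocZero_nonneg (fun j => (pairUp_pos x y j).le) 0).eq_or_lt with h | h
    · rw [← h]; exact integrable_absBoundaryIntegrand_zero hβ h1 (by linarith)
    · exact integrable_absBoundaryIntegrand hβ h1 _ h
  · rw [integrable_besselIntegrand_iff]
    refine integrable_absBesselIntegrand_right ?_
      (snocZero_nonneg (fun j => (pairUp_pos x y j).le) _) (pairDown_pos x y j)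
    simp; linarith

theorem raisingKernel_eq {g β : ℝ} (hβ : 0 < β) (n : ℕ) (lam : ℂ)
    (x : Fin (n + 1) → ℝ) (y : Fin n → ℝ) :
    raisingKernel g β n lam x y
      = (2 * (β : ℂ)) ^ (Complex.I * lam) / Complex.Gamma ((g : ℂ) - Complex.I * lam) *
        (Complex.exp (Complex.I * lam * (∑ k, x k + ∑ j, y j : ℝ)) *
          row g β lam (raisingUp x y) (raisingDown x y)) := by
  rw [raisingKernel, integral_congr_ae (raisingIntegrand_ae_eq hβ n lam x y),
    integral_const_mul, integral_rowIntegrand]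

theorem baxterKernel_eq_row {g β : ℝ} (hβ : 0 < β) (n : ℕ) (lam : ℂ) (x y : Fin n → ℝ) :
    baxterKernel g β n lam x y
      = (2 * (β : ℂ)) ^ (Complex.I * lam) / Complex.Gamma ((g : ℂ) - Complex.I * lam) *
        (Complex.exp (Complex.I * lam * (∑ k, x k + ∑ j, y j : ℝ)) *
          row g β lam (snocZero (pairUp x y)) (pairDown x y)) := by
  rw [baxterKernel, integral_congr_ae (baxterIntegrand_ae_eq hβ n lam x y),
    integral_const_mul, integral_rowIntegrand]

theorem reducedBaxterKernel_eq {g β : ℝ} (hβ : 0 < β) (n : ℕ) (lam : ℂ)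
    (x y : Fin (n + 1) → ℝ) :
    reducedBaxterKernel g β n lam x y
      = (2 * (β : ℂ)) ^ (-(Complex.I * lam)) / Complex.Gamma ((g : ℂ) + Complex.I * lam) *
        (Complex.exp (-(Complex.I * lam) * (∑ k, x k + ∑ j, y j : ℝ)) *
          row g β (-lam) (pairUp x y) (fun j => pairDown x y j.castSucc)) := by
  rw [reducedBaxterKernel, integral_congr_ae (reducedBaxterIntegrand_ae_eq hβ n lam x y),
    integral_const_mul, integral_rowIntegrand]

theorem cpow_two_mul {β : ℝ} (hβ : 0 < β) (c : ℂ) :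
    (2 * (β : ℂ)) ^ c = Complex.exp (c * (Real.log 2 + Real.log β : ℝ)) := by
  rw [← Real.log_mul two_ne_zero hβ.ne', Complex.cpow_def_of_ne_zero (by simp [hβ.ne']),
    Complex.ofReal_log (by positivity), mul_comm]
  push_cast; rfl

/-! ### Proportionality of the two Baxter kernels -/

/-- Reflection of all indices in the row of a Baxter kernel. -/
theorem prod_bessel_pair {n : ℕ} {ν : ℂ} (hre : 0 < ν.re) (x y : Fin (n + 1) → ℝ) :
    ∏ j, bessel (-ν) (snocZero (pairUp x y) j.succ) (pairDown x y j)
      = Complex.Gamma ν * (Complex.exp (-ν * (∑ k, x k + ∑ j, y j : ℝ)) *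
          Complex.exp (-(ν * (Real.log (pairUp x y 0) : ℝ)))) *
        ∏ j : Fin n, bessel ν (pairUp x y j.succ) (pairDown x y j.castSucc) := by
  -- The extra variable z_{n+1} of the Baxter kernel has no e^{z} term, hence the factor Γ(ν).
  have hlast : bessel (-ν) 0 (pairDown x y (Fin.last n))
      = Complex.Gamma ν * Complex.exp (-ν * (Real.log (pairDown x y (Fin.last n)) : ℝ)) := by
    rw [bessel_zero_left (by simpa using hre) (pairDown_pos x y _), neg_neg]
  have hmid : ∀ j : Fin n, bessel (-ν) (pairUp x y j.succ) (pairDown x y j.castSucc)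
      = Complex.exp (-ν * (Real.log (pairDown x y j.castSucc)
          - Real.log (pairUp x y j.succ) : ℝ)) *
        bessel ν (pairUp x y j.succ) (pairDown x y j.castSucc) := fun j => by
    rw [bessel_reflect (-ν) (pairUp_pos x y _) (pairDown_pos x y _), neg_neg]
  rw [Fin.prod_univ_castSucc, Fin.succ_last, snocZero_last, hlast]
  simp only [← Fin.castSucc_succ, snocZero_castSucc, hmid, Finset.prod_mul_distrib]
  rw [← Complex.exp_sum]
  have hsum : Complex.exp (∑ j : Fin n, -ν * (Real.log (pairDown x y j.castSucc)
          - Real.log (pairUp x y j.succ) : ℝ)) *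
        Complex.exp (-ν * (Real.log (pairDown x y (Fin.last n)) : ℝ))
      = Complex.exp (-ν * (∑ k, x k + ∑ j, y j : ℝ)) *
        Complex.exp (-(ν * (Real.log (pairUp x y 0) : ℝ))) := by
    rw [← Complex.exp_add, ← Complex.exp_add, ← Finset.mul_sum, ← Complex.ofReal_sum]
    have hL : ∑ j : Fin n, (Real.log (pairDown x y j.castSucc)
          - Real.log (pairUp x y j.succ)) + Real.log (pairDown x y (Fin.last n))
        = ∑ k, x k + ∑ j, y j + Real.log (pairUp x y 0) := by
      have e1 := Fin.sum_univ_castSucc fun k => Real.log (pairDown x y k)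
      have e2 := Fin.sum_univ_succ fun k => Real.log (pairUp x y k)
      simp only [log_pairDown, Finset.sum_add_distrib] at e1 e2
      simp only [Finset.sum_sub_distrib, log_pairDown, Finset.sum_add_distrib]
      linarith
    congr 1
    have hL := congrArg (fun r : ℝ => -ν * (r : ℂ)) hL
    simp only [Complex.ofReal_add] at hL ⊢
    linear_combination hL
  rw [← hsum]; ring

/-- The Baxter kernel is proportional to the reduced one. -/
theorem baxterKernel_eq {g β : ℝ} (hβ : 0 < β) (n : ℕ) {lam : ℂ} (h1 : -g < lam.im)
    (h2 : lam.im < 0) (x y : Fin (n + 1) → ℝ) :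
    baxterKernel g β (n + 1) lam x y
      = Complex.Gamma (2 * Complex.I * lam) * reducedBaxterKernel g β n lam x y := by
  set ν : ℂ := 2 * Complex.I * lam with hν
  have hre : 0 < ν.re := by simp [hν]; linarith
  have hrow : row g β lam (snocZero (pairUp x y)) (pairDown x y)
      = Complex.Gamma ν * Complex.exp (-ν * (∑ k, x k + ∑ j, y j : ℝ)) *
        (Complex.exp (-(ν * (Real.log (pairUp x y 0) : ℝ))) * boundary g β lam (pairUp x y 0)) *
        ∏ j : Fin n, bessel ν (pairUp x y j.succ) (pairDown x y j.castSucc) := by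
    rw [row, ← hν, prod_bessel_pair hre, ← Fin.castSucc_zero, snocZero_castSucc]
    ring
  -- The power of `pairUp x y 0` left over by the telescoping is precisely the one in Kummer's
  -- transformation.
  have hk := boundary_neg hβ (pairUp_pos x y 0) h1 h2
  rw [← hν] at hk
  rw [baxterKernel_eq_row hβ, reducedBaxterKernel_eq hβ, hrow, row, cpow_two_mul hβ,
    cpow_two_mul hβ, show -(2 * Complex.I * -lam) = ν by rw [hν]; ring]
  have he : Complex.exp (Complex.I * lam * (∑ k, x k + ∑ j, y j : ℝ)) *
      Complex.exp (-ν * (∑ k, x k + ∑ j, y j : ℝ))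
      = Complex.exp (-(Complex.I * lam) * (∑ k, x k + ∑ j, y j : ℝ)) := by
    rw [← Complex.exp_add]; congr 1; rw [hν]; ring
  rw [← he]
  linear_combination (Complex.exp (Complex.I * lam * (∑ k, x k + ∑ j, y j : ℝ)) *
    Complex.exp (-ν * (∑ k, x k + ∑ j, y j : ℝ)) * Complex.Gamma ν *
    ∏ j : Fin n, bessel ν (pairUp x y j.succ) (pairDown x y j.castSucc)) * hk

/-! ### Exponentially localised kernels and their composition -/

theorem integrable_exp_neg_mul_abs {ε : ℝ} (hε : 0 < ε) :
    Integrable fun t : ℝ => Real.exp (-ε * |t|) := by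
  rw [← integrableOn_univ, ← Set.Iic_union_Ioi (a := (0 : ℝ))]
  refine IntegrableOn.union ?_ ?_
  · refine (integrableOn_exp_mul_Iic hε 0).congr_fun (fun t ht => ?_) measurableSet_Iic
    simp [abs_of_nonpos (Set.mem_Iic.1 ht)]
  · refine (integrableOn_exp_mul_Ioi (neg_neg_of_pos hε) 0).congr_fun (fun t ht => ?_)
      measurableSet_Ioi
    simp [abs_of_pos (Set.mem_Ioi.1 ht)]

/-- A measurable kernel which is exponentially localised relative to the weight `e^{s Σ x}`. -/
def LocalKernel (s : ℝ) {m n : ℕ} (k : (Fin m → ℝ) → (Fin n → ℝ) → ℂ) : Prop :=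
  Measurable (Function.uncurry k) ∧ ∃ M ε : ℝ, 0 ≤ M ∧ 0 < ε ∧
    ∃ p : (Fin m → ℝ) → (Fin n → ℝ), ∀ x y, ‖k x y‖ * Real.exp (s * ∑ j, y j)
      ≤ M * Real.exp (s * ∑ j, x j) * ∏ j, Real.exp (-ε * |y j - p x j|)

/-- A measurable function bounded by a multiple of `e^{s Σ x}`. -/
def ExpBounded (s : ℝ) {n : ℕ} (φ : (Fin n → ℝ) → ℂ) : Prop :=
  Measurable φ ∧ ∃ C : ℝ, 0 ≤ C ∧ ∀ y, ‖φ y‖ ≤ C * Real.exp (s * ∑ j, y j)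

section LocalKernel

variable {s : ℝ} {l m n : ℕ} {k : (Fin m → ℝ) → (Fin n → ℝ) → ℂ}

/-- The dominating product has an integral independent of its centre p(x), so the bound is uniform
in x apart from the weight e^{sΣx}. -/
theorem LocalKernel.integrable_and_le (hk : LocalKernel s k) {φ : (Fin n → ℝ) → ℂ}
    (hφ : ExpBounded s φ) :
    (∀ x, Integrable fun y => k x y * φ y) ∧
      ∃ C, 0 ≤ C ∧ ∀ x, ∫ y, ‖k x y * φ y‖ ≤ C * Real.exp (s * ∑ j, x j) := by
  obtain ⟨hm, M, ε, hM, hε, p, hb⟩ := hk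
  obtain ⟨hφm, C, hC, hφ⟩ := hφ
  have hbound : ∀ x y, ‖k x y * φ y‖
      ≤ C * M * Real.exp (s * ∑ j, x j) * ∏ j, Real.exp (-ε * |y j - p x j|) := fun x y =>
    calc ‖k x y * φ y‖ = ‖k x y‖ * ‖φ y‖ := norm_mul _ _
      _ ≤ ‖k x y‖ * (C * Real.exp (s * ∑ j, y j)) :=
        mul_le_mul_of_nonneg_left (hφ y) (norm_nonneg _)
      _ = C * (‖k x y‖ * Real.exp (s * ∑ j, y j)) := by ring
      _ ≤ _ := (mul_le_mul_of_nonneg_left (hb x y) hC).trans (le_of_eq (by ring))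
  have hi : ∀ x, Integrable fun y : Fin n → ℝ => C * M * Real.exp (s * ∑ j, x j) *
      ∏ j, Real.exp (-ε * |y j - p x j|) := fun x => by
    refine Integrable.const_mul ?_ _
    exact Integrable.fintype_prod (μ := fun _ : Fin n => (volume : Measure ℝ))
      (f := fun j t => Real.exp (-ε * |t - p x j|))
      fun j => (integrable_exp_neg_mul_abs hε).comp_sub_right (p x j)
  have hmeas : ∀ x, Measurable fun y => k x y * φ y := fun x =>
    (hm.comp (measurable_const.prodMk measurable_id)).mul hφm
  refine ⟨fun x => (hi x).mono' (hmeas x).aestronglyMeasurable (ae_of_all _ (hbound x)),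
    C * M * ∏ _j : Fin n, ∫ t, Real.exp (-ε * |t|), ?_, fun x => ?_⟩
  · refine mul_nonneg (mul_nonneg hC hM) (Finset.prod_nonneg fun j _ =>
      integral_nonneg fun t => (Real.exp_pos _).le)
  · refine (integral_mono_of_nonneg (ae_of_all _ fun y => norm_nonneg _) (hi x)
      (ae_of_all _ (hbound x))).trans (le_of_eq ?_)
    rw [integral_const_mul, integral_fintype_prod_volume_eq_prod (E := fun _ => ℝ)
      (fun j t => Real.exp (-ε * |t - p x j|))]
    have : ∀ j, ∫ t, Real.exp (-ε * |t - p x j|) = ∫ t, Real.exp (-ε * |t|) := fun j =>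
      integral_sub_right_eq_self (fun t => Real.exp (-ε * |t|)) _
    simp only [this]
    ring

theorem LocalKernel.expBounded (hk : LocalKernel s k) {φ : (Fin n → ℝ) → ℂ}
    (hφ : ExpBounded s φ) : ExpBounded s fun x => ∫ y, k x y * φ y := by
  obtain ⟨-, C, hC, h⟩ := hk.integrable_and_le hφ
  refine ⟨?_, C, hC, fun x => (norm_integral_le_integral_norm _).trans (h x)⟩
  have : Measurable (Function.uncurry fun x y => k x y * φ y) :=
    hk.1.mul (hφ.1.comp measurable_snd)
  exact this.stronglyMeasurable.integral_prod_right.measurable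

/-- Two localised kernels may be composed. -/
theorem LocalKernel.comp_apply {k' : (Fin l → ℝ) → (Fin m → ℝ) → ℂ} (hk' : LocalKernel s k')
    (hk : LocalKernel s k) {φ : (Fin n → ℝ) → ℂ} (hφ : ExpBounded s φ) (x : Fin l → ℝ) :
    ∫ y, k' x y * ∫ v, k y v * φ v = ∫ v, (∫ y, k' x y * k y v) * φ v := by
  obtain ⟨hint, C, hC, hle⟩ := hk.integrable_and_le hφ
  have hmeas : Measurable fun q : (Fin m → ℝ) × (Fin n → ℝ) =>
      k' x q.1 * (k q.1 q.2 * φ q.2) :=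
    (hk'.1.comp (measurable_const.prodMk measurable_fst)).mul
      (hk.1.mul (hφ.1.comp measurable_snd))
  have hmk : Measurable fun y => ∫ v, ‖k y v * φ v‖ := by
    have : Measurable (Function.uncurry fun y v => ‖k y v * φ v‖) :=
      (hk.1.mul (hφ.1.comp measurable_snd)).norm
    exact this.stronglyMeasurable.integral_prod_right.measurable
  -- The inner integral of absolute values is again O(e^{sΣy}), so the localisation of the outer
  -- kernel supplies the second half of Tonelli's criterion.
  have hψ : ExpBounded s fun y => ((∫ v, ‖k y v * φ v‖ : ℝ) : ℂ) :=
    ⟨by fun_prop, C, hC, fun y => by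
      rw [Complex.norm_real, Real.norm_of_nonneg (integral_nonneg fun _ => norm_nonneg _)]
      exact hle y⟩
  have hI : Integrable (Function.uncurry fun y v => k' x y * (k y v * φ v))
      (volume.prod volume) := by
    refine (integrable_prod_iff hmeas.aestronglyMeasurable).2
      ⟨ae_of_all _ fun y => (hint y).const_mul (k' x y), ?_⟩
    refine ((hk'.integrable_and_le hψ).1 x).norm.congr (ae_of_all _ fun y => ?_)
    simp only [norm_mul, integral_const_mul, Complex.norm_real]
    rw [Real.norm_of_nonneg (integral_nonneg fun _ => by positivity)]
  simp only [← integral_const_mul, ← integral_mul_const]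
  rw [integral_integral_swap hI]
  simp only [mul_assoc]

end LocalKernel

/-! ### Localisation of the raising and reduced Baxter kernels -/

theorem measurable_boundaryWeight (g β : ℝ) (lam : ℂ) : Measurable (boundaryWeight g β lam) := by
  unfold boundaryWeight heaviside
  refine Measurable.mul (by fun_prop) (Complex.measurable_ofReal.comp ?_)
  exact Measurable.ite (measurableSet_le measurable_const (by fun_prop)) measurable_const
    measurable_const

theorem measurable_raisingKernel (g β : ℝ) (n : ℕ) (lam : ℂ) :
    Measurable (Function.uncurry (raisingKernel g β n lam)) := by
  have : Measurable (Function.uncurry fun (q : (Fin (n + 1) → ℝ) × (Fin n → ℝ))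
      (z : Fin (n + 1) → ℝ) => raisingIntegrand g β n lam q.1 q.2 z) := by
    unfold raisingIntegrand
    exact ((measurable_boundaryWeight g β lam).comp (by fun_prop)).mul (by fun_prop)
  exact this.stronglyMeasurable.integral_prod_right.measurable.const_mul _

theorem measurable_reducedBaxterKernel (g β : ℝ) (n : ℕ) (lam : ℂ) :
    Measurable (Function.uncurry (reducedBaxterKernel g β n lam)) := by
  have : Measurable (Function.uncurry fun (q : (Fin (n + 1) → ℝ) × (Fin (n + 1) → ℝ))
      (z : Fin (n + 1) → ℝ) => reducedBaxterIntegrand g β n lam q.1 q.2 z) := by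
    unfold reducedBaxterIntegrand
    exact ((measurable_boundaryWeight g β (-lam)).comp (by fun_prop)).mul (by fun_prop)
  exact this.stronglyMeasurable.integral_prod_right.measurable.const_mul _

theorem norm_bessel_le (ν : ℂ) (A B : ℝ) : ‖bessel ν A B‖ ≤ absBessel ν.re A B := by
  refine (norm_integral_le_integral_norm _).trans (le_of_eq ?_)
  simp only [norm_besselIntegrand]; rfl

theorem norm_boundary_le (g β : ℝ) (lam : ℂ) (c : ℝ) :
    ‖boundary g β lam c‖ ≤ absBoundary g β lam.im (2 * lam.im) c := by
  refine (norm_integral_le_integral_norm _).trans (le_of_eq ?_)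
  simp only [norm_boundaryIntegrand]; rfl

theorem norm_row_le (g β : ℝ) (lam : ℂ) {n : ℕ} (C : Fin (n + 1) → ℝ) (D : Fin n → ℝ) :
    ‖row g β lam C D‖ ≤ absBoundary g β lam.im (2 * lam.im) (C 0) *
      ∏ j, absBessel (2 * lam.im) (C j.succ) (D j) := by
  rw [row, norm_mul, norm_prod]
  refine mul_le_mul (norm_boundary_le ..) (Finset.prod_le_prod (fun _ _ => norm_nonneg _)
    fun j _ => (norm_bessel_le ..).trans (le_of_eq ?_)) (Finset.prod_nonneg fun _ _ =>
      norm_nonneg _) (absBoundary_nonneg ..)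
  congr 1; simp

theorem exp_mul_absBessel_le {s : ℝ} (hs : 0 < s) :
    ∃ M, 0 ≤ M ∧ ∀ x y : ℝ, absBessel 0 (Real.exp (-x)) (Real.exp y) * Real.exp (s * y)
      ≤ M * Real.exp (s * x) * Real.exp (-(s / 2) * |y - x|) := by
  set M₁ := Real.exp (2 * s * Real.log (2 * s)) * Real.Gamma (2 * s)
  set M₂ := Real.exp (s / 2 * Real.log (s / 2)) * Real.Gamma (s / 2)
  have h1 : 0 < Real.Gamma (2 * s) := Real.Gamma_pos_of_pos (by positivity)
  have h2 : 0 < Real.Gamma (s / 2) := Real.Gamma_pos_of_pos (by positivity)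
  have hM₁ : 0 ≤ M₁ := by positivity
  have hM₂ : 0 ≤ M₂ := by positivity
  refine ⟨M₁ + M₂, by positivity, fun x y => ?_⟩
  have key : ∀ {τ : ℝ}, 0 < τ → absBessel 0 (Real.exp (-x)) (Real.exp y) * Real.exp (s * y)
      ≤ Real.exp (τ * Real.log τ) * Real.Gamma τ *
        Real.exp (s * y - τ * (y - x)) := fun {τ} hτ => by
    have := absBessel_zero_le hτ (Real.exp_pos (-x)) (Real.exp_pos y)
    refine (mul_le_mul_of_nonneg_right this (Real.exp_pos _).le).trans (le_of_eq ?_)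
    rw [mul_assoc _ (Real.exp _) (Real.exp (s * y)), ← Real.exp_add, Real.log_exp, Real.log_exp]
    congr 2; ring
  rw [mul_assoc, ← Real.exp_add]
  -- The power bound leaves the exponent sx + (s-τ)(y-x): τ = 2s gives decay for y ≥ x, τ = s/2 for
  -- y ≤ x.
  rcases le_total 0 (y - x) with h | h
  · refine (key (τ := 2 * s) (by positivity)).trans (mul_le_mul (by linarith)
      (Real.exp_le_exp.2 ?_) (Real.exp_pos _).le (by positivity))
    rw [abs_of_nonneg h]; nlinarith
  · refine (key (τ := s / 2) (by positivity)).trans (mul_le_mul (by linarith)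
      (Real.exp_le_exp.2 ?_) (Real.exp_pos _).le (by positivity))
    rw [abs_of_nonpos h]; nlinarith

/-- Dropping positive terms from the exponents leaves in each y_j a zero-index Macdonald function
centred at x_{j+1}. The remaining x_1 appears only in the boundary factor, bounded by e^{s x_1}. -/
theorem localKernel_raisingKernel {g β s : ℝ} (hg : 0 < g) (hβ : 0 < β) (hs : 0 < s) (n : ℕ)
    (r : ℝ) : LocalKernel s (raisingKernel g β n (r : ℂ)) := by
  obtain ⟨M₁, hM₁, h₁⟩ := absBoundary_le (g := g) (η := 0) (s := 0) hβ (by linarith) hs hs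
  obtain ⟨M₂, hM₂, h₂⟩ := exp_mul_absBessel_le hs
  set c := ‖(2 * (β : ℂ)) ^ (Complex.I * r) / Complex.Gamma ((g : ℂ) - Complex.I * r)‖
  refine ⟨measurable_raisingKernel g β n r, c * M₁ * M₂ ^ n, s / 2, by positivity,
    by positivity, fun x j => x j.succ, fun x y => ?_⟩
  have hrow : ‖row g β r (raisingUp x y) (raisingDown x y)‖ ≤ M₁ * Real.exp (s * x 0) *
      ∏ j : Fin n, absBessel 0 (Real.exp (-x j.succ)) (Real.exp (y j)) := by
    refine (norm_row_le ..).trans ?_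
    simp only [Complex.ofReal_im, mul_zero]
    have hle : ∀ k, Real.exp (-x k) ≤ raisingUp x y k := fun k =>
      le_add_of_nonneg_right (snocZero_nonneg (fun _ => (Real.exp_pos _).le) k)
    refine mul_le_mul ?_ (Finset.prod_le_prod (fun _ _ => absBessel_nonneg ..) fun j _ =>
      absBessel_anti (integrable_absBesselIntegrand 0 (Real.exp_pos _) (Real.exp_pos _))
        (hle j.succ) (le_add_of_nonneg_left (Real.exp_pos _).le))
      (Finset.prod_nonneg fun _ _ => absBessel_nonneg ..) (by positivity)
    refine (absBoundary_anti (integrable_absBoundaryIntegrand hβ (by linarith) 0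
      (Real.exp_pos (-x 0))) (hle 0)).trans ((h₁ _ (Real.exp_pos _)).trans (le_of_eq ?_))
    rw [Real.log_exp]; congr 2; ring
  have hexp : ‖Complex.exp (Complex.I * r * (∑ k, x k + ∑ j, y j : ℝ))‖ = 1 := by
    rw [Complex.norm_exp, Complex.re_mul_ofReal]; simp
  rw [raisingKernel_eq hβ, norm_mul, norm_mul, hexp, one_mul]
  calc c * ‖row g β r (raisingUp x y) (raisingDown x y)‖ * Real.exp (s * ∑ j, y j)
      ≤ c * (M₁ * Real.exp (s * x 0) *
          ∏ j : Fin n, absBessel 0 (Real.exp (-x j.succ)) (Real.exp (y j))) *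
          Real.exp (s * ∑ j, y j) := by gcongr
    _ = c * M₁ * Real.exp (s * x 0) * ∏ j : Fin n,
          (absBessel 0 (Real.exp (-x j.succ)) (Real.exp (y j)) * Real.exp (s * y j)) := by
        rw [Finset.prod_mul_distrib, ← Real.exp_sum, Finset.mul_sum]; ring
    _ ≤ c * M₁ * Real.exp (s * x 0) * ∏ j : Fin n,
          (M₂ * Real.exp (s * x j.succ) * Real.exp (-(s / 2) * |y j - x j.succ|)) := by
        refine mul_le_mul_of_nonneg_left (Finset.prod_le_prod (fun j _ =>
          mul_nonneg (absBessel_nonneg ..) (Real.exp_pos _).le) fun j _ => h₂ _ _) (by positivity)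
    _ = _ := by
        rw [Finset.prod_mul_distrib, Finset.prod_mul_distrib, ← Real.exp_sum, Fin.sum_univ_succ,
          mul_add, Real.exp_add, Finset.mul_sum]
        simp only [Finset.prod_const, Finset.card_univ, Fintype.card_fin]
        ring

/-- Since -log(e^{-x} + e^{-y}) ≤ min(x, y), the first two factors are at most e^{-σ|x-y|}; moving
e^{sy} to e^{sx} costs e^{s|x-y|}, which is affordable because s < σ. -/
theorem exp_pairUp_le {s σ x y : ℝ} (hs : 0 < s) (hsσ : s < σ) :
    Real.exp (-(2 * σ * Real.log (Real.exp (-x) + Real.exp (-y)))) * Real.exp (-σ * (x + y)) *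
      Real.exp (s * y) ≤ Real.exp (s * x) * Real.exp (-(σ - s) * |y - x|) := by
  rw [← Real.exp_add, ← Real.exp_add, ← Real.exp_add, Real.exp_le_exp]
  have hx : -x ≤ Real.log (Real.exp (-x) + Real.exp (-y)) := by
    rw [Real.le_log_iff_exp_le (by positivity)]; linarith [Real.exp_pos (-y)]
  have hy : -y ≤ Real.log (Real.exp (-x) + Real.exp (-y)) := by
    rw [Real.le_log_iff_exp_le (by positivity)]; linarith [Real.exp_pos (-x)]
  rcases le_total 0 (y - x) with h | h
  · rw [abs_of_nonneg h]; nlinarith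
  · rw [abs_of_nonpos h]; nlinarith

theorem localKernel_reducedBaxterKernel {g β s : ℝ} (hg : 0 < g) (hβ : 0 < β) (hs : 0 < s)
    (n : ℕ) {lam : ℂ} (hlam : s < -lam.im) : LocalKernel s (reducedBaxterKernel g β n lam) := by
  set σ := -lam.im with hσ
  -- The sharp exponent 2σ is needed so that the boundary factor pairs with e^{-σ(x+y)} just as the
  -- Macdonald factors do.
  obtain ⟨M₁, hM₁, h₁⟩ := absBoundary_le_self (g := g) (η := σ) (s := 2 * σ) hβ (by linarith)
    (by linarith)
  have hΓ : 0 < Real.Gamma (2 * σ) := Real.Gamma_pos_of_pos (by linarith)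
  set c := ‖(2 * (β : ℂ)) ^ (-(Complex.I * lam)) / Complex.Gamma ((g : ℂ) + Complex.I * lam)‖
  refine ⟨measurable_reducedBaxterKernel g β n lam, c * M₁ * Real.Gamma (2 * σ) ^ n, σ - s,
    by positivity, by linarith, fun x => x, fun x y => ?_⟩
  have hrow : ‖row g β (-lam) (pairUp x y) (fun j => pairDown x y j.castSucc)‖ ≤
      M₁ * Real.Gamma (2 * σ) ^ n * ∏ k, Real.exp (-(2 * σ * Real.log (pairUp x y k))) := by
    refine (norm_row_le ..).trans ?_
    rw [Complex.neg_im, ← hσ]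
    calc _ ≤ M₁ * Real.exp (-(2 * σ * Real.log (pairUp x y 0))) *
          ∏ j : Fin n, (Real.Gamma (2 * σ) *
            Real.exp (-(2 * σ * Real.log (pairUp x y j.succ)))) :=
          mul_le_mul (h₁ _ (pairUp_pos x y 0)) (Finset.prod_le_prod
            (fun _ _ => absBessel_nonneg ..) fun j _ => absBessel_le_left (by linarith)
              (pairUp_pos x y _) (pairDown_pos x y _).le)
            (Finset.prod_nonneg fun _ _ => absBessel_nonneg ..) (by positivity)
      _ = _ := by
          rw [Finset.prod_mul_distrib, Fin.prod_univ_succ]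
          simp only [Finset.prod_const, Finset.card_univ, Fintype.card_fin]
          ring
  have hexp : ‖Complex.exp (-(Complex.I * lam) * (∑ k, x k + ∑ j, y j : ℝ))‖
      = ∏ k, Real.exp (-σ * (x k + y k)) := by
    rw [Complex.norm_exp, Complex.re_mul_ofReal, ← Real.exp_sum, ← Finset.mul_sum,
      Finset.sum_add_distrib]
    simp [hσ]
  have hexp' : Real.exp (s * ∑ j, y j) = ∏ j, Real.exp (s * y j) := by
    rw [← Real.exp_sum, Finset.mul_sum]
  rw [reducedBaxterKernel_eq hβ, norm_mul, norm_mul, hexp, hexp', Finset.mul_sum, Real.exp_sum]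
  calc _ ≤ c * ((∏ k, Real.exp (-σ * (x k + y k))) * (M₁ * Real.Gamma (2 * σ) ^ n *
          ∏ k, Real.exp (-(2 * σ * Real.log (pairUp x y k))))) *
          ∏ j, Real.exp (s * y j) := by gcongr
    _ = c * M₁ * Real.Gamma (2 * σ) ^ n * ∏ k, (Real.exp (-(2 * σ * Real.log (pairUp x y k))) *
          Real.exp (-σ * (x k + y k)) * Real.exp (s * y k)) := by
        rw [Finset.prod_mul_distrib, Finset.prod_mul_distrib]; ring
    _ ≤ c * M₁ * Real.Gamma (2 * σ) ^ n * ∏ k, (Real.exp (s * x k) *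
          Real.exp (-(σ - s) * |y k - x k|)) := by
        refine mul_le_mul_of_nonneg_left (Finset.prod_le_prod (fun j _ => by positivity)
          fun j _ => exp_pairUp_le hs hlam) (by positivity)
    _ = _ := by rw [Finset.prod_mul_distrib]; ring

/-! ### Closing, reflecting and reopening the intermediate integrals -/

section Fubini

variable {Z : Type*} [MeasureSpace Z] [SigmaFinite (volume : Measure Z)] {N N' : ℕ}

/-- Fubini's theorem for a family of products of Macdonald functions. -/
theorem integral_prod_bessel {P : Z → ℂ} {ν : ℂ} {A B : Fin N → Z → ℝ} (hP : Measurable P)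
    (hA : ∀ j, Measurable (A j)) (hB : ∀ j, Measurable (B j))
    (hk : ∀ z j, Integrable (absBesselIntegrand ν.re (A j z) (B j z)))
    (hI : Integrable fun z => ‖P z‖ * ∏ j, absBessel ν.re (A j z) (B j z)) :
    ∫ y : Fin N → ℝ, ∫ z, P z * ∏ j, besselIntegrand ν (A j z) (B j z) (y j)
      = ∫ z, P z * ∏ j, bessel ν (A j z) (B j z) := by
  have hmeas : Measurable fun q : (Fin N → ℝ) × Z =>
      P q.2 * ∏ j, besselIntegrand ν (A j q.2) (B j q.2) (q.1 j) :=
    (hP.comp measurable_snd).mul (Finset.measurable_prod _ fun j _ =>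
      measurable_besselIntegrand ν ((hA j).comp measurable_snd) ((hB j).comp measurable_snd)
        (by fun_prop))
  have hint : Integrable (Function.uncurry fun (y : Fin N → ℝ) z =>
      P z * ∏ j, besselIntegrand ν (A j z) (B j z) (y j)) (volume.prod volume) := by
    refine (integrable_prod_iff' hmeas.aestronglyMeasurable).2 ⟨ae_of_all _ fun z => ?_, ?_⟩
    · refine Integrable.const_mul ?_ (P z)
      exact Integrable.fintype_prod (μ := fun _ : Fin N => (volume : Measure ℝ))
        fun j => (integrable_besselIntegrand_iff ..).2 (hk z j)
    · refine hI.congr (ae_of_all _ fun z => ?_)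
      simp only [norm_mul, norm_prod, norm_besselIntegrand, integral_const_mul]
      congr 1
      exact (integral_fintype_prod_volume_eq_prod (E := fun _ => ℝ)
        (fun j t => absBesselIntegrand ν.re (A j z) (B j z) t)).symm
  rw [integral_integral_swap hint]
  congr 1; ext z
  rw [integral_const_mul]
  congr 1
  exact integral_fintype_prod_volume_eq_prod (E := fun _ => ℝ)
    (fun j t => besselIntegrand ν (A j z) (B j z) t)

/-- Reflection of all indices in a family of products of Macdonald functions. -/
theorem integral_prod_bessel_reflect {P P' : Z → ℂ} {ν c : ℂ} {c' : ℝ} {A B : Fin N → Z → ℝ}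
    {A' B' : Fin N' → Z → ℝ} (hP : Measurable P) (hP' : Measurable P')
    (hA : ∀ j, Measurable (A j)) (hB : ∀ j, Measurable (B j))
    (hA' : ∀ j, Measurable (A' j)) (hB' : ∀ j, Measurable (B' j))
    (hk : ∀ z j, Integrable (absBesselIntegrand ν.re (A j z) (B j z)))
    (hk' : ∀ z j, Integrable (absBesselIntegrand (-ν).re (A' j z) (B' j z)))
    (hI : Integrable fun z => ‖P z‖ * ∏ j, absBessel ν.re (A j z) (B j z))
    (h : ∀ z, P z * ∏ j, bessel ν (A j z) (B j z)
      = c * (P' z * ∏ j, bessel (-ν) (A' j z) (B' j z)))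
    (hc' : c' ≠ 0)
    (h' : ∀ z, ‖P z‖ * ∏ j, absBessel ν.re (A j z) (B j z)
      = c' * (‖P' z‖ * ∏ j, absBessel (-ν).re (A' j z) (B' j z))) :
    ∫ y : Fin N → ℝ, ∫ z, P z * ∏ j, besselIntegrand ν (A j z) (B j z) (y j)
      = c * ∫ y : Fin N' → ℝ, ∫ z, P' z * ∏ j, besselIntegrand (-ν) (A' j z) (B' j z) (y j) := by
  rw [integral_prod_bessel hP hA hB hk hI]
  simp only [h]
  rw [integral_const_mul, ← integral_prod_bessel hP' hA' hB' hk']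
  -- No new estimate is needed for the reflected family: its absolute integrand is a nonzero
  -- multiple of the original one.
  simp only [h'] at hI
  have := hI.const_mul c'⁻¹
  simpa only [inv_mul_cancel_left₀ hc'] using this

end Fubini

/-! ### Integrals over two rows -/

/-- The space of two rows of auxiliary variables, with the two boundary variables in front. -/
abbrev TwoRows (n p : ℕ) : Type := (ℝ × ℝ) × ((Fin n → ℝ) × (Fin p → ℝ))

/-- The first row. -/
def TwoRows.fst {n p : ℕ} (q : TwoRows n p) : Fin (n + 1) → ℝ :=
  Fin.cons (α := fun _ => ℝ) q.1.1 q.2.1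

/-- The second row. -/
def TwoRows.snd {n p : ℕ} (q : TwoRows n p) : Fin (p + 1) → ℝ :=
  Fin.cons (α := fun _ => ℝ) q.1.2 q.2.2

section TwoRows

variable {n p : ℕ}

@[simp] theorem TwoRows.fst_zero (q : TwoRows n p) : TwoRows.fst q 0 = q.1.1 := rfl
@[simp] theorem TwoRows.snd_zero (q : TwoRows n p) : TwoRows.snd q 0 = q.1.2 := rfl
@[simp] theorem TwoRows.fst_succ (q : TwoRows n p) (j : Fin n) :
    TwoRows.fst q j.succ = q.2.1 j := rfl
@[simp] theorem TwoRows.snd_succ (q : TwoRows n p) (j : Fin p) :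
    TwoRows.snd q j.succ = q.2.2 j := rfl

theorem TwoRows.measurable_fst (k : Fin (n + 1)) :
    Measurable fun q : TwoRows n p => TwoRows.fst q k := by
  induction k using Fin.cases with
  | zero => simp only [TwoRows.fst_zero]; fun_prop
  | succ j => simp only [TwoRows.fst_succ]; fun_prop

theorem TwoRows.measurable_snd (k : Fin (p + 1)) :
    Measurable fun q : TwoRows n p => TwoRows.snd q k := by
  induction k using Fin.cases with
  | zero => simp only [TwoRows.snd_zero]; fun_prop
  | succ j => simp only [TwoRows.snd_succ]; fun_prop

theorem TwoRows.integral_prod (f₀ : ℝ × ℝ → ℂ) (f : Fin n → ℝ → ℂ) (h : Fin p → ℝ → ℂ) :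
    ∫ q : TwoRows n p, f₀ q.1 * ((∏ j, f j (q.2.1 j)) * ∏ j, h j (q.2.2 j))
      = (∫ w, f₀ w) * ((∏ j, ∫ t, f j t) * ∏ j, ∫ t, h j t) := by
  rw [← integral_fintype_prod_volume_eq_prod, ← integral_fintype_prod_volume_eq_prod,
    ← integral_prod_mul, ← integral_prod_mul]
  rfl

theorem TwoRows.integrable_prod {f₀ : ℝ × ℝ → ℝ} {f : Fin n → ℝ → ℝ} {h : Fin p → ℝ → ℝ}
    (i₀ : Integrable f₀) (i₁ : ∀ j, Integrable (f j)) (i₂ : ∀ j, Integrable (h j)) :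
    Integrable fun q : TwoRows n p =>
      f₀ q.1 * ((∏ j, f j (q.2.1 j)) * ∏ j, h j (q.2.2 j)) :=
  i₀.mul_prod ((Integrable.fintype_prod (μ := fun _ : Fin n => (volume : Measure ℝ)) i₁).mul_prod
    (Integrable.fintype_prod (μ := fun _ : Fin p => (volume : Measure ℝ)) i₂))

theorem measurable_rowIntegrand (g β : ℝ) (lam : ℂ) (C : Fin (n + 1) → ℝ) (D : Fin n → ℝ) :
    Measurable (rowIntegrand g β lam C D) := by
  unfold rowIntegrand
  exact (measurable_boundaryIntegrand g β lam measurable_const (by fun_prop)).mul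
    (Finset.measurable_prod _ fun j _ => measurable_besselIntegrand _ measurable_const
      measurable_const (by fun_prop))

theorem TwoRows.measurable_rows (g β : ℝ) (mu rho : ℂ) (C : Fin (n + 1) → ℝ) (D : Fin n → ℝ)
    (C' : Fin (p + 1) → ℝ) (D' : Fin p → ℝ) : Measurable fun q : TwoRows n p =>
      rowIntegrand g β mu C D (TwoRows.fst q) * rowIntegrand g β rho C' D' (TwoRows.snd q) :=
  ((measurable_rowIntegrand g β mu C D).comp (measurable_pi_iff.2 TwoRows.measurable_fst)).mul
    ((measurable_rowIntegrand g β rho C' D').comp (measurable_pi_iff.2 TwoRows.measurable_snd))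

theorem TwoRows.integral_rows (g β : ℝ) (mu rho : ℂ) (C : Fin (n + 1) → ℝ) (D : Fin n → ℝ)
    (C' : Fin (p + 1) → ℝ) (D' : Fin p → ℝ) :
    ∫ q : TwoRows n p,
      rowIntegrand g β mu C D (TwoRows.fst q) * rowIntegrand g β rho C' D' (TwoRows.snd q)
      = row g β mu C D * row g β rho C' D' := by
  simp only [rowIntegrand, TwoRows.fst_zero, TwoRows.snd_zero, TwoRows.fst_succ,
    TwoRows.snd_succ, mul_mul_mul_comm (boundaryIntegrand g β mu (C 0) _)]
  rw [TwoRows.integral_prod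
    (fun w => boundaryIntegrand g β mu (C 0) w.1 * boundaryIntegrand g β rho (C' 0) w.2)
    (fun j => besselIntegrand (-(2 * Complex.I * mu)) (C j.succ) (D j))
    (fun j => besselIntegrand (-(2 * Complex.I * rho)) (C' j.succ) (D' j)),
    Measure.volume_eq_prod, integral_prod_mul, row, row, mul_mul_mul_comm]
  rfl

end TwoRows

/-- The product of reflection factors telescopes. -/
theorem prod_bessel_reflect {n : ℕ} (ν : ℂ) {A e : Fin n → ℝ} {B : Fin (n + 1) → ℝ}
    (hA : ∀ j, 0 < A j) (hB : ∀ k, 0 < B k)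
    (h : ∀ j, Real.log (A j) = Real.log (B j.succ) - e j) :
    ∏ j, bessel ν (A j) (B j.castSucc)
      = Complex.exp (ν * (Real.log (B 0) - Real.log (B (Fin.last n)) + ∑ j, e j : ℝ)) *
        ∏ j, bessel (-ν) (A j) (B j.castSucc) := by
  simp only [fun j => bessel_reflect ν (hA j) (hB j.castSucc), Finset.prod_mul_distrib]
  rw [← Complex.exp_sum, ← Finset.mul_sum, ← Complex.ofReal_sum]
  congr 4
  have e1 := Fin.sum_univ_castSucc fun k => Real.log (B k)
  have e2 := Fin.sum_univ_succ fun k => Real.log (B k)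
  simp only [h, Finset.sum_sub_distrib]
  linarith

theorem log_exp_neg_add_exp_neg (z u : ℝ) :
    Real.log (Real.exp (-z) + Real.exp (-u))
      = Real.log (Real.exp z + Real.exp u) - (z + u) := by
  rw [eq_sub_iff_add_eq, ← Real.log_exp (z + u), ← Real.log_mul (by positivity) (by positivity)]
  congr 1
  rw [add_mul, ← Real.exp_add, ← Real.exp_add, add_comm]
  congr 2 <;> ring

theorem exp_mul_mul_exp (w w' a b c : ℂ) :
    Complex.exp c * (w * Complex.exp a * (w' * Complex.exp b))
      = w * w' * Complex.exp (a + b + c) := by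
  simp only [Complex.exp_add]; ring

theorem exp_mul_exp_mul (w w' a b c d : ℂ) :
    Complex.exp c * (w * w' * Complex.exp a * (Complex.exp b * Complex.exp d))
      = w * w' * Complex.exp (a + b + c + d) := by
  simp only [Complex.exp_add]; ring

theorem measurable_absBessel {Z : Type*} [MeasurableSpace Z] (s : ℝ) {A B : Z → ℝ}
    (hA : Measurable A) (hB : Measurable B) : Measurable fun z => absBessel s (A z) (B z) := by
  have : Measurable (Function.uncurry fun z t => absBesselIntegrand s (A z) (B z) t) :=
    measurable_absBesselIntegrand s (hA.comp measurable_fst) (hB.comp measurable_fst)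
      measurable_snd
  exact this.stronglyMeasurable.integral_prod_right.measurable

theorem measurable_snocZero {Z : Type*} [MeasurableSpace Z] {n : ℕ} {f : Z → Fin n → ℝ}
    (hf : ∀ j, Measurable fun z => f z j) (k : Fin (n + 1)) :
    Measurable fun z => snocZero (f z) k := by
  induction k using Fin.lastCases with
  | last => simp
  | cast j => simpa using hf j

theorem norm_rowIntegrand (g β : ℝ) (lam : ℂ) {n : ℕ} (C : Fin (n + 1) → ℝ) (D : Fin n → ℝ)
    (z : Fin (n + 1) → ℝ) :
    ‖rowIntegrand g β lam C D z‖
      = absBoundaryIntegrand g β lam.im (2 * lam.im) (C 0) (z 0) *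
        ∏ j, absBesselIntegrand (2 * lam.im) (C j.succ) (D j) (z j.succ) := by
  rw [rowIntegrand, norm_mul, norm_prod, norm_boundaryIntegrand]
  simp [norm_besselIntegrand]

/-! ### The reduced Baxter kernel times a raising kernel -/

section Lower

variable {n : ℕ}

/-- The coupling of the intermediate variables to two rows of equal length from above. -/
def equalUp (z u : Fin (n + 1) → ℝ) (j : Fin n) : ℝ :=
  Real.exp (-z j.succ) + Real.exp (-u j.succ)

theorem equalUp_pos (z u : Fin (n + 1) → ℝ) (j : Fin n) : 0 < equalUp z u j :=
  add_pos (Real.exp_pos _) (Real.exp_pos _)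

theorem log_equalUp (z u : Fin (n + 1) → ℝ) (j : Fin n) :
    Real.log (equalUp z u j) = Real.log (pairDown z u j.succ) - (z j.succ + u j.succ) :=
  log_exp_neg_add_exp_neg _ _

theorem measurable_equalUp (j : Fin n) :
    Measurable fun q : TwoRows n n => equalUp (TwoRows.fst q) (TwoRows.snd q) j := by
  simp only [equalUp, TwoRows.fst_succ, TwoRows.snd_succ]; fun_prop

theorem measurable_pairDown (k : Fin (n + 1)) :
    Measurable fun q : TwoRows n n => pairDown (TwoRows.fst q) (TwoRows.snd q) k := by
  have h1 := TwoRows.measurable_fst (n := n) (p := n) k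
  have h2 := TwoRows.measurable_snd (n := n) (p := n) k
  unfold pairDown; fun_prop

/-- The last intermediate variable has no term e^{y}, so it integrates to a Gamma function and
disappears; this lowers the number of intermediate variables by one. The power it leaves is what the
telescoping of the other reflections requires. -/
theorem prod_bessel_equal {ν : ℂ} (hν : ν.re < 0) (z u : Fin (n + 1) → ℝ) :
    ∏ k, bessel ν (snocZero (equalUp z u) k) (pairDown z u k)
      = Complex.Gamma (-ν) * (Complex.exp (ν * (Real.log (pairDown z u 0)
          + ∑ j : Fin n, (z j.succ + u j.succ) : ℝ)) *
        ∏ j, bessel (-ν) (equalUp z u j) (pairDown z u j.castSucc)) := by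
  rw [Fin.prod_univ_castSucc, snocZero_last, bessel_zero_left hν (pairDown_pos z u _)]
  simp only [snocZero_castSucc]
  rw [prod_bessel_reflect ν (equalUp_pos z u) (pairDown_pos z u) (log_equalUp z u)]
  have : Complex.exp (ν * (Real.log (pairDown z u 0)
        - Real.log (pairDown z u (Fin.last n)) + ∑ j : Fin n, (z j.succ + u j.succ) : ℝ)) *
      Complex.exp (ν * (Real.log (pairDown z u (Fin.last n)) : ℝ))
      = Complex.exp (ν * (Real.log (pairDown z u 0)
          + ∑ j : Fin n, (z j.succ + u j.succ) : ℝ)) := by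
    rw [← Complex.exp_add]; congr 1; push_cast; ring
  rw [← this]; ring

/-- The complex identity at a real index; it provides the proportionality of absolute integrands. -/
theorem prod_absBessel_equal {s : ℝ} (hs : s < 0) (z u : Fin (n + 1) → ℝ) :
    ∏ k, absBessel s (snocZero (equalUp z u) k) (pairDown z u k)
      = Real.Gamma (-s) * (Real.exp (s * (Real.log (pairDown z u 0)
          + ∑ j : Fin n, (z j.succ + u j.succ))) *
        ∏ j, absBessel (-s) (equalUp z u j) (pairDown z u j.castSucc)) := by
  have := prod_bessel_equal (ν := s) (by simpa using hs) z u
  simp only [← Complex.ofReal_neg, ← ofReal_absBessel, Complex.Gamma_ofReal] at this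
  exact_mod_cast this

theorem rows_mul_equal (g β : ℝ) (mu rho : ℂ) (x y z u : Fin (n + 1) → ℝ) (v : Fin n → ℝ) :
    Complex.exp ((Complex.I * mu + Complex.I * rho) * (∑ k, y k : ℝ)) *
      (rowIntegrand g β mu (pairUp x y) (fun j => pairDown x y j.castSucc) z *
        rowIntegrand g β rho (raisingUp y v) (raisingDown y v) u)
      = rowIntegrand g β mu (fun k => Real.exp (-x k)) (fun j => Real.exp (x j.castSucc)) z *
        rowIntegrand g β rho (snocZero fun j => Real.exp (-v j)) (fun j => Real.exp (v j)) u *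
        ∏ k, besselIntegrand (Complex.I * mu + Complex.I * rho) (snocZero (equalUp z u) k)
          (pairDown z u k) (y k) := by
  simp only [rowIntegrand_eq, besselIntegrand]
  rw [← Complex.exp_sum, mul_comm _ (Complex.exp (∑ _, _)), exp_mul_mul_exp, exp_mul_mul_exp]
  congr 2
  have e1 := Fin.sum_univ_castSucc fun k => (Real.exp (-x k) + Real.exp (-y k)) * Real.exp (z k)
  have e2 := Fin.sum_univ_castSucc fun k => raisingUp y v k * Real.exp (u k)
  have e3 := Fin.sum_univ_castSucc fun k => Real.exp (-x k) * Real.exp (z k)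
  have e4 := Fin.sum_univ_castSucc fun k => snocZero (fun j => Real.exp (-v j)) k * Real.exp (u k)
  have e5 := Fin.sum_univ_castSucc fun k => snocZero (equalUp z u) k * Real.exp (y k)
    + pairDown z u k * Real.exp (-y k)
  simp only [Finset.sum_sub_distrib, ← Finset.mul_sum, ← Complex.ofReal_sum]
  simp only [pairUp, e1, e2, e3, e4, e5]
  simp only [raisingUp, raisingDown, pairDown, equalUp, snocZero_castSucc, snocZero_last,
    add_mul, Finset.sum_add_distrib, zero_mul, mul_comm (Real.exp (y _)),
    mul_comm (Real.exp (-y _)), Complex.ofReal_add, Complex.ofReal_zero]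
  ring

/-- The reflection factor adds iμ + iρ to the characters -2iμ and -2iρ of the non-boundary
variables, making the indices of the two rows opposite, ±(iρ - iμ). At the boundary it adds only the
coupling (e^{z} + e^{u})^{iμ+iρ}. -/
theorem rows_mul_equal_reflected (g β : ℝ) (mu rho : ℂ) (x z u : Fin (n + 1) → ℝ)
    (y v : Fin n → ℝ) :
    rowIntegrand g β mu (fun k => Real.exp (-x k)) (fun j => Real.exp (x j.castSucc)) z *
        rowIntegrand g β rho (snocZero fun j => Real.exp (-v j)) (fun j => Real.exp (v j)) u *
        Complex.exp ((Complex.I * mu + Complex.I * rho) * (Real.log (pairDown z u 0)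
          + ∑ j : Fin n, (z j.succ + u j.succ) : ℝ)) *
        ∏ j, besselIntegrand (-(Complex.I * mu + Complex.I * rho)) (equalUp z u j)
          (pairDown z u j.castSucc) (y j)
      = Complex.exp (-(Complex.I * mu + Complex.I * rho) * (∑ k, y k : ℝ)) *
        (coupledIntegrand g β mu rho (raisingUp x y 0) (snocZero (pairUp y v) 0) (z 0, u 0) *
          ((∏ j, besselIntegrand (Complex.I * rho - Complex.I * mu) (raisingUp x y j.succ)
              (raisingDown x y j) (z j.succ)) *
            ∏ j, besselIntegrand (-(Complex.I * rho - Complex.I * mu))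
              (snocZero (pairUp y v) j.succ) (pairDown y v j) (u j.succ))) := by
  simp only [rowIntegrand_eq, besselIntegrand, coupledIntegrand]
  simp only [← Complex.exp_sum]
  rw [mul_assoc, ← Complex.exp_add, mul_comm _ (Complex.exp (_ + ∑ _, _)), exp_mul_mul_exp,
    exp_mul_exp_mul]
  congr 2
  have e1 := Fin.sum_univ_castSucc fun k => raisingUp x y k * Real.exp (z k)
  rw [Fin.sum_univ_succ] at e1
  have e2 := Fin.sum_univ_castSucc fun k => snocZero (pairUp y v) k * Real.exp (u k)
  rw [Fin.sum_univ_succ] at e2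
  have e3 := Fin.sum_univ_castSucc fun k => Real.exp (-x k) * Real.exp (z k)
  have e4 := Fin.sum_univ_castSucc fun k => snocZero (fun j => Real.exp (-v j)) k * Real.exp (u k)
  simp only [Finset.sum_sub_distrib, ← Finset.mul_sum, ← Complex.ofReal_sum]
  simp only [e3, e4, Finset.sum_add_distrib, Fin.sum_univ_succ z, Fin.sum_univ_succ u]
  have e1 := congrArg (fun r : ℝ => (r : ℂ)) e1
  have e2 := congrArg (fun r : ℝ => (r : ℂ)) e2
  simp only [pairDown, equalUp, raisingDown, add_mul, Finset.sum_add_distrib,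
    mul_comm (Real.exp (y _))] at e1 e2 ⊢
  simp only [raisingUp, pairUp, snocZero_castSucc, snocZero_last, add_mul,
    Finset.sum_add_distrib, zero_mul, Complex.ofReal_add, mul_comm (Real.exp (-y _)),
    Complex.ofReal_zero] at e1 e2 ⊢
  linear_combination e1 + e2

/-- With ρ real, the last variable of the second row has neither a term e^{u} nor a decaying
character. The missing decay e^{-(Im μ)u} is taken from the Macdonald functions of the intermediate
variables, whose second argument is at least e^{u_k}. -/
theorem integrable_rows_equal {g β : ℝ} (hg : 0 < g) (hβ : 0 < β) {mu rho : ℂ}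
    (hmu : 0 < mu.im) (hrho : rho.im = 0) (x : Fin (n + 1) → ℝ) (v : Fin n → ℝ) :
    Integrable fun q : TwoRows n n =>
      ‖rowIntegrand g β mu (fun k => Real.exp (-x k)) (fun j => Real.exp (x j.castSucc))
          (TwoRows.fst q) *
        rowIntegrand g β rho (snocZero fun j => Real.exp (-v j)) (fun j => Real.exp (v j))
          (TwoRows.snd q)‖ *
        ∏ k, absBessel (-mu.im) (snocZero (equalUp (TwoRows.fst q) (TwoRows.snd q)) k)
          (pairDown (TwoRows.fst q) (TwoRows.snd q) k) := by
  have hv := snocZero_nonneg fun j => (Real.exp_pos (-v j)).le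
  have i₀ : Integrable fun w : ℝ × ℝ =>
      absBoundaryIntegrand g β mu.im (2 * mu.im) (Real.exp (-x 0)) w.1 *
        absBoundaryIntegrand g β 0 (-mu.im) (snocZero (fun j => Real.exp (-v j)) 0) w.2 := by
    refine (integrable_absBoundaryIntegrand hβ (by linarith) _ (Real.exp_pos _)).mul_prod ?_
    rcases (hv 0).eq_or_lt with h | h
    · rw [← h]; exact integrable_absBoundaryIntegrand_zero hβ (by linarith) (by linarith)
    · exact integrable_absBoundaryIntegrand hβ (by linarith) _ h
  have hI := (TwoRows.integrable_prod i₀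
    (fun j : Fin n => integrable_absBesselIntegrand (2 * mu.im) (Real.exp_pos (-x j.succ))
      (Real.exp_pos (x j.castSucc)))
    (fun j : Fin n => integrable_absBesselIntegrand_right (neg_neg_of_pos hmu) (hv j.succ)
      (Real.exp_pos (v j)))).const_mul (Real.Gamma mu.im ^ (n + 1))
  have hmeasP := TwoRows.measurable_rows g β mu rho (fun k => Real.exp (-x k))
    (fun j => Real.exp (x j.castSucc)) (snocZero fun j => Real.exp (-v j))
    (fun j => Real.exp (v j))
  refine hI.mono' (hmeasP.norm.mul (Finset.measurable_prod _ fun k _ => ?_)).aestronglyMeasurable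
    (ae_of_all _ fun q => ?_)
  · exact measurable_absBessel _ (measurable_snocZero (fun j => (measurable_equalUp j)) k)
      (measurable_pairDown k)
  · rw [Real.norm_of_nonneg (mul_nonneg (norm_nonneg _)
      (Finset.prod_nonneg fun _ _ => absBessel_nonneg ..))]
    have hB : ∀ k, absBessel (-mu.im) (snocZero (equalUp (TwoRows.fst q) (TwoRows.snd q)) k)
        (pairDown (TwoRows.fst q) (TwoRows.snd q) k)
        ≤ Real.Gamma mu.im * Real.exp (-(mu.im * TwoRows.snd q k)) := fun k => by
      refine (absBessel_le_right hmu (snocZero_nonneg (fun j => (equalUp_pos _ _ j).le) k)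
        (pairDown_pos _ _ k)).trans (mul_le_mul_of_nonneg_left (Real.exp_le_exp.2 ?_)
          (Real.Gamma_pos_of_pos hmu).le)
      have : TwoRows.snd q k ≤ Real.log (pairDown (TwoRows.fst q) (TwoRows.snd q) k) := by
        rw [Real.le_log_iff_exp_le (pairDown_pos _ _ k)]
        exact le_add_of_nonneg_left (Real.exp_pos _).le
      nlinarith
    refine (mul_le_mul_of_nonneg_left (Finset.prod_le_prod (fun _ _ => absBessel_nonneg ..)
      fun k _ => hB k) (norm_nonneg _)).trans (le_of_eq ?_)
    rw [norm_mul, norm_rowIntegrand, norm_rowIntegrand, Finset.prod_mul_distrib,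
      Fin.prod_univ_succ (fun k => Real.exp (-(mu.im * TwoRows.snd q k)))]
    simp only [TwoRows.fst_zero, TwoRows.fst_succ, TwoRows.snd_zero, TwoRows.snd_succ,
      Finset.prod_const, Finset.card_univ, Fintype.card_fin, hrho, mul_zero]
    have h1 : ∀ t c, absBoundaryIntegrand g β 0 (-mu.im) c t
        = absBoundaryIntegrand g β 0 0 c t * Real.exp (-(mu.im * t)) := fun t c => by
      rw [absBoundaryIntegrand, absBoundaryIntegrand, mul_assoc, ← Real.exp_add]
      congr 2; ring
    have h2 : ∀ t A B, absBesselIntegrand (-mu.im) A B t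
        = absBesselIntegrand 0 A B t * Real.exp (-(mu.im * t)) := fun t A B => by
      rw [absBesselIntegrand, absBesselIntegrand, ← Real.exp_add]
      congr 1; ring
    simp only [h1, h2, Finset.prod_mul_distrib]
    ring

/-- The reduced Baxter kernel times a raising kernel, with the intermediate variables reflected. -/
theorem integral_rows_equal {g β : ℝ} (hg : 0 < g) (hβ : 0 < β) {mu rho : ℂ}
    (hmu : 0 < mu.im) (hrho : rho.im = 0) (x : Fin (n + 1) → ℝ) (v : Fin n → ℝ) :
    ∫ y : Fin (n + 1) → ℝ, Complex.exp ((Complex.I * mu + Complex.I * rho) * (∑ k, y k : ℝ)) *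
      (row g β mu (pairUp x y) (fun j => pairDown x y j.castSucc) *
        row g β rho (raisingUp y v) (raisingDown y v))
      = Complex.Gamma (-(Complex.I * mu + Complex.I * rho)) *
        ∫ y : Fin n → ℝ, Complex.exp (-(Complex.I * mu + Complex.I * rho) * (∑ k, y k : ℝ)) *
          (coupledBoundary g β mu rho (raisingUp x y 0) (snocZero (pairUp y v) 0) *
            ((∏ j, bessel (Complex.I * rho - Complex.I * mu) (raisingUp x y j.succ)
              (raisingDown x y j)) *
            ∏ j, bessel (-(Complex.I * rho - Complex.I * mu))
              (snocZero (pairUp y v) j.succ) (pairDown y v j))) := by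
  set ν := Complex.I * mu + Complex.I * rho with hν
  have hre : ν.re = -mu.im := by simp [hν, hrho]
  have hreneg : ν.re < 0 := by rw [hre]; linarith
  have hmeasP := TwoRows.measurable_rows g β mu rho (fun k => Real.exp (-x k))
    (fun j => Real.exp (x j.castSucc)) (snocZero fun j => Real.exp (-v j))
    (fun j => Real.exp (v j))
  have hI := integrable_rows_equal hg hβ hmu hrho x v
  rw [← hre] at hI
  have hmeasL : Measurable fun q : TwoRows n n =>
      Complex.exp (ν * (Real.log (pairDown (TwoRows.fst q) (TwoRows.snd q) 0)
        + ∑ j : Fin n, (TwoRows.fst q j.succ + TwoRows.snd q j.succ) : ℝ)) := by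
    have h0 := measurable_pairDown (n := n) 0
    simp only [TwoRows.fst_succ, TwoRows.snd_succ]
    fun_prop
  have key := integral_prod_bessel_reflect hmeasP (hmeasP.mul hmeasL)
    (fun k => measurable_snocZero (fun j => (measurable_equalUp j)) k)
    (fun k => measurable_pairDown k) (fun j => measurable_equalUp j)
    (fun j => measurable_pairDown j.castSucc)
    (fun q k => integrable_absBesselIntegrand_right hreneg
      (snocZero_nonneg (fun j => (equalUp_pos _ _ j).le) k) (pairDown_pos _ _ k))
    (fun q j => integrable_absBesselIntegrand _ (equalUp_pos _ _ j) (pairDown_pos _ _ _)) hI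
    (c := Complex.Gamma (-ν)) (c' := Real.Gamma (-ν.re))
    (fun q => by rw [prod_bessel_equal hreneg, Pi.mul_apply]; ring)
    (Real.Gamma_pos_of_pos (neg_pos.2 hreneg)).ne'
    (fun q => by
      rw [prod_absBessel_equal hreneg, Pi.mul_apply, norm_mul _ (Complex.exp _),
        Complex.norm_exp, Complex.re_mul_ofReal, Complex.neg_re]
      ring)
  simp only [← TwoRows.integral_rows, ← integral_const_mul (Complex.exp _), rows_mul_equal,
    hν] at key ⊢
  rw [key]
  -- For fixed reopened variables the integral over both rows splits into one coupled boundary pair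
  -- and single Macdonald integrals.
  simp only [Pi.mul_apply, rows_mul_equal_reflected, integral_const_mul]
  congr 2; ext y; congr 1
  exact TwoRows.integral_prod _
    (fun j => besselIntegrand (Complex.I * rho - Complex.I * mu) (raisingUp x y j.succ)
      (raisingDown x y j))
    (fun j => besselIntegrand (-(Complex.I * rho - Complex.I * mu))
      (snocZero (pairUp y v) j.succ) (pairDown y v j))

end Lower

theorem sum_snocZero_mul {n : ℕ} (f : Fin n → ℝ) (h : Fin (n + 1) → ℝ) :
    ∑ k, snocZero f k * h k = ∑ j, f j * h j.castSucc := by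
  simp [Fin.sum_univ_castSucc]

/-! ### A raising kernel times the reduced Baxter kernel -/

section Shorter

variable {m : ℕ}

/-- The coupling of the intermediate variables to two rows of unequal length from above. -/
def unequalUp (z : Fin (m + 2) → ℝ) (u : Fin (m + 1) → ℝ) (j : Fin (m + 1)) : ℝ :=
  Real.exp (-z j.succ) + snocZero (fun i : Fin m => Real.exp (-u i.succ)) j

theorem unequalUp_pos (z : Fin (m + 2) → ℝ) (u : Fin (m + 1) → ℝ) (j : Fin (m + 1)) :
    0 < unequalUp z u j :=
  add_pos_of_pos_of_nonneg (Real.exp_pos _) (snocZero_nonneg (fun _ => (Real.exp_pos _).le) j)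

theorem measurable_unequalUp (j : Fin (m + 1)) :
    Measurable fun q : TwoRows (m + 1) m => unequalUp (TwoRows.fst q) (TwoRows.snd q) j := by
  have h := measurable_snocZero (Z := TwoRows (m + 1) m)
    (f := fun q (i : Fin m) => Real.exp (-q.2.2 i)) (fun i => by fun_prop) j
  simp only [unequalUp, TwoRows.fst_succ, TwoRows.snd_succ]; fun_prop

theorem measurable_raisingDown (j : Fin (m + 1)) :
    Measurable fun q : TwoRows (m + 1) m => raisingDown (TwoRows.fst q) (TwoRows.snd q) j := by
  have h1 := TwoRows.measurable_fst (n := m + 1) (p := m) j.castSucc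
  have h2 := TwoRows.measurable_snd (n := m + 1) (p := m) j
  unfold raisingDown; fun_prop

/-- Here the last intermediate variable keeps the coefficient e^{-z} of the longer row, so it is
reflected like the others: their number is unchanged and no Gamma function appears. -/
theorem prod_bessel_unequal (ν : ℂ) (z : Fin (m + 2) → ℝ) (u : Fin (m + 1) → ℝ) :
    ∏ j, bessel ν (unequalUp z u j) (raisingDown z u j)
      = Complex.exp (ν * (Real.log (raisingDown z u 0)
          + (∑ j : Fin (m + 1), z j.succ + ∑ i : Fin m, u i.succ) : ℝ)) *
        ∏ j, bessel (-ν) (unequalUp z u j) (raisingDown z u j) := by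
  rw [Fin.prod_univ_castSucc, prod_bessel_reflect ν (e := fun i : Fin m =>
      z i.castSucc.succ + u i.succ) (A := fun i : Fin m => unequalUp z u i.castSucc)
    (fun i => unequalUp_pos z u _) (raisingDown_pos z u) (fun i => ?_),
    bessel_reflect ν (unequalUp_pos z u _) (raisingDown_pos z u _),
    Fin.prod_univ_castSucc (fun j => bessel (-ν) (unequalUp z u j) (raisingDown z u j)),
    mul_mul_mul_comm, ← Complex.exp_add]
  -- The shorter row does not contribute to this last coefficient, and so the telescoping closes up.
  · have : Real.log (unequalUp z u (Fin.last m)) = -z (Fin.last m).succ := by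
      rw [unequalUp, snocZero_last, add_zero, Real.log_exp]
    congr 2
    rw [this, Finset.sum_add_distrib, Fin.sum_univ_castSucc fun j : Fin (m + 1) => z j.succ]
    push_cast; ring
  · rw [unequalUp, snocZero_castSucc, log_exp_neg_add_exp_neg, raisingDown, Fin.castSucc_succ]

theorem prod_absBessel_unequal (s : ℝ) (z : Fin (m + 2) → ℝ) (u : Fin (m + 1) → ℝ) :
    ∏ j, absBessel s (unequalUp z u j) (raisingDown z u j)
      = Real.exp (s * (Real.log (raisingDown z u 0)
          + (∑ j : Fin (m + 1), z j.succ + ∑ i : Fin m, u i.succ))) *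
        ∏ j, absBessel (-s) (unequalUp z u j) (raisingDown z u j) := by
  have := prod_bessel_unequal (s : ℂ) z u
  simp only [← Complex.ofReal_neg, ← ofReal_absBessel] at this
  exact_mod_cast this

theorem rows_mul_unequal (g β : ℝ) (mu rho : ℂ) (x z : Fin (m + 2) → ℝ)
    (y v u : Fin (m + 1) → ℝ) :
    Complex.exp ((Complex.I * rho + Complex.I * mu) * (∑ k, y k : ℝ)) *
      (rowIntegrand g β rho (raisingUp x y) (raisingDown x y) z *
        rowIntegrand g β mu (pairUp y v) (fun i => pairDown y v i.castSucc) u)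
      = rowIntegrand g β rho (fun k => Real.exp (-x k)) (fun j => Real.exp (x j.castSucc)) z *
        rowIntegrand g β mu (fun k => Real.exp (-v k)) (fun i => Real.exp (v i.castSucc)) u *
        ∏ j, besselIntegrand (Complex.I * rho + Complex.I * mu) (unequalUp z u j)
          (raisingDown z u j) (y j) := by
  simp only [rowIntegrand_eq, besselIntegrand]
  rw [← Complex.exp_sum, mul_comm _ (Complex.exp (∑ _, _)), exp_mul_mul_exp, exp_mul_mul_exp]
  congr 2
  simp only [Finset.sum_sub_distrib, ← Finset.mul_sum, ← Complex.ofReal_sum]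
  simp only [raisingUp, raisingDown, pairUp, pairDown, unequalUp, add_mul,
    Finset.sum_add_distrib, sum_snocZero_mul, mul_comm (Real.exp (y _)),
    mul_comm (Real.exp (-y _)), Complex.ofReal_add]
  ring

theorem rows_mul_unequal_reflected (g β : ℝ) (mu rho : ℂ) (x z : Fin (m + 2) → ℝ)
    (y v u : Fin (m + 1) → ℝ) :
    rowIntegrand g β rho (fun k => Real.exp (-x k)) (fun j => Real.exp (x j.castSucc)) z *
        rowIntegrand g β mu (fun k => Real.exp (-v k)) (fun i => Real.exp (v i.castSucc)) u *
        Complex.exp ((Complex.I * rho + Complex.I * mu) * (Real.log (raisingDown z u 0)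
          + (∑ j : Fin (m + 1), z j.succ + ∑ i : Fin m, u i.succ) : ℝ)) *
        ∏ j, besselIntegrand (-(Complex.I * rho + Complex.I * mu)) (unequalUp z u j)
          (raisingDown z u j) (y j)
      = Complex.exp (-(Complex.I * rho + Complex.I * mu) * (∑ k, y k : ℝ)) *
        (coupledIntegrand g β rho mu (raisingUp x y 0) (pairUp y v 0) (z 0, u 0) *
          ((∏ j, besselIntegrand (Complex.I * mu - Complex.I * rho) (raisingUp x y j.succ)
              (raisingDown x y j) (z j.succ)) *
            ∏ i : Fin m, besselIntegrand (-(Complex.I * mu - Complex.I * rho))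
              (pairUp y v i.succ) (pairDown y v i.castSucc) (u i.succ))) := by
  simp only [rowIntegrand_eq, besselIntegrand, coupledIntegrand]
  simp only [← Complex.exp_sum]
  rw [mul_assoc, ← Complex.exp_add, mul_comm _ (Complex.exp (_ + ∑ _, _)), exp_mul_mul_exp,
    exp_mul_exp_mul]
  congr 2
  have e1 := Fin.sum_univ_succ fun k => raisingUp x y k * Real.exp (z k)
  have e2 := Fin.sum_univ_succ fun k => pairUp y v k * Real.exp (u k)
  simp only [Finset.sum_sub_distrib, ← Finset.mul_sum, ← Complex.ofReal_sum]
  simp only [Finset.sum_add_distrib]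
  rw [← sub_eq_iff_eq_add'] at e1 e2
  rw [← e1, ← e2]
  simp only [raisingUp, raisingDown, pairUp, pairDown, unequalUp, add_mul,
    Finset.sum_add_distrib, sum_snocZero_mul, mul_comm (Real.exp (y _)),
    mul_comm (Real.exp (-y _)), Complex.ofReal_add, Complex.ofReal_sub, Fin.sum_univ_succ z,
    Fin.sum_univ_succ u, Fin.castSucc_zero]
  ring

theorem integrable_rows_unequal {g β : ℝ} (hg : 0 < g) (hβ : 0 < β) {mu rho : ℂ}
    (hmu : 0 < mu.im) (hrho : rho.im = 0) (x : Fin (m + 2) → ℝ) (v : Fin (m + 1) → ℝ) :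
    Integrable fun q : TwoRows (m + 1) m =>
      ‖rowIntegrand g β rho (fun k => Real.exp (-x k)) (fun j => Real.exp (x j.castSucc))
          (TwoRows.fst q) *
        rowIntegrand g β mu (fun k => Real.exp (-v k)) (fun i => Real.exp (v i.castSucc))
          (TwoRows.snd q)‖ *
        ∏ j, absBessel (-mu.im) (unequalUp (TwoRows.fst q) (TwoRows.snd q) j)
          (raisingDown (TwoRows.fst q) (TwoRows.snd q) j) := by
  have hI := (TwoRows.integrable_prod
    ((integrable_absBoundaryIntegrand (g := g) (η := 0) hβ (by linarith) 0
      (Real.exp_pos (-x 0))).mul_prod (integrable_absBoundaryIntegrand (g := g) (η := mu.im) hβ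
        (by linarith) mu.im (Real.exp_pos (-v 0))))
    (fun j : Fin (m + 1) => integrable_absBesselIntegrand 0 (Real.exp_pos (-x j.succ))
      (Real.exp_pos (x j.castSucc)))
    (fun i : Fin m => integrable_absBesselIntegrand mu.im (Real.exp_pos (-v i.succ))
      (Real.exp_pos (v i.castSucc)))).const_mul (Real.Gamma mu.im ^ (m + 1))
  have hmeasP := TwoRows.measurable_rows g β rho mu (fun k => Real.exp (-x k))
    (fun j => Real.exp (x j.castSucc)) (fun k => Real.exp (-v k))
    (fun i => Real.exp (v i.castSucc))
  refine hI.mono' (hmeasP.norm.mul (Finset.measurable_prod _ fun k _ => ?_)).aestronglyMeasurable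
    (ae_of_all _ fun q => ?_)
  · exact measurable_absBessel _ (measurable_unequalUp k) (measurable_raisingDown k)
  · rw [Real.norm_of_nonneg (mul_nonneg (norm_nonneg _)
      (Finset.prod_nonneg fun _ _ => absBessel_nonneg ..))]
    have hB : ∀ j, absBessel (-mu.im) (unequalUp (TwoRows.fst q) (TwoRows.snd q) j)
        (raisingDown (TwoRows.fst q) (TwoRows.snd q) j)
        ≤ Real.Gamma mu.im * Real.exp (-(mu.im * TwoRows.snd q j)) := fun j => by
      refine (absBessel_le_right hmu (unequalUp_pos _ _ j).le
        (raisingDown_pos _ _ j)).trans (mul_le_mul_of_nonneg_left (Real.exp_le_exp.2 ?_)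
          (Real.Gamma_pos_of_pos hmu).le)
      have : TwoRows.snd q j ≤ Real.log (raisingDown (TwoRows.fst q) (TwoRows.snd q) j) := by
        rw [Real.le_log_iff_exp_le (raisingDown_pos _ _ j)]
        exact le_add_of_nonneg_left (Real.exp_pos _).le
      nlinarith
    refine (mul_le_mul_of_nonneg_left (Finset.prod_le_prod (fun _ _ => absBessel_nonneg ..)
      fun k _ => hB k) (norm_nonneg _)).trans (le_of_eq ?_)
    rw [norm_mul, norm_rowIntegrand, norm_rowIntegrand, Finset.prod_mul_distrib,
      Fin.prod_univ_succ (fun k => Real.exp (-(mu.im * TwoRows.snd q k)))]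
    simp only [TwoRows.fst_zero, TwoRows.fst_succ, TwoRows.snd_zero, TwoRows.snd_succ,
      Finset.prod_const, Finset.card_univ, Fintype.card_fin, hrho, mul_zero]
    have h1 : ∀ t c, absBoundaryIntegrand g β mu.im mu.im c t
        = absBoundaryIntegrand g β mu.im (2 * mu.im) c t * Real.exp (-(mu.im * t)) :=
      fun t c => by
        rw [absBoundaryIntegrand, absBoundaryIntegrand, mul_assoc, ← Real.exp_add]
        congr 2; ring
    have h2 : ∀ t A B, absBesselIntegrand mu.im A B t
        = absBesselIntegrand (2 * mu.im) A B t * Real.exp (-(mu.im * t)) := fun t A B => by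
      rw [absBesselIntegrand, absBesselIntegrand, ← Real.exp_add]
      congr 1; ring
    simp only [h1, h2, Finset.prod_mul_distrib]
    ring

/-- A raising kernel times the reduced Baxter kernel, with the intermediate variables reflected. -/
theorem integral_rows_unequal {g β : ℝ} (hg : 0 < g) (hβ : 0 < β) {mu rho : ℂ}
    (hmu : 0 < mu.im) (hrho : rho.im = 0) (x : Fin (m + 2) → ℝ) (v : Fin (m + 1) → ℝ) :
    ∫ y : Fin (m + 1) → ℝ, Complex.exp ((Complex.I * rho + Complex.I * mu) * (∑ k, y k : ℝ)) *
      (row g β rho (raisingUp x y) (raisingDown x y) *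
        row g β mu (pairUp y v) (fun i => pairDown y v i.castSucc))
      = ∫ y : Fin (m + 1) → ℝ,
        Complex.exp (-(Complex.I * rho + Complex.I * mu) * (∑ k, y k : ℝ)) *
          (coupledBoundary g β rho mu (raisingUp x y 0) (pairUp y v 0) *
            ((∏ j, bessel (Complex.I * mu - Complex.I * rho) (raisingUp x y j.succ)
              (raisingDown x y j)) *
            ∏ i : Fin m, bessel (-(Complex.I * mu - Complex.I * rho))
              (pairUp y v i.succ) (pairDown y v i.castSucc))) := by
  set ν := Complex.I * rho + Complex.I * mu with hν
  have hre : ν.re = -mu.im := by simp [hν, hrho]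
  have hmeasP := TwoRows.measurable_rows g β rho mu (fun k => Real.exp (-x k))
    (fun j => Real.exp (x j.castSucc)) (fun k => Real.exp (-v k))
    (fun i => Real.exp (v i.castSucc))
  have hI := integrable_rows_unequal hg hβ hmu hrho x v
  rw [← hre] at hI
  have hmeasL : Measurable fun q : TwoRows (m + 1) m =>
      Complex.exp (ν * (Real.log (raisingDown (TwoRows.fst q) (TwoRows.snd q) 0)
        + (∑ j : Fin (m + 1), TwoRows.fst q j.succ + ∑ i : Fin m, TwoRows.snd q i.succ) : ℝ)) := by
    have h0 := measurable_raisingDown (m := m) 0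
    simp only [TwoRows.fst_succ, TwoRows.snd_succ]
    fun_prop
  have key := integral_prod_bessel_reflect hmeasP (hmeasP.mul hmeasL)
    (fun k => measurable_unequalUp k) (fun k => measurable_raisingDown k)
    (fun j => measurable_unequalUp j) (fun j => measurable_raisingDown j)
    (fun q k => integrable_absBesselIntegrand _ (unequalUp_pos _ _ k) (raisingDown_pos _ _ k))
    (fun q j => integrable_absBesselIntegrand _ (unequalUp_pos _ _ j) (raisingDown_pos _ _ _))
    hI (c := 1) (c' := 1)
    (fun q => by rw [prod_bessel_unequal ν, Pi.mul_apply]; ring) one_ne_zero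
    (fun q => by
      rw [prod_absBessel_unequal ν.re, Pi.mul_apply, norm_mul _ (Complex.exp _),
        Complex.norm_exp, Complex.re_mul_ofReal, Complex.neg_re]
      ring)
  simp only [← TwoRows.integral_rows, ← integral_const_mul (Complex.exp _), rows_mul_unequal,
    hν] at key ⊢
  rw [key, one_mul]
  simp only [Pi.mul_apply, rows_mul_unequal_reflected, integral_const_mul]
  congr 1; ext y; congr 1
  exact TwoRows.integral_prod _
    (fun j => besselIntegrand (Complex.I * mu - Complex.I * rho) (raisingUp x y j.succ)
      (raisingDown x y j))
    (fun i : Fin m => besselIntegrand (-(Complex.I * mu - Complex.I * rho))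
      (pairUp y v i.succ) (pairDown y v i.castSucc))

end Shorter

/-! ### The exchange relations -/

theorem integrable_coupledIntegrand {g β : ℝ} (hg : 0 < g) (hβ : 0 < β) {mu rho : ℂ}
    (hmu : 0 < mu.im) (hrho : rho.im = 0) {a b : ℝ} (ha : 0 < a) (hb : 0 ≤ b) :
    Integrable (coupledIntegrand g β mu rho a b) := by
  have hI : Integrable fun w : ℝ × ℝ => absBoundaryIntegrand g β mu.im (2 * mu.im) a w.1 *
      absBoundaryIntegrand g β 0 (-mu.im) b w.2 := by
    refine (integrable_absBoundaryIntegrand hβ (by linarith) _ ha).mul_prod ?_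
    rcases hb.eq_or_lt with h | h
    · rw [← h]; exact integrable_absBoundaryIntegrand_zero hβ (by linarith) (by linarith)
    · exact integrable_absBoundaryIntegrand hβ (by linarith) _ h
  refine hI.mono' ?_ (ae_of_all _ fun w => ?_)
  · refine Measurable.aestronglyMeasurable ?_
    unfold coupledIntegrand
    exact (((measurable_weight g β mu).comp measurable_fst).mul
      ((measurable_weight g β rho).comp measurable_snd)).mul (by fun_prop)
  · have hre : (-(2 * Complex.I * mu) * w.1 - 2 * Complex.I * rho * w.2
        + (Complex.I * mu + Complex.I * rho) * (Real.log (Real.exp w.1 + Real.exp w.2) : ℝ)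
        - ((a * Real.exp w.1 + b * Real.exp w.2 : ℝ) : ℂ)).re
        = 2 * mu.im * w.1 - mu.im * Real.log (Real.exp w.1 + Real.exp w.2)
          - (a * Real.exp w.1 + b * Real.exp w.2) := by
      rw [Complex.sub_re, Complex.add_re, Complex.sub_re, Complex.re_mul_ofReal,
        Complex.re_mul_ofReal, Complex.re_mul_ofReal, Complex.ofReal_re]
      simp [hrho]
      ring
    rw [coupledIntegrand, norm_mul, norm_mul, norm_weight, norm_weight, Complex.norm_exp, hre,
      hrho, absBoundaryIntegrand, absBoundaryIntegrand, mul_mul_mul_comm, ← Real.exp_add]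
    refine mul_le_mul_of_nonneg_left (Real.exp_le_exp.2 ?_)
      (mul_nonneg (absWeight_nonneg ..) (absWeight_nonneg ..))
    -- As Im μ > 0, the coupling supplies the factor e^{-(Im μ)u}, which makes b = 0 admissible.
    have : w.2 ≤ Real.log (Real.exp w.1 + Real.exp w.2) := by
      rw [Real.le_log_iff_exp_le (by positivity)]
      exact le_add_of_nonneg_left (Real.exp_pos _).le
    nlinarith

theorem integrable_coupledIntegrand_swap {g β : ℝ} (hg : 0 < g) (hβ : 0 < β) {mu rho : ℂ}
    (hmu : 0 < mu.im) (hrho : rho.im = 0) {a b : ℝ} (ha : 0 ≤ a) (hb : 0 < b) :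
    Integrable (coupledIntegrand g β rho mu a b) := by
  have := (integrable_coupledIntegrand hg hβ hmu hrho hb ha).swap
  exact this.congr (ae_of_all _ fun p => coupledIntegrand_swap g β mu rho b a p)

theorem log_raisingDown {n : ℕ} (x : Fin (n + 1) → ℝ) (y : Fin n → ℝ) (j : Fin n) :
    Real.log (raisingDown x y j)
      = Real.log (raisingUp x y j.castSucc) + (x j.castSucc + y j) := by
  rw [raisingUp, snocZero_castSucc, log_exp_neg_add_exp_neg, raisingDown]; ring

/-- Reflection of all indices in the row of a raising kernel. -/
theorem prod_bessel_raising {n : ℕ} (ν : ℂ) (x : Fin (n + 1) → ℝ) (y : Fin n → ℝ) :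
    ∏ j, bessel ν (raisingUp x y j.succ) (raisingDown x y j)
      = Complex.exp (ν * (∑ k, x k + ∑ j, y j + Real.log (raisingUp x y 0) : ℝ)) *
        ∏ j, bessel (-ν) (raisingUp x y j.succ) (raisingDown x y j) := by
  simp only [fun j => bessel_reflect ν (raisingUp_pos x y (Fin.succ j)) (raisingDown_pos x y j),
    Finset.prod_mul_distrib]
  rw [← Complex.exp_sum, ← Finset.mul_sum, ← Complex.ofReal_sum]
  congr 4
  have e1 := Fin.sum_univ_castSucc fun k => Real.log (raisingUp x y k)
  have e2 := Fin.sum_univ_succ fun k => Real.log (raisingUp x y k)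
  have e3 : Real.log (raisingUp x y (Fin.last n)) = -x (Fin.last n) := by
    rw [raisingUp, snocZero_last, add_zero, Real.log_exp]
  simp only [Finset.sum_sub_distrib, log_raisingDown, Finset.sum_add_distrib,
    Fin.sum_univ_castSucc x]
  linarith

/-- Both rows are reflected and the coupled boundary transform is swapped; the powers of the two
boundary coefficients cancel. The last variable of the second row has no term e^{u} and yields the
Gamma factor, Γ(iλ+ir) when μ = -λ and ρ = r. -/
theorem coupled_exchange {g β : ℝ} (hg : 0 < g) (hβ : 0 < β) {mu rho : ℂ} (hmu : 0 < mu.im)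
    (hrho : rho.im = 0) {m : ℕ} (x : Fin (m + 2) → ℝ) (y v : Fin (m + 1) → ℝ) :
    coupledBoundary g β mu rho (raisingUp x y 0) (snocZero (pairUp y v) 0) *
        ((∏ j, bessel (Complex.I * rho - Complex.I * mu) (raisingUp x y j.succ)
            (raisingDown x y j)) *
          ∏ j, bessel (-(Complex.I * rho - Complex.I * mu)) (snocZero (pairUp y v) j.succ)
            (pairDown y v j))
      = Complex.Gamma (Complex.I * rho - Complex.I * mu) *
        Complex.exp ((Complex.I * rho - Complex.I * mu) * (∑ k, x k - ∑ k, v k : ℝ)) *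
        (coupledBoundary g β rho mu (raisingUp x y 0) (pairUp y v 0) *
          ((∏ j, bessel (Complex.I * mu - Complex.I * rho) (raisingUp x y j.succ)
            (raisingDown x y j)) *
          ∏ i : Fin m, bessel (-(Complex.I * mu - Complex.I * rho)) (pairUp y v i.succ)
            (pairDown y v i.castSucc))) := by
  have hre : 0 < (Complex.I * rho - Complex.I * mu).re := by simp [hrho]; exact hmu
  rw [prod_bessel_raising, prod_bessel_pair hre, ← Fin.castSucc_zero, snocZero_castSucc,
    Fin.castSucc_zero, neg_sub, neg_sub, ← coupledBoundary_swap hβ (raisingUp_pos x y 0)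
      (pairUp_pos y v 0) (integrable_coupledIntegrand hg hβ hmu hrho (raisingUp_pos x y 0)
        (pairUp_pos y v 0).le) (integrable_coupledIntegrand_swap hg hβ hmu hrho
          (raisingUp_pos x y 0).le (pairUp_pos y v 0))]
  set κ := Complex.I * rho - Complex.I * mu with hκ
  have he : Complex.exp (κ * (∑ k, x k + ∑ j, y j + Real.log (raisingUp x y 0) : ℝ)) *
      (Complex.exp (-κ * (∑ k, y k + ∑ j, v j : ℝ)) *
        Complex.exp (-(κ * (Real.log (pairUp y v 0) : ℝ))))
      = Complex.exp (κ * (∑ k, x k - ∑ k, v k : ℝ)) *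
        Complex.exp (κ * (Real.log (raisingUp x y 0) - Real.log (pairUp y v 0) : ℝ)) := by
    simp only [← Complex.exp_add]
    congr 1; push_cast; ring
  rw [show Complex.I * mu - Complex.I * rho = -κ by rw [hκ]; ring] at *
  linear_combination (coupledBoundary g β mu rho (raisingUp x y 0) (pairUp y v 0) *
    Complex.Gamma κ * (∏ j, bessel (-κ) (raisingUp x y j.succ) (raisingDown x y j)) *
    ∏ i : Fin m, bessel κ (pairUp y v i.succ) (pairDown y v i.castSucc)) * he

/-- The kernel of the reduced Baxter operator composed with a raising operator. -/
theorem reduced_mul_raising {g β : ℝ} (hg : 0 < g) (hβ : 0 < β) {lam : ℂ} (hlam : lam.im < 0)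
    (r : ℝ) (n : ℕ) (x : Fin (n + 1) → ℝ) (v : Fin n → ℝ) :
    ∫ y, reducedBaxterKernel g β n lam x y * raisingKernel g β n r y v
      = (2 * (β : ℂ)) ^ (-(Complex.I * lam)) / Complex.Gamma ((g : ℂ) + Complex.I * lam) *
        ((2 * (β : ℂ)) ^ (Complex.I * r) / Complex.Gamma ((g : ℂ) - Complex.I * r)) *
        Complex.exp (-(Complex.I * lam) * (∑ k, x k : ℝ) + Complex.I * r * (∑ k, v k : ℝ)) *
        (Complex.Gamma (Complex.I * lam - Complex.I * r) *
        ∫ y : Fin n → ℝ, Complex.exp (-(Complex.I * -lam + Complex.I * r) * (∑ k, y k : ℝ)) *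
          (coupledBoundary g β (-lam) r (raisingUp x y 0) (snocZero (pairUp y v) 0) *
            ((∏ j, bessel (Complex.I * r - Complex.I * -lam) (raisingUp x y j.succ)
              (raisingDown x y j)) *
            ∏ j, bessel (-(Complex.I * r - Complex.I * -lam))
              (snocZero (pairUp y v) j.succ) (pairDown y v j)))) := by
  have h := integral_rows_equal hg hβ (mu := -lam) (rho := r) (by simpa using hlam) (by simp) x v
  rw [show -(Complex.I * -lam + Complex.I * (r : ℂ)) = Complex.I * lam - Complex.I * r by ring]
    at h ⊢
  rw [← h, ← integral_const_mul]
  congr 1; ext y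
  rw [reducedBaxterKernel_eq hβ, raisingKernel_eq hβ]
  have he : Complex.exp (-(Complex.I * lam) * (∑ k, x k + ∑ j, y j : ℝ)) *
      Complex.exp (Complex.I * r * (∑ k, y k + ∑ j, v j : ℝ))
      = Complex.exp (-(Complex.I * lam) * (∑ k, x k : ℝ) + Complex.I * r * (∑ k, v k : ℝ)) *
        Complex.exp ((Complex.I * -lam + Complex.I * r) * (∑ k, y k : ℝ)) := by
    simp only [← Complex.exp_add]
    congr 1; push_cast; ring
  linear_combination ((2 * (β : ℂ)) ^ (-(Complex.I * lam)) /
    Complex.Gamma ((g : ℂ) + Complex.I * lam) *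
    ((2 * (β : ℂ)) ^ (Complex.I * r) / Complex.Gamma ((g : ℂ) - Complex.I * r)) *
    (row g β (-lam) (pairUp x y) (fun j => pairDown x y j.castSucc) *
        row g β r (raisingUp y v) (raisingDown y v))) * he

/-- The kernel of a raising operator composed with the reduced Baxter operator. -/
theorem raising_mul_reduced {g β : ℝ} (hg : 0 < g) (hβ : 0 < β) {lam : ℂ} (hlam : lam.im < 0)
    (r : ℝ) (m : ℕ) (x : Fin (m + 2) → ℝ) (v : Fin (m + 1) → ℝ) :
    ∫ y, raisingKernel g β (m + 1) r x y * reducedBaxterKernel g β m lam y v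
      = (2 * (β : ℂ)) ^ (-(Complex.I * lam)) / Complex.Gamma ((g : ℂ) + Complex.I * lam) *
        ((2 * (β : ℂ)) ^ (Complex.I * r) / Complex.Gamma ((g : ℂ) - Complex.I * r)) *
        Complex.exp (Complex.I * r * (∑ k, x k : ℝ) + -(Complex.I * lam) * (∑ k, v k : ℝ)) *
        ∫ y : Fin (m + 1) → ℝ,
          Complex.exp (-(Complex.I * r + Complex.I * -lam) * (∑ k, y k : ℝ)) *
          (coupledBoundary g β r (-lam) (raisingUp x y 0) (pairUp y v 0) *
            ((∏ j, bessel (Complex.I * -lam - Complex.I * r) (raisingUp x y j.succ)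
              (raisingDown x y j)) *
            ∏ i : Fin m, bessel (-(Complex.I * -lam - Complex.I * r))
              (pairUp y v i.succ) (pairDown y v i.castSucc))) := by
  rw [← integral_rows_unequal hg hβ (mu := -lam) (rho := r) (by simpa using hlam) (by simp) x v,
    ← integral_const_mul]
  congr 1; ext y
  rw [reducedBaxterKernel_eq hβ, raisingKernel_eq hβ]
  have he : Complex.exp (Complex.I * r * (∑ k, x k + ∑ j, y j : ℝ)) *
      Complex.exp (-(Complex.I * lam) * (∑ k, y k + ∑ j, v j : ℝ))
      = Complex.exp (Complex.I * r * (∑ k, x k : ℝ) + -(Complex.I * lam) * (∑ k, v k : ℝ)) *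
        Complex.exp ((Complex.I * r + Complex.I * -lam) * (∑ k, y k : ℝ)) := by
    simp only [← Complex.exp_add]
    congr 1; push_cast; ring
  linear_combination ((2 * (β : ℂ)) ^ (-(Complex.I * lam)) /
    Complex.Gamma ((g : ℂ) + Complex.I * lam) *
    ((2 * (β : ℂ)) ^ (Complex.I * r) / Complex.Gamma ((g : ℂ) - Complex.I * r)) *
    (row g β r (raisingUp x y) (raisingDown x y) *
        row g β (-lam) (pairUp y v) (fun i => pairDown y v i.castSucc))) * he

/-- The exchange relation between the kernels of the reduced Baxter and raising operators. -/
theorem kernel_exchange {g β : ℝ} (hg : 0 < g) (hβ : 0 < β) {lam : ℂ} (hlam : lam.im < 0)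
    (r : ℝ) (m : ℕ) (x : Fin (m + 2) → ℝ) (v : Fin (m + 1) → ℝ) :
    ∫ y, reducedBaxterKernel g β (m + 1) lam x y * raisingKernel g β (m + 1) r y v
      = Complex.Gamma (Complex.I * lam + Complex.I * r) *
        Complex.Gamma (Complex.I * lam - Complex.I * r) *
        ∫ y, raisingKernel g β (m + 1) r x y * reducedBaxterKernel g β m lam y v := by
  rw [reduced_mul_raising hg hβ hlam, raising_mul_reduced hg hβ hlam]
  simp only [coupled_exchange hg hβ (mu := -lam) (rho := r) (by simpa using hlam) (by simp),
    mul_left_comm (Complex.exp _) (Complex.Gamma _ * Complex.exp _)]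
  rw [integral_const_mul, show Complex.I * (r : ℂ) - Complex.I * -lam
    = Complex.I * lam + Complex.I * r by ring, add_comm (Complex.I * -lam)]
  have he : Complex.exp (-(Complex.I * lam) * (∑ k, x k : ℝ) + Complex.I * r * (∑ k, v k : ℝ)) *
      Complex.exp ((Complex.I * lam + Complex.I * r) * (∑ k, x k - ∑ k, v k : ℝ))
      = Complex.exp (Complex.I * r * (∑ k, x k : ℝ) + -(Complex.I * lam) * (∑ k, v k : ℝ)) := by
    rw [← Complex.exp_add]; congr 1; push_cast; ring
  rw [← he]
  ring

/-- The exchange relation for the kernels of one particle. -/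
theorem kernel_exchange_one {g β : ℝ} (hg : 0 < g) (hβ : 0 < β) {lam : ℂ} (hlam : lam.im < 0)
    (r : ℝ) (x : Fin 1 → ℝ) (v : Fin 0 → ℝ) :
    ∫ y, reducedBaxterKernel g β 0 lam x y * raisingKernel g β 0 r y v
      = (2 * (β : ℂ)) ^ (-(Complex.I * lam)) / Complex.Gamma ((g : ℂ) + Complex.I * lam) *
        (Complex.Gamma (Complex.I * lam + Complex.I * r) *
        Complex.Gamma (Complex.I * lam - Complex.I * r)) * raisingKernel g β 0 r x v := by
  -- With one particle no intermediate variable survives the reflection, and the second boundary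
  -- coefficient is the final zero of the extended empty tuple.
  have hz : ∀ f : Fin 0 → ℝ, snocZero f 0 = 0 := fun f => snocZero_last f
  rw [reduced_mul_raising hg hβ hlam, raisingKernel_eq hβ, integral_unique]
  simp only [row, raisingUp, hz, Finset.univ_eq_empty, Finset.prod_empty, Finset.sum_empty,
    add_zero, mul_one, Complex.ofReal_zero, mul_zero, Complex.exp_zero, one_mul]
  rw [coupledBoundary_zero hβ (Real.exp_pos _) (by simpa using hlam)
    (integrable_coupledIntegrand hg hβ (by simpa using hlam) (by simp) (Real.exp_pos _) le_rfl),
    Real.log_exp, show Complex.I * (r : ℂ) - Complex.I * -lam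
    = Complex.I * lam + Complex.I * r by ring]
  have he : Complex.exp (-(Complex.I * lam) * (∑ k, x k : ℝ)) *
      Complex.exp (-((Complex.I * lam + Complex.I * r) * (-x 0 : ℝ)))
      = Complex.exp (Complex.I * r * (∑ k, x k : ℝ)) := by
    rw [← Complex.exp_add]; congr 1; simp; ring
  have hvol : (volume : Measure (Fin 0 → ℝ)).real Set.univ = 1 := by
    simp [Measure.real, volume_pi]
  rw [← he, hvol, one_smul]
  ring

/-! ### Convergence and eigenvalues -/

/-- The constant 1 is a function of no variables, hence bounded for every s, and each raising
operator preserves the bound. That s > 0 may be arbitrarily small lets Q' act for every Im λ < 0. -/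
theorem expBounded_waveFunction {g β s : ℝ} (hg : 0 < g) (hβ : 0 < β) (hs : 0 < s) (n : ℕ)
    (lams : Fin n → ℝ) : ExpBounded s (waveFunction g β n lams) := by
  induction n with
  | zero => exact ⟨measurable_const, 1, zero_le_one, fun y => by simp [waveFunction]⟩
  | succ n ih => exact (localKernel_raisingKernel hg hβ hs n (lams (Fin.last n))).expBounded (ih _)

theorem waveFunctionConverges {g β : ℝ} (hg : 0 < g) (hβ : 0 < β) (n : ℕ) (lams : Fin n → ℝ) :
    WaveFunctionConverges g β n lams := by
  induction n with
  | zero => trivial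
  | succ n ih =>
    exact ⟨ih _, fun x => ⟨integrable_raisingIntegrand hβ (by simpa using hg) x,
      ((localKernel_raisingKernel hg hβ one_pos n (lams (Fin.last n))).integrable_and_le
        (expBounded_waveFunction hg hβ one_pos n _)).1 x⟩⟩

theorem reducedBaxterConverges {g β : ℝ} (hg : 0 < g) (hβ : 0 < β) (n : ℕ)
    (lams : Fin (n + 1) → ℝ) {lam : ℂ} (hlam : lam.im < 0) :
    ReducedBaxterConverges g β n lam (waveFunction g β (n + 1) lams) := fun x =>
  ⟨integrable_reducedBaxterIntegrand hβ (by linarith) x,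
    ((localKernel_reducedBaxterKernel (s := -lam.im / 2) hg hβ (by linarith) n
      (by linarith)).integrable_and_le
        (expBounded_waveFunction hg hβ (by linarith) (n + 1) lams)).1 x⟩

/-- The wave functions are eigenfunctions of the reduced Baxter operator. -/
theorem reducedBaxterOp_waveFunction {g β : ℝ} (hg : 0 < g) (hβ : 0 < β) {lam : ℂ}
    (hlam : lam.im < 0) (n : ℕ) (lams : Fin (n + 1) → ℝ) (x : Fin (n + 1) → ℝ) :
    reducedBaxterOp g β n lam (waveFunction g β (n + 1) lams) x
      = (2 * (β : ℂ)) ^ (-(Complex.I * lam)) / Complex.Gamma ((g : ℂ) + Complex.I * lam) *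
        (∏ j, Complex.Gamma (Complex.I * lam + Complex.I * (lams j : ℂ)) *
          Complex.Gamma (Complex.I * lam - Complex.I * (lams j : ℂ))) *
        waveFunction g β (n + 1) lams x := by
  have hs : 0 < -lam.im / 2 := by linarith
  have hs' : -lam.im / 2 < -lam.im := by linarith
  induction n with
  | zero =>
    have h := (localKernel_reducedBaxterKernel hg hβ hs 0 hs').comp_apply
      (localKernel_raisingKernel hg hβ hs 0 (lams (Fin.last 0)))
      (expBounded_waveFunction hg hβ hs 0 fun j => lams j.castSucc) x
    simp only [kernel_exchange_one hg hβ hlam] at h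
    refine h.trans ?_
    simp only [mul_assoc, integral_const_mul, Fin.prod_univ_succ, Finset.univ_eq_empty,
      Finset.prod_empty, mul_one]
    rfl
  | succ m ih =>
    have hφ := expBounded_waveFunction hg hβ hs (m + 1) fun j => lams j.castSucc
    have h := (localKernel_reducedBaxterKernel hg hβ hs (m + 1) hs').comp_apply
      (localKernel_raisingKernel hg hβ hs (m + 1) (lams (Fin.last (m + 1)))) hφ x
    have h' := (localKernel_raisingKernel hg hβ hs (m + 1) (lams (Fin.last (m + 1)))).comp_apply
      (localKernel_reducedBaxterKernel hg hβ hs m hs') hφ x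
    -- Composing on the left, exchanging the kernels and decomposing on the right moves Q' past the
    -- outermost raising operator; the induction hypothesis then applies inside the integral.
    simp only [kernel_exchange hg hβ hlam, mul_assoc _ (integral _ _), integral_const_mul] at h
    refine h.trans ?_
    rw [← h', Fin.prod_univ_castSucc]
    have ih' := fun y => ih (fun j => lams j.castSucc) y
    simp only [reducedBaxterOp] at ih'
    simp only [ih', mul_left_comm (raisingKernel _ _ _ _ _ _), integral_const_mul]
    change _ = _ * ∫ y, raisingKernel g β (m + 1) _ x y * _
    ring

theorem baxterOp_eq {g β : ℝ} (hβ : 0 < β) (n : ℕ) {lam : ℂ} (h1 : -g < lam.im)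
    (h2 : lam.im < 0) (φ : (Fin (n + 1) → ℝ) → ℂ) (x : Fin (n + 1) → ℝ) :
    baxterOp g β (n + 1) lam φ x
      = Complex.Gamma (2 * Complex.I * lam) * reducedBaxterOp g β n lam φ x := by
  simp only [baxterOp, reducedBaxterOp, baxterKernel_eq hβ n h1 h2, mul_assoc,
    integral_const_mul]

theorem baxterConverges {g β : ℝ} (hβ : 0 < β) {n : ℕ} {lam : ℂ} (h1 : -g < lam.im)
    (h2 : lam.im < 0) {φ : (Fin (n + 1) → ℝ) → ℂ} (h : ReducedBaxterConverges g β n lam φ) :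
    BaxterConverges g β (n + 1) lam φ := fun x =>
  ⟨integrable_baxterIntegrand hβ h1 h2 x, by
    simp only [baxterKernel_eq hβ n h1 h2, mul_assoc]
    exact (h x).2.const_mul _⟩

end

end BCToda

theorem theorem2p2 (g β : ℝ) (hg : 0 < g) (hβ : 0 < β) (n : ℕ) (lams : Fin (n + 1) → ℝ) :
    BCToda.WaveFunctionConverges g β (n + 1) lams ∧
    (∀ lam : ℂ, -g < lam.im → lam.im < 0 →
      BCToda.BaxterConverges g β (n + 1) lam (BCToda.waveFunction g β (n + 1) lams) ∧
      ∀ x : Fin (n + 1) → ℝ,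
        BCToda.baxterOp g β (n + 1) lam (BCToda.waveFunction g β (n + 1) lams) x =
          (2 * (β : ℂ)) ^ (-(Complex.I * lam)) * Complex.Gamma (2 * Complex.I * lam) /
              Complex.Gamma ((g : ℂ) + Complex.I * lam) *
            (∏ j, Complex.Gamma (Complex.I * lam + Complex.I * (lams j : ℂ)) *
              Complex.Gamma (Complex.I * lam - Complex.I * (lams j : ℂ))) *
            BCToda.waveFunction g β (n + 1) lams x) ∧
    (∀ lam : ℂ, lam.im < 0 →
      BCToda.ReducedBaxterConverges g β n lam (BCToda.waveFunction g β (n + 1) lams) ∧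
      ∀ x : Fin (n + 1) → ℝ,
        BCToda.reducedBaxterOp g β n lam (BCToda.waveFunction g β (n + 1) lams) x =
          (2 * (β : ℂ)) ^ (-(Complex.I * lam)) /
              Complex.Gamma ((g : ℂ) + Complex.I * lam) *
            (∏ j, Complex.Gamma (Complex.I * lam + Complex.I * (lams j : ℂ)) *
              Complex.Gamma (Complex.I * lam - Complex.I * (lams j : ℂ))) *
            BCToda.waveFunction g β (n + 1) lams x) := by
  refine ⟨BCToda.waveFunctionConverges hg hβ (n + 1) lams, fun lam h1 h2 => ?_, fun lam h => ?_⟩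
  · refine ⟨BCToda.baxterConverges hβ h1 h2 (BCToda.reducedBaxterConverges hg hβ n lams h2),
      fun x => ?_⟩
    rw [BCToda.baxterOp_eq hβ n h1 h2, BCToda.reducedBaxterOp_waveFunction hg hβ h2]
    ring
  · exact ⟨BCToda.reducedBaxterConverges hg hβ n lams h,
      BCToda.reducedBaxterOp_waveFunction hg hβ h n lams⟩
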